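/- Let $M$ be a smooth manifold (Hausdorff, second countable, without boundary, not necessarily compact or complete) of dimension $n\ge 3$, and let $g$ be a smooth Riemannian metric on $M$ with volume measure $dV$, Riemann tensor $R_{ikjl}$ (with the sign for which $R_{ikjl}=g_{ij}g_{kl}-g_{il}g_{kj}$ on the unit sphere), Ricci tensor $Ric$, scalar curvature $R$, trace-less Ricci tensor $E=Ric-\frac1n Rg$ and Schouten tensor $A=\frac1{n-2}\big(Ric-\frac{1}{2(n-1)}Rg\big)$. Let $\sigma_2(A)$ be the second elementary symmetric function of the eigenvalues of $A$ with respect to $g$, and put $$\mathcal F_t(g)=\int|Ric|^2\,dV+t\int R^2\,dV\quad(t\in\mathbb R),\qquad \mathscr F_2(g)=\int\sigma_2(A)\,dV .$$ Call $g$ critical for one of these functionals $F$ if, for every smooth symmetric two-tensor $h$ vanishing outside a compact set $K\subset M$, the function $s\mapsto F(g+sh)$, with the integrals extended over $K$ only, has derivative $0$ at $s=0$. All contractions below are with respect to $g$, $\Delta=g^{kl}\nabla_l\nabla_k$, and $(E\circ E)_{ij}=E_{ip}E_{jp}$. (a) For every $t\in\mathbb R$, $g$ is critical for $\mathcal F_t$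 if and only if, on all of $M$, $$\Delta E_{ij}=(1+2t)\nabla^2_{ij}R-\tfrac{n+2+4nt}{2n}(\Delta R)g_{ij}-2R_{ikjl}E_{kl}-\tfrac{2+2nt}{n}RE_{ij}+\tfrac12\Big(|Ric|^2-\tfrac{4-n(n-4)t}{n^2}R^2\Big)g_{ij},$$ $$\big(n+4(n-1)t\big)\Delta R=(n-4)\big(|Ric|^2+tR^2\big).$$ (b) If $n=3$, then $g$ is critical for $\mathscr F_2$ if and only if, on all of $M$, $$\Delta E=\tfrac14\nabla^2R-\tfrac1{12}(\Delta R)g+4E\circ E+\tfrac5{12}RE-\tfrac12\Big(3|E|^2-\tfrac1{72}R^2\Big)g,$$ $$-2\sigma_2(A)=|Ric|^2-\tfrac38R^2=|E|^2-\tfrac1{24}R^2=0 .$$ -/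

import Mathlib

open scoped Manifold ContDiff Bundle

noncomputable section

namespace QuadraticCurvature

open MeasureTheory

/-! ### Tensor calculus in coordinates

Below `G : ℝⁿ → Matrix` is the matrix `g_{ij}` of the components of a metric in a coordinate system,
as a function of the coordinates. Two-tensors are matrices of functions as well. -/

section Coordinates

variable {n : ℕ}

/-- The partial derivative `∂_i f` at `y`. -/
def pd (i : Fin n) (f : EuclideanSpace ℝ (Fin n) → ℝ) (y : EuclideanSpace ℝ (Fin n)) : ℝ :=
  fderiv ℝ f y (EuclideanSpace.single i 1)

/-- The Christoffel symbol `Γ^k_{ij} = ½ g^{kl} (∂_i g_{jl} + ∂_j g_{il} - ∂_l g_{ij})`. -/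
def christoffel (G : EuclideanSpace ℝ (Fin n) → Matrix (Fin n) (Fin n) ℝ) (k i j : Fin n)
    (y : EuclideanSpace ℝ (Fin n)) : ℝ :=
  (1 / 2) * ∑ l, (G y)⁻¹ k l *
    (pd i (fun z => G z j l) y + pd j (fun z => G z i l) y - pd l (fun z => G z i j) y)

/-- The components `R_{ijk}^l` of the curvature, `R(∂_i, ∂_j) ∂_k = R_{ijk}^l ∂_l`, where
`R(X, Y) = ∇_X ∇_Y - ∇_Y ∇_X - ∇_{[X, Y]}`. -/
def curv (G : EuclideanSpace ℝ (Fin n) → Matrix (Fin n) (Fin n) ℝ) (i j k l : Fin n)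
    (y : EuclideanSpace ℝ (Fin n)) : ℝ :=
  pd i (christoffel G l j k) y - pd j (christoffel G l i k) y +
    ∑ m, (christoffel G l i m y * christoffel G m j k y -
      christoffel G l j m y * christoffel G m i k y)

/-- The Riemann tensor `R_{ijkl} = g(R(∂_i, ∂_j) ∂_l, ∂_k)`; the sign is such that
`R_{ijkl} = g_{ik} g_{jl} - g_{il} g_{jk}` on the unit sphere. -/
def riem (G : EuclideanSpace ℝ (Fin n) → Matrix (Fin n) (Fin n) ℝ) (i j k l : Fin n)
    (y : EuclideanSpace ℝ (Fin n)) : ℝ :=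
  ∑ m, G y k m * curv G i j l m y

/-- The Ricci tensor, `Ric(Y, Z) = tr (X ↦ R(X, Y) Z)`. -/
def ric (G : EuclideanSpace ℝ (Fin n) → Matrix (Fin n) (Fin n) ℝ)
    (y : EuclideanSpace ℝ (Fin n)) : Matrix (Fin n) (Fin n) ℝ :=
  Matrix.of fun i j => ∑ k, curv G k i j k y

/-- The scalar curvature `R = g^{ij} R_{ij}`. -/
def scal (G : EuclideanSpace ℝ (Fin n) → Matrix (Fin n) (Fin n) ℝ)
    (y : EuclideanSpace ℝ (Fin n)) : ℝ :=
  ∑ i, ∑ j, (G y)⁻¹ i j * ric G y i j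

/-- The trace-less Ricci tensor `E = Ric - (1/n) R g`. -/
def tracelessRic (G : EuclideanSpace ℝ (Fin n) → Matrix (Fin n) (Fin n) ℝ)
    (y : EuclideanSpace ℝ (Fin n)) : Matrix (Fin n) (Fin n) ℝ :=
  ric G y - (scal G y / n) • G y

/-- The Schouten tensor `A = (1/(n-2)) (Ric - (1/(2(n-1))) R g)`. -/
def schouten (G : EuclideanSpace ℝ (Fin n) → Matrix (Fin n) (Fin n) ℝ)
    (y : EuclideanSpace ℝ (Fin n)) : Matrix (Fin n) (Fin n) ℝ :=
  (1 / ((n : ℝ) - 2)) • (ric G y - (scal G y / (2 * ((n : ℝ) - 1))) • G y)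

/-- The second elementary symmetric function of the eigenvalues of the two-tensor `T` with respect
to the metric, that is of the endomorphism `g^{ik} T_{kj}`. -/
def sigmaTwo (G T : EuclideanSpace ℝ (Fin n) → Matrix (Fin n) (Fin n) ℝ)
    (y : EuclideanSpace ℝ (Fin n)) : ℝ :=
  ((G y)⁻¹ * T y).charpoly.roots.esymm 2

/-- The squared norm `|T|² = g^{ik} g^{jl} T_{ij} T_{kl}`. -/
def normSq (G T : EuclideanSpace ℝ (Fin n) → Matrix (Fin n) (Fin n) ℝ)
    (y : EuclideanSpace ℝ (Fin n)) : ℝ :=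
  ∑ i, ∑ j, ∑ k, ∑ l, (G y)⁻¹ i k * (G y)⁻¹ j l * T y i j * T y k l

/-- The composition `(S ∘ T)_{ij} = g^{pq} S_{ip} T_{qj}` of two-tensors. -/
def comp (G S T : EuclideanSpace ℝ (Fin n) → Matrix (Fin n) (Fin n) ℝ) (i j : Fin n)
    (y : EuclideanSpace ℝ (Fin n)) : ℝ :=
  ∑ p, ∑ q, (G y)⁻¹ p q * S y i p * T y q j

/-- The contraction `R_{ikjl} T_{kl}` with the Riemann tensor (indices raised with the metric). -/
def riemContract (G T : EuclideanSpace ℝ (Fin n) → Matrix (Fin n) (Fin n) ℝ) (i j : Fin n)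
    (y : EuclideanSpace ℝ (Fin n)) : ℝ :=
  ∑ k, ∑ l, ∑ p, ∑ q, (G y)⁻¹ k p * (G y)⁻¹ l q * riem G i k j l y * T y p q

/-- The Hessian `∇²_{ij} f = ∂_i ∂_j f - Γ^k_{ij} ∂_k f`. -/
def hess (G : EuclideanSpace ℝ (Fin n) → Matrix (Fin n) (Fin n) ℝ)
    (f : EuclideanSpace ℝ (Fin n) → ℝ) (i j : Fin n) (y : EuclideanSpace ℝ (Fin n)) : ℝ :=
  pd i (pd j f) y - ∑ k, christoffel G k i j y * pd k f y

/-- The Laplacian `Δ f = g^{ij} ∇²_{ij} f` of a function. -/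
def lap (G : EuclideanSpace ℝ (Fin n) → Matrix (Fin n) (Fin n) ℝ)
    (f : EuclideanSpace ℝ (Fin n) → ℝ) (y : EuclideanSpace ℝ (Fin n)) : ℝ :=
  ∑ i, ∑ j, (G y)⁻¹ i j * hess G f i j y

/-- The covariant derivative `∇_k T_{ij}` of a two-tensor. -/
def covDeriv (G T : EuclideanSpace ℝ (Fin n) → Matrix (Fin n) (Fin n) ℝ) (k i j : Fin n)
    (y : EuclideanSpace ℝ (Fin n)) : ℝ :=
  pd k (fun z => T z i j) y -
    ∑ m, (christoffel G m k i y * T y m j + christoffel G m k j y * T y i m)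

/-- The second covariant derivative `∇_l ∇_k T_{ij}` of a two-tensor, that is, the covariant
derivative in the direction `∂_l` of the three-tensor `∇_k T_{ij}`. -/
def covDeriv2 (G T : EuclideanSpace ℝ (Fin n) → Matrix (Fin n) (Fin n) ℝ) (l k i j : Fin n)
    (y : EuclideanSpace ℝ (Fin n)) : ℝ :=
  pd l (covDeriv G T k i j) y -
    ∑ m, (christoffel G m l k y * covDeriv G T m i j y +
      christoffel G m l i y * covDeriv G T k m j y +
      christoffel G m l j y * covDeriv G T k i m y)

/-- The (rough) Laplacian `Δ T_{ij} = g^{kl} ∇_l ∇_k T_{ij}` of a two-tensor. -/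
def tensorLap (G T : EuclideanSpace ℝ (Fin n) → Matrix (Fin n) (Fin n) ℝ) (i j : Fin n)
    (y : EuclideanSpace ℝ (Fin n)) : ℝ :=
  ∑ k, ∑ l, (G y)⁻¹ k l * covDeriv2 G T l k i j y

end Coordinates

/-! ### Two-tensors, curvature functionals and critical metrics on a manifold -/

section Manifold

variable {n : ℕ} {M : Type*} [TopologicalSpace M] [ChartedSpace (EuclideanSpace ℝ (Fin n)) M]

variable (n M) in
/-- A (not necessarily smooth) covariant two-tensor field on the manifold `M`. -/
abbrev TwoTensor : Type _ :=
  ∀ p : M, TangentSpace (𝓡 n) p →L[ℝ] TangentSpace (𝓡 n) p →L[ℝ] ℝ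

/-- Smoothness of a two-tensor field, as a section of the bundle of bilinear forms. -/
def TwoTensor.IsSmooth [IsManifold (𝓡 n) ∞ M] (h : TwoTensor n M) : Prop :=
  ContMDiff (𝓡 n)
    ((𝓡 n).prod 𝓘(ℝ, EuclideanSpace ℝ (Fin n) →L[ℝ] EuclideanSpace ℝ (Fin n) →L[ℝ] ℝ)) ∞
    (fun p : M => Bundle.TotalSpace.mk'
      (EuclideanSpace ℝ (Fin n) →L[ℝ] EuclideanSpace ℝ (Fin n) →L[ℝ] ℝ)
      (E := fun p : M => TangentSpace (𝓡 n) p →L[ℝ] TangentSpace (𝓡 n) p →L[ℝ] ℝ) p (h p))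

/-- The coordinate vector field `∂_i` of the chart around `c`, at the point with coordinates `y`. -/
def coordVec (c : M) (i : Fin n) (y : EuclideanSpace ℝ (Fin n)) :
    TangentSpace (𝓡 n) ((extChartAt (𝓡 n) c).symm y) :=
  mfderiv 𝓘(ℝ, EuclideanSpace ℝ (Fin n)) (𝓡 n) (extChartAt (𝓡 n) c).symm y
    (EuclideanSpace.single i (1 : ℝ))

/-- The components `T_{ij} = T(∂_i, ∂_j)` of a two-tensor in the chart around `c`, as functions of
the coordinates. -/
def TwoTensor.coeff (T : TwoTensor n M) (c : M) (y : EuclideanSpace ℝ (Fin n)) :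
    Matrix (Fin n) (Fin n) ℝ :=
  Matrix.of fun i j => T ((extChartAt (𝓡 n) c).symm y) (coordVec c i y) (coordVec c j y)

/-- `|Ric|²` of the metric `g` at the point `p`. -/
def ricNormSq (g : TwoTensor n M) (p : M) : ℝ :=
  normSq (g.coeff p) (ric (g.coeff p)) (extChartAt (𝓡 n) p p)

/-- The scalar curvature of the metric `g` at the point `p`. -/
def scalarCurvature (g : TwoTensor n M) (p : M) : ℝ :=
  scal (g.coeff p) (extChartAt (𝓡 n) p p)

/-- `σ₂(A)` of the metric `g` at the point `p`, where `A` is the Schouten tensor. -/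
def sigmaTwoSchouten (g : TwoTensor n M) (p : M) : ℝ :=
  sigmaTwo (g.coeff p) (schouten (g.coeff p)) (extChartAt (𝓡 n) p p)

variable [MeasurableSpace M]

/-- The measure `√(det g_{ij}) dy¹ ⋯ dyⁿ` on the domain of the chart around `c`, as a measure on
`M` (zero outside the domain). -/
def chartVolume (g : TwoTensor n M) (c : M) : Measure M :=
  Measure.map (extChartAt (𝓡 n) c).symm
    ((volume.restrict (extChartAt (𝓡 n) c).target).withDensity
      fun y => ENNReal.ofReal (Real.sqrt (g.coeff c y).det))

/-- The Riemannian measure `dV` of the metric `g`: the least measure on `M` that dominates the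
measures `√(det g_{ij}) dy¹ ⋯ dyⁿ` of all charts. As these agree on the overlaps of the chart
domains, `dV` restricts to each of them on the domain of the chart. -/
def volumeMeasure (g : TwoTensor n M) : Measure M :=
  ⨆ c : M, chartVolume g c

/-- The functional `𝓕_t(g) = ∫ |Ric|² dV + t ∫ R² dV`, with the integrals extended over `K`. -/
def functionalF (t : ℝ) (g : TwoTensor n M) (K : Set M) : ℝ :=
  (∫ p in K, ricNormSq g p ∂(volumeMeasure g)) +
    t * ∫ p in K, scalarCurvature g p ^ 2 ∂(volumeMeasure g)

/-- The functional `𝓕₂(g) = ∫ σ₂(A) dV`, with the integral extended over `K`. -/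
def functionalSigmaTwo (g : TwoTensor n M) (K : Set M) : ℝ :=
  ∫ p in K, sigmaTwoSchouten g p ∂(volumeMeasure g)

/-- The metric `g` is critical for the integral functional `F` with respect to compactly supported
variations: if `h` is a smooth symmetric two-tensor that vanishes outside a compact set `K`, then
`d/ds F(g + s h) = 0` at `s = 0`. As `M` need not be compact, `F` is evaluated on the
compact set `K`, outside of which the metric does not vary (`g + s h` is a Riemannian metric for
small `s`). -/
def IsCritical [IsManifold (𝓡 n) ∞ M] (F : TwoTensor n M → Set M → ℝ) (g : TwoTensor n M) : Prop :=
  ∀ h : TwoTensor n M, h.IsSmooth → (∀ p v w, h p v w = h p w v) →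
    ∀ K : Set M, IsCompact K → (∀ p, p ∉ K → h p = 0) →
      HasDerivAt (fun s : ℝ => F (fun p => g p + s • h p) K) 0 0

end Manifold

end QuadraticCurvature

end

noncomputable section

namespace QuadraticCurvature

open MeasureTheory
open scoped Manifold ContDiff Bundle Matrix Topology ENNReal

/-! ### Tensor calculus over a commutative ring with commuting derivations -/

section DerivationMatrix

variable {A : Type*} [CommRing A] [Algebra ℝ A] {m : Type*} [Fintype m] [DecidableEq m]

/-! Criticality is an Euler–Lagrange equation. Put $L=|Ric|^2+tR^2$, let $w$ be the volume density
and $h=\delta g$. The core is the identity $2\,\delta(wL)=w\langle B,h\rangle+\partial_iV^i$, where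
$B=2(1+2t)\nabla^2R-2\Delta Ric-(1+4t)\Delta R\,g-4Rm(Ric)-4tR\,Ric+Lg$ and
$Rm(T)_{ij}=R_{ikjl}T_{kl}$ (`MetricAlg.first_variation`). Palatini's formula expresses $\delta Ric$
through second covariant derivatives of $h$. Moving them onto $Ric+tRg$ costs a divergence, and the
Ricci identity and the contracted Bianchi identity simplify what is left.

Substituting $Ric=E+\frac1nRg$ turns $B=0$ into the tensor equation of (a); the scalar equation is
its trace, hence a consequence (`eulerLagrange_iff`). In dimension three
$\sigma_2(A)=-\frac12(|Ric|^2-\frac38R^2)$, so (b) is the case $t=-\frac38$. There $n+4(n-1)t=0$, so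
the trace says $|Ric|^2=\frac38R^2$, and since the Ricci tensor determines the Riemann tensor
(`riemann_eq_of_dim_three`), $Rm(E)$ is algebraic in $E$.

The tensor identities hold over any commutative $\mathbb R$-algebra with commuting derivations. In
the ring of smooth functions of $(s,y)$, with metric $G+sH$, the derivative in $s$ is one more
derivation commuting with the $\partial_i$. The field $V$ lies in every ideal containing $h$ and
$\partial h$; for the kernel of evaluation at a point this says that $V$ vanishes wherever $h$
vanishes nearby (`exists_divergence`).

On $M$, coordinate invariance of the curvature (`invariance`) and of the volume (`chartVolume_eq`)
makes the energy of a set inside a chart domain a coordinate integral. Cutting a compact set into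
measurable pieces inside charts shows that the energy is differentiable along variations, with a
derivative that is additive and local (`isRegular_of_subset`). If $B=0$, a partition of unity splits
$h$ into pieces supported in charts, each of derivative zero (`isStationary_of_gradient`).
Conversely, bump variations in a single chart and the fundamental lemma of the calculus of
variations force $B=0$ (`IsStationary.gradient_eq_zero`). -/

theorem map_derivation_mul (d : Derivation ℝ A A) (S T : Matrix m m A) :
    (S * T).map d = S.map d * T + S * T.map d := by
  ext i j
  simp only [Matrix.map_apply, Matrix.mul_apply, Matrix.add_apply, map_sum, Derivation.leibniz,
    smul_eq_mul, Finset.sum_add_distrib]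
  rw [add_comm]
  congr 1
  exact Finset.sum_congr rfl fun _ _ => mul_comm _ _

theorem map_derivation_add (d : Derivation ℝ A A) (S T : Matrix m m A) :
    (S + T).map d = S.map d + T.map d := by ext; simp

theorem map_derivation_sub (d : Derivation ℝ A A) (S T : Matrix m m A) :
    (S - T).map d = S.map d - T.map d := by ext; simp

theorem map_derivation_one (d : Derivation ℝ A A) : (1 : Matrix m m A).map d = 0 := by
  ext i j
  by_cases h : i = j <;> simp [Matrix.one_apply, h]

theorem map_derivation_transpose (d : Derivation ℝ A A) (S : Matrix m m A) :
    Sᵀ.map d = (S.map d)ᵀ := rfl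

theorem map_derivation_inv (d : Derivation ℝ A A) {S T : Matrix m m A} (h : S * T = 1) :
    T.map d = -(T * S.map d * T) := by
  have h' : T * S = 1 := mul_eq_one_comm.mp h
  have := map_derivation_mul d S T
  rw [h, map_derivation_one] at this
  calc T.map d = T * S * T.map d := by rw [h', one_mul]
    _ = T * (S.map d * T + S * T.map d) - T * S.map d * T := by noncomm_ring
    _ = _ := by rw [← this]; simp

theorem derivation_prod {ι : Type*} [DecidableEq ι] (d : Derivation ℝ A A) (s : Finset ι)
    (f : ι → A) : d (∏ i ∈ s, f i) = ∑ i ∈ s, (∏ j ∈ s.erase i, f j) * d (f i) := by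
  induction s using Finset.induction_on with
  | empty => simp
  | insert a s ha ih =>
    rw [Finset.prod_insert ha, Derivation.leibniz, ih, Finset.sum_insert ha,
      Finset.erase_insert ha, smul_eq_mul, smul_eq_mul, add_comm, Finset.mul_sum]
    congr 1
    refine Finset.sum_congr rfl fun i hi => ?_
    have hne : a ≠ i := fun e => ha (e ▸ hi)
    rw [Finset.erase_insert_of_ne hne, Finset.prod_insert fun h => ha (Finset.mem_of_mem_erase h),
      mul_assoc]

/-- Jacobi's formula: the derivative falls on one row at a time, and expanding along that row brings
in the adjugate, which is `S.det • T`. -/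
theorem derivation_det (d : Derivation ℝ A A) {S T : Matrix m m A} (h : S * T = 1) :
    d S.det = S.det * (T * S.map d).trace := by
  have hadj : S.adjugate = S.det • T := by
    calc S.adjugate = S.adjugate * (S * T) := by rw [h, mul_one]
      _ = _ := by rw [← mul_assoc, Matrix.adjugate_mul, Matrix.smul_mul, one_mul]
  have h1 : d S.det = ∑ j, (S.updateRow j (S.map d j)).det := by
    simp only [Matrix.det_apply, map_sum]
    rw [Finset.sum_comm]
    refine Finset.sum_congr rfl fun σ _ => ?_
    rw [Units.smul_def, map_zsmul, ← Finset.smul_sum]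
    congr 1
    -- The factor with index `i` lies in row `σ i`; the sum is reindexed by rows.
    rw [derivation_prod, ← Equiv.sum_comp σ⁻¹]
    refine Finset.sum_congr rfl fun i _ => ?_
    rw [← Finset.mul_prod_erase _ _ (Finset.mem_univ (σ⁻¹ i))]
    have hσ : σ (σ⁻¹ i) = i := σ.apply_symm_apply i
    rw [hσ, Matrix.updateRow_self, Matrix.map_apply]
    rw [mul_comm]
    congr 1
    refine Finset.prod_congr rfl fun k hk => ?_
    rw [Matrix.updateRow_ne]
    rintro rfl
    simp at hk
  have h2 : ∀ j, (S.updateRow j (S.map d j)).det = ∑ i, S.adjugate i j * d (S j i) := by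
    intro j
    rw [← Matrix.cramer_transpose_apply]
    rw [Matrix.cramer_eq_adjugate_mulVec, ← Matrix.adjugate_transpose]
    rfl
  rw [h1, Finset.sum_congr rfl fun j _ => h2 j, hadj, Matrix.trace, Finset.mul_sum,
    Finset.sum_comm]
  refine Finset.sum_congr rfl fun i _ => ?_
  simp [Matrix.mul_apply, Finset.mul_sum, mul_assoc]

end DerivationMatrix

/-- A metric `G` (with inverse `Gi`) together with its Levi-Civita connection `Γ`
(`Γ i k j` is the Christoffel symbol `Γ^k_{ij}`) over a ring with commuting derivations `D i`. -/
structure MetricAlg (n : ℕ) (A : Type*) [CommRing A] [Algebra ℝ A] where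
  D : Fin n → Derivation ℝ A A
  D_comm : ∀ i j a, D i (D j a) = D j (D i a)
  G : Matrix (Fin n) (Fin n) A
  Gi : Matrix (Fin n) (Fin n) A
  symm : Gᵀ = G
  mul_inv : G * Gi = 1
  Γ : Fin n → Matrix (Fin n) (Fin n) A
  torsion : ∀ i j k, Γ i k j = Γ j k i
  compat : ∀ i, G.map (D i) = (Γ i)ᵀ * G + G * Γ i

namespace MetricAlg

variable {n : ℕ} {A : Type*} [CommRing A] [Algebra ℝ A] (X : MetricAlg n A)

theorem inv_mul : X.Gi * X.G = 1 := mul_eq_one_comm.mp X.mul_inv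

theorem inv_symm : X.Giᵀ = X.Gi := by
  have h : X.G * X.Giᵀ = 1 := by
    rw [← X.symm, ← Matrix.transpose_mul, X.inv_mul, Matrix.transpose_one]
  calc X.Giᵀ = X.Gi * (X.G * X.Giᵀ) := by rw [← mul_assoc, X.inv_mul, one_mul]
    _ = _ := by rw [h, mul_one]

theorem G_comm (i j : Fin n) : X.G i j = X.G j i := congrFun (congrFun X.symm j) i

theorem Gi_comm (i j : Fin n) : X.Gi i j = X.Gi j i := congrFun (congrFun X.inv_symm j) i

/-- The contraction `g^{ij} F_{ij}`. -/
def tr2 (F : Fin n → Fin n → A) : A := ∑ i, ∑ j, X.Gi i j * F i j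

/-- The action of the connection matrix `Γ_k` on a covariant index. -/
def act (k : Fin n) (f : Fin n → A) (i : Fin n) : A := ∑ m, X.Γ k m i * f m

/-- All indices are covariant. In an iterated derivative the direction of the inner one counts as a
further tensor index, whence the versions up to rank four. -/
def cov1 (k : Fin n) (v : Fin n → A) (i : Fin n) : A := X.D k (v i) - X.act k v i

def cov2 (k : Fin n) (T : Fin n → Fin n → A) (i j : Fin n) : A :=
  X.D k (T i j) - X.act k (fun a => T a j) i - X.act k (fun a => T i a) j

def cov3 (k : Fin n) (T : Fin n → Fin n → Fin n → A) (i j p : Fin n) : A :=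
  X.D k (T i j p) - X.act k (fun a => T a j p) i - X.act k (fun a => T i a p) j
    - X.act k (fun a => T i j a) p

def cov4 (k : Fin n) (T : Fin n → Fin n → Fin n → Fin n → A) (i j p q : Fin n) : A :=
  X.D k (T i j p q) - X.act k (fun a => T a j p q) i - X.act k (fun a => T i a p q) j
    - X.act k (fun a => T i j a q) p - X.act k (fun a => T i j p a) q

/-- The curvature matrices `(Ω i j) l k = R_{ijk}^l`. -/
def Ω (i j : Fin n) : Matrix (Fin n) (Fin n) A :=
  (X.Γ j).map (X.D i) - (X.Γ i).map (X.D j) + X.Γ i * X.Γ j - X.Γ j * X.Γ i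

def riem (i j k l : Fin n) : A := (X.G * X.Ω i j) k l

def ric (i j : Fin n) : A := ∑ k, X.Ω k i k j

def scal : A := X.tr2 X.ric

def hess (f : A) (i j : Fin n) : A := X.cov1 i (fun k => X.D k f) j

def lap (f : A) : A := X.tr2 (X.hess f)

def lap2 (T : Fin n → Fin n → A) (i j : Fin n) : A :=
  X.tr2 fun k l => X.cov3 l (fun k i j => X.cov2 k T i j) k i j

def rmC (T : Fin n → Fin n → A) (i j : Fin n) : A :=
  X.tr2 fun k p => X.tr2 fun l q => X.riem i k j l * T p q

def ip (S T : Fin n → Fin n → A) : A := X.tr2 fun i k => X.tr2 fun j l => S i j * T k l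

/-- The divergence `g^{lj} ∇_l T_{jk}`. -/
def div2 (T : Fin n → Fin n → A) (k : Fin n) : A := X.tr2 fun l j => X.cov2 l T j k

def div1 (v : Fin n → A) : A := X.tr2 fun l j => X.cov1 l v j

/-! #### Contractions -/

theorem tr2_add (F F' : Fin n → Fin n → A) :
    X.tr2 (fun i j => F i j + F' i j) = X.tr2 F + X.tr2 F' := by
  simp [tr2, mul_add, Finset.sum_add_distrib]

theorem tr2_sub (F F' : Fin n → Fin n → A) :
    X.tr2 (fun i j => F i j - F' i j) = X.tr2 F - X.tr2 F' := by
  simp [tr2, mul_sub, Finset.sum_sub_distrib]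

theorem tr2_neg (F : Fin n → Fin n → A) : X.tr2 (fun i j => -F i j) = -X.tr2 F := by
  simp [tr2]

theorem tr2_mul_left (c : A) (F : Fin n → Fin n → A) :
    X.tr2 (fun i j => c * F i j) = c * X.tr2 F := by
  simp only [tr2, Finset.mul_sum]
  exact Finset.sum_congr rfl fun _ _ => Finset.sum_congr rfl fun _ _ => by ring

theorem tr2_mul_right (c : A) (F : Fin n → Fin n → A) :
    X.tr2 (fun i j => F i j * c) = X.tr2 F * c := by
  simp only [tr2, Finset.sum_mul]
  exact Finset.sum_congr rfl fun _ _ => Finset.sum_congr rfl fun _ _ => by ring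

theorem tr2_sum {ι : Type*} (s : Finset ι) (F : ι → Fin n → Fin n → A) :
    X.tr2 (fun i j => ∑ x ∈ s, F x i j) = ∑ x ∈ s, X.tr2 (F x) := by
  simp only [tr2, Finset.mul_sum]
  rw [Finset.sum_comm]
  rw [Finset.sum_congr rfl fun j _ => Finset.sum_comm]
  rw [Finset.sum_comm]
  exact Finset.sum_congr rfl fun _ _ => Finset.sum_comm

theorem tr2_swap (F : Fin n → Fin n → A) : X.tr2 (fun i j => F j i) = X.tr2 F := by
  simp only [tr2]
  rw [Finset.sum_comm]
  exact Finset.sum_congr rfl fun i _ => Finset.sum_congr rfl fun j _ => by rw [X.Gi_comm]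

theorem tr2_comm (F : Fin n → Fin n → Fin n → Fin n → A) :
    X.tr2 (fun i j => X.tr2 fun k l => F i j k l) =
      X.tr2 fun k l => X.tr2 fun i j => F i j k l := by
  conv_lhs => simp only [tr2, Finset.mul_sum]
  conv_rhs => simp only [tr2, Finset.mul_sum]
  rw [Finset.sum_congr rfl fun i _ => Finset.sum_comm, Finset.sum_comm]
  rw [Finset.sum_congr rfl fun k _ => Finset.sum_congr rfl fun i _ => Finset.sum_comm]
  rw [Finset.sum_congr rfl fun k _ => Finset.sum_comm]
  refine Finset.sum_congr rfl fun k _ => Finset.sum_congr rfl fun l _ =>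
    Finset.sum_congr rfl fun i _ => Finset.sum_congr rfl fun j _ => by ring

theorem tr2_G_mul (v : Fin n → A) (i : Fin n) : X.tr2 (fun k l => X.G i k * v l) = v i := by
  have : ∀ l, ∑ k, X.G i k * X.Gi k l = (1 : Matrix (Fin n) (Fin n) A) i l := fun l => by
    rw [← X.mul_inv]; rfl
  simp only [tr2]
  rw [Finset.sum_comm]
  have h : ∀ l, ∑ k, X.Gi k l * (X.G i k * v l) = (1 : Matrix (Fin n) (Fin n) A) i l * v l :=
    fun l => by
      rw [← this, Finset.sum_mul]
      exact Finset.sum_congr rfl fun _ _ => by ring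
  rw [Finset.sum_congr rfl fun l _ => h l]
  simp [Matrix.one_apply]

theorem tr2_mul_G (v : Fin n → A) (i : Fin n) : X.tr2 (fun k l => v k * X.G l i) = v i := by
  rw [← X.tr2_swap]
  rw [← X.tr2_G_mul v i]
  congr 1
  ext k l
  rw [X.G_comm k i, mul_comm]

theorem tr2_G : X.tr2 (fun i j => X.G i j) = n := by
  simp only [tr2]
  have : ∀ i, ∑ j, X.Gi i j * X.G i j = 1 := fun i => by
    have := congrFun (congrFun X.inv_mul i) i
    rw [Matrix.mul_apply, Matrix.one_apply_eq] at this
    rw [← this]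
    exact Finset.sum_congr rfl fun j _ => by rw [X.G_comm]
  simp [this]

/-! #### The connection acting on tensors -/

theorem act_add (k : Fin n) (f g : Fin n → A) (i : Fin n) :
    X.act k (fun a => f a + g a) i = X.act k f i + X.act k g i := by
  simp [act, mul_add, Finset.sum_add_distrib]

theorem act_sub (k : Fin n) (f g : Fin n → A) (i : Fin n) :
    X.act k (fun a => f a - g a) i = X.act k f i - X.act k g i := by
  simp [act, mul_sub, Finset.sum_sub_distrib]

theorem act_neg (k : Fin n) (f : Fin n → A) (i : Fin n) :
    X.act k (fun a => -f a) i = -X.act k f i := by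
  simp [act]

theorem act_mul_left (k : Fin n) (c : A) (f : Fin n → A) (i : Fin n) :
    X.act k (fun a => c * f a) i = c * X.act k f i := by
  simp only [act, Finset.mul_sum]
  exact Finset.sum_congr rfl fun _ _ => by ring

theorem act_mul_right (k : Fin n) (c : A) (f : Fin n → A) (i : Fin n) :
    X.act k (fun a => f a * c) i = X.act k f i * c := by
  simp only [act, Finset.sum_mul]
  exact Finset.sum_congr rfl fun _ _ => by ring

theorem act_tr2 (k : Fin n) (F : Fin n → Fin n → Fin n → A) (i : Fin n) :
    X.act k (fun a => X.tr2 (F a)) i = X.tr2 fun p q => X.act k (fun a => F a p q) i := by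
  simp only [act]
  rw [X.tr2_sum]
  exact Finset.sum_congr rfl fun _ _ => by rw [X.tr2_mul_left]

/-- This is $\nabla g^{-1}=0$, got from $\nabla g=0$ by differentiating the inverse matrix. -/
theorem D_Gi (k : Fin n) : X.Gi.map (X.D k) = -(X.Γ k * X.Gi) - X.Gi * (X.Γ k)ᵀ := by
  have h := X.inv_mul
  have h' := X.mul_inv
  rw [map_derivation_inv _ X.mul_inv, X.compat]
  calc -(X.Gi * ((X.Γ k)ᵀ * X.G + X.G * X.Γ k) * X.Gi)
      = -((X.Gi * X.G) * X.Γ k * X.Gi) - X.Gi * (X.Γ k)ᵀ * (X.G * X.Gi) := by noncomm_ring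
    _ = _ := by rw [h, h', one_mul, mul_one]

/-- The covariant derivative commutes with contractions. -/
theorem D_tr2 (k : Fin n) (F : Fin n → Fin n → A) : X.D k (X.tr2 F) = X.tr2 (X.cov2 k F) := by
  have h : ∀ i j, X.D k (X.Gi i j) =
      -(∑ m, X.Γ k i m * X.Gi m j) - ∑ m, X.Gi i m * X.Γ k j m := fun i j => by
    have := congrFun (congrFun (X.D_Gi k) i) j
    simpa [Matrix.mul_apply] using this
  have e1 : X.tr2 (fun i j => X.act k (fun a => F a j) i) =
      ∑ i, ∑ j, F i j * ∑ m, X.Γ k i m * X.Gi m j := by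
    simp only [tr2, act, Finset.mul_sum]
    rw [Finset.sum_congr rfl fun i _ => Finset.sum_comm, Finset.sum_comm]
    rw [Finset.sum_congr rfl fun i _ => Finset.sum_comm]
    exact Finset.sum_congr rfl fun _ _ => Finset.sum_congr rfl fun _ _ =>
      Finset.sum_congr rfl fun _ _ => by ring
  have e2 : X.tr2 (fun i j => X.act k (fun a => F i a) j) =
      ∑ i, ∑ j, F i j * ∑ m, X.Gi i m * X.Γ k j m := by
    simp only [tr2, act, Finset.mul_sum]
    rw [Finset.sum_congr rfl fun i _ => Finset.sum_comm]
    exact Finset.sum_congr rfl fun _ _ => Finset.sum_congr rfl fun _ _ =>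
      Finset.sum_congr rfl fun _ _ => by ring
  unfold cov2
  rw [tr2_sub, tr2_sub, e1, e2]
  simp only [tr2, map_sum, Derivation.leibniz, smul_eq_mul, h]
  simp only [← Finset.sum_sub_distrib]
  exact Finset.sum_congr rfl fun _ _ => Finset.sum_congr rfl fun _ _ => by ring

theorem cov1_tr2 (k : Fin n) (F : Fin n → Fin n → Fin n → A) (i : Fin n) :
    X.cov1 k (fun i => X.tr2 (F i)) i = X.tr2 fun p q => X.cov3 k F i p q := by
  simp only [cov1, cov3, D_tr2, act_tr2, ← tr2_sub, cov2]
  congr 1; ext p q; ring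

theorem cov2_tr2 (k : Fin n) (F : Fin n → Fin n → Fin n → Fin n → A) (i j : Fin n) :
    X.cov2 k (fun i j => X.tr2 (F i j)) i j = X.tr2 fun p q => X.cov4 k F i j p q := by
  simp only [cov2, cov4, D_tr2, act_tr2, ← tr2_sub]
  congr 1; ext p q; ring

theorem cov2_G (k i j : Fin n) : X.cov2 k (fun a b => X.G a b) i j = 0 := by
  have h := congrFun (congrFun (X.compat k) i) j
  simp only [Matrix.map_apply, Matrix.add_apply, Matrix.mul_apply, Matrix.transpose_apply] at h
  have e : ∑ m, X.G i m * X.Γ k m j = X.act k (fun a => X.G i a) j :=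
    Finset.sum_congr rfl fun _ _ => mul_comm _ _
  rw [cov2, h, e]
  simp only [act]
  ring

theorem cov2_add (k : Fin n) (S T : Fin n → Fin n → A) (i j : Fin n) :
    X.cov2 k (fun a b => S a b + T a b) i j = X.cov2 k S i j + X.cov2 k T i j := by
  simp only [cov2, act_add, map_add]; ring

theorem cov3_add (k : Fin n) (S T : Fin n → Fin n → Fin n → A) (i j p : Fin n) :
    X.cov3 k (fun a b c => S a b c + T a b c) i j p = X.cov3 k S i j p + X.cov3 k T i j p := by
  simp only [cov3, act_add, map_add]; ring

theorem cov2_smul (k : Fin n) (f : A) (T : Fin n → Fin n → A) (i j : Fin n) :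
    X.cov2 k (fun a b => f * T a b) i j = X.D k f * T i j + f * X.cov2 k T i j := by
  simp only [cov2, act_mul_left, Derivation.leibniz, smul_eq_mul]; ring

theorem cov1_smul (k : Fin n) (f : A) (v : Fin n → A) (i : Fin n) :
    X.cov1 k (fun a => f * v a) i = X.D k f * v i + f * X.cov1 k v i := by
  simp only [cov1, act_mul_left, Derivation.leibniz, smul_eq_mul]; ring

/-- The covariant derivative of the inner product of a 3-tensor and a 2-tensor. -/
theorem cov1_ip (k : Fin n) (N : Fin n → Fin n → Fin n → A) (H : Fin n → Fin n → A) (i : Fin n) :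
    X.cov1 k (fun i => X.ip (N i) H) i =
      X.ip (fun p q => X.cov3 k N i p q) H + X.ip (N i) (X.cov2 k H) := by
  simp only [ip, ← tr2_add]
  simp only [cov1, D_tr2, cov2, act_tr2, ← tr2_sub]
  congr 1; ext a b; congr 1; ext c d
  simp only [cov3, Derivation.leibniz, smul_eq_mul, act_mul_left, act_mul_right, cov2]
  ring

end MetricAlg

namespace MetricAlg

variable {n : ℕ} {A : Type*} [CommRing A] [Algebra ℝ A] (X : MetricAlg n A)

/-! #### Curvature identities -/

/-- Two is invertible in an `ℝ`-algebra. This replaces division in the symmetrisation arguments. -/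
theorem two_mul_cancel {a b : A} (h : 2 * a = 2 * b) : a = b := by
  have key : ∀ c : A, c = (1 / 2 : ℝ) • (2 * c) := fun c => by
    rw [two_mul, ← two_smul ℝ c, smul_smul]; norm_num
  rw [key a, key b, h]

/-- The covariant derivative of a two-tensor as a matrix. -/
def covM (k : Fin n) (T : Matrix (Fin n) (Fin n) A) : Matrix (Fin n) (Fin n) A :=
  T.map (X.D k) - (X.Γ k)ᵀ * T - T * X.Γ k

theorem covM_apply (k : Fin n) (T : Matrix (Fin n) (Fin n) A) (i j : Fin n) :
    X.covM k T i j = X.cov2 k (fun a b => T a b) i j := by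
  simp only [covM, cov2, act, Matrix.sub_apply, Matrix.map_apply, Matrix.mul_apply,
    Matrix.transpose_apply]
  congr 1
  exact Finset.sum_congr rfl fun _ _ => mul_comm _ _

theorem map_D_comm (i j : Fin n) (T : Matrix (Fin n) (Fin n) A) :
    (T.map (X.D j)).map (X.D i) = (T.map (X.D i)).map (X.D j) := by
  ext a b; simp [X.D_comm i j]

/-- The Ricci identity with the directions `l`, `k` frozen as parameters: second derivatives of `T`
cancel, and the terms in `Γ` assemble into the curvature matrices. -/
theorem covM_comm (l k : Fin n) (T : Matrix (Fin n) (Fin n) A) :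
    X.covM l (X.covM k T) - X.covM k (X.covM l T) = -((X.Ω l k)ᵀ * T) - T * X.Ω l k := by
  simp only [covM, Ω, map_derivation_sub, map_derivation_mul, map_derivation_transpose,
    X.map_D_comm l k, Matrix.transpose_add, Matrix.transpose_sub, Matrix.transpose_mul]
  noncomm_ring

/-- The full Ricci identity differs from the frozen one by a connection term on the inner direction,
symmetric in `l` and `k` because there is no torsion. -/
theorem cov3_cov2_comm (T : Fin n → Fin n → A) (l k i j : Fin n) :
    X.cov3 l (fun k i j => X.cov2 k T i j) k i j - X.cov3 k (fun k i j => X.cov2 k T i j) l i j =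
      -(∑ m, X.Ω l k m i * T m j) - ∑ m, X.Ω l k m j * T i m := by
  have h := congrFun (congrFun (X.covM_comm l k (Matrix.of T)) i) j
  have e : ∀ l k, X.cov3 l (fun k i j => X.cov2 k T i j) k i j =
      X.covM l (X.covM k (Matrix.of T)) i j - ∑ m, X.Γ l m k * X.cov2 m T i j := fun l k => by
    rw [covM_apply]
    simp only [covM_apply, cov3, cov2, act, Matrix.of_apply]
    ring
  rw [e, e]
  have ht : ∑ m, X.Γ l m k * X.cov2 m T i j = ∑ m, X.Γ k m l * X.cov2 m T i j :=
    Finset.sum_congr rfl fun m _ => by rw [X.torsion]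
  simp only [Matrix.sub_apply, Matrix.neg_apply, Matrix.mul_apply, Matrix.transpose_apply,
    Matrix.of_apply] at h
  have e2 : ∑ m, X.Ω l k m j * T i m = ∑ m, T i m * X.Ω l k m j :=
    Finset.sum_congr rfl fun _ _ => mul_comm _ _
  rw [e2, ← h, ht]
  ring

theorem Ω_swap (i j : Fin n) : X.Ω j i = -X.Ω i j := by simp only [Ω]; noncomm_ring

theorem covM_G (k : Fin n) : X.covM k X.G = 0 := by rw [covM, X.compat]; noncomm_ring

/-- The Ricci identity for the parallel tensor `G` has left side zero; the right side is the
asserted antisymmetry. -/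
theorem G_mul_Ω (i j : Fin n) : X.G * X.Ω i j = -(X.G * X.Ω i j)ᵀ := by
  have h := X.covM_comm i j X.G
  have h0 : ∀ k, X.covM k (0 : Matrix (Fin n) (Fin n) A) = 0 := fun k => by
    rw [covM]; ext; simp
  rw [X.covM_G, X.covM_G, h0, h0] at h
  rw [Matrix.transpose_mul, X.symm, ← sub_eq_zero, sub_neg_eq_add, add_comm, ← neg_eq_zero]
  rw [neg_add, ← sub_eq_add_neg, ← h, sub_zero]

theorem riem_swap_left (i j k l : Fin n) : X.riem j i k l = -X.riem i j k l := by
  rw [riem, riem, X.Ω_swap i j]; simp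

theorem riem_swap_right (i j k l : Fin n) : X.riem i j l k = -X.riem i j k l := by
  have := congrFun (congrFun (X.G_mul_Ω i j) l) k
  exact this

/-- The first Bianchi identity. Absence of torsion puts each term in the form
$\varphi(i,j,k)-\varphi(j,k,i)$, so that the cyclic sum telescopes. -/
theorem Ω_cyclic (i j k l : Fin n) : X.Ω i j l k + X.Ω j k l i + X.Ω k i l j = 0 := by
  have e : ∀ i j k, X.Ω i j l k = X.D i (X.Γ j l k) - X.D j (X.Γ k l i) +
      ∑ m, X.Γ i l m * X.Γ j m k - ∑ m, X.Γ j l m * X.Γ k m i := fun i j k => by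
    rw [X.torsion k i l]
    simp only [Ω, Matrix.sub_apply, Matrix.add_apply, Matrix.map_apply, Matrix.mul_apply]
    congr 1
    exact Finset.sum_congr rfl fun m _ => by rw [X.torsion k i m]
  rw [e, e, e]
  ring

theorem riem_cyclic (i j k l : Fin n) :
    X.riem i j k l + X.riem j l k i + X.riem l i k j = 0 := by
  simp only [riem, Matrix.mul_apply, ← Finset.sum_add_distrib, ← mul_add]
  refine Finset.sum_eq_zero fun m _ => ?_
  rw [X.Ω_cyclic, mul_zero]

/-- The octahedron argument: a signed sum of four first Bianchi identities leaves twice the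
difference, once the two antisymmetries have identified the other terms. -/
theorem riem_pair (i j k l : Fin n) : X.riem k l i j = X.riem i j k l := by
  apply two_mul_cancel
  have h1 := X.riem_cyclic i j k l
  have h2 := X.riem_cyclic j k l i
  have h3 := X.riem_cyclic k l i j
  have h4 := X.riem_cyclic l i j k
  have a1 := X.riem_swap_left
  have a2 := X.riem_swap_right
  linear_combination h3 - h4 - h1 + h2 - a1 j l i k + a1 i l j k + a2 k l i j + a2 j l i k +
    a1 i l k j - a2 i l j k - a2 j k i l - a1 i k l j + a2 i k j l - a2 i j k l

/-- Turns the mixed curvature terms of the Ricci identity into metric contractions of `riem`. -/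
theorem raise_Ω (i j l : Fin n) (f : Fin n → A) :
    ∑ m, X.Ω i j m l * f m = X.tr2 fun p q => X.riem i j p l * f q := by
  simp only [riem, Matrix.mul_apply, Finset.sum_mul]
  rw [X.tr2_sum]
  refine Finset.sum_congr rfl fun m _ => ?_
  rw [← X.tr2_G_mul f m, ← X.tr2_mul_left]
  congr 1; ext p q
  rw [X.G_comm]; ring

theorem ric_eq (i j : Fin n) : X.ric i j = X.tr2 fun k p => X.riem k i p j := by
  simp only [riem, Matrix.mul_apply]
  rw [X.tr2_sum]
  refine Finset.sum_congr rfl fun m _ => ?_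
  rw [← X.tr2_mul_G (fun k => X.Ω k i m j) m]
  congr 1; ext p q
  rw [X.G_comm]; ring

theorem ric_comm (i j : Fin n) : X.ric i j = X.ric j i := by
  rw [ric_eq, ric_eq, ← X.tr2_swap]
  congr 1; ext k p
  exact X.riem_pair _ _ _ _

/-- The second Bianchi identity. -/
theorem cov4_riem_cyclic (k i j p l : Fin n) :
    X.cov4 k X.riem i j p l + X.cov4 i X.riem j k p l + X.cov4 j X.riem k i p l = 0 := by
  set K : Fin n → Fin n → Fin n → Matrix (Fin n) (Fin n) A := fun k i j =>
    (X.Ω i j).map (X.D k) + X.Γ k * X.Ω i j - X.Ω i j * X.Γ k with hK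
  -- `K` differentiates covariantly in the matrix indices only. The corrections for the indices `i`,
  -- `j` are written so that they telescope in the cyclic sum.
  have e : ∀ k i j, X.cov4 k X.riem i j p l = (X.G * K k i j) p l -
      ∑ m, X.Γ k m i * X.riem m j p l + ∑ m, X.Γ j m k * X.riem m i p l := fun k i j => by
    have h1 : X.G * K k i j = X.covM k (X.G * X.Ω i j) := by
      simp only [hK]
      rw [covM, map_derivation_mul, X.compat]; noncomm_ring
    rw [h1, covM_apply]
    have h2 : ∑ m, X.Γ j m k * X.riem m i p l = - ∑ m, X.Γ k m j * X.riem i m p l := by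
      rw [← Finset.sum_neg_distrib]
      exact Finset.sum_congr rfl fun m _ => by rw [X.torsion j k m, X.riem_swap_left i m]; ring
    rw [h2]
    simp only [cov4, cov2, act, riem]
    ring
  have h : K k i j + K i j k + K j k i = 0 := by
    simp only [hK, Ω, map_derivation_sub, map_derivation_add, map_derivation_mul]
    rw [X.map_D_comm k i, X.map_D_comm k j, X.map_D_comm i j]
    noncomm_ring
  have h'' : (X.G * K k i j) p l + (X.G * K i j k) p l + (X.G * K j k i) p l = 0 := by
    rw [← Matrix.add_apply, ← Matrix.add_apply, ← mul_add, ← mul_add, h, mul_zero]; rfl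
  rw [e, e, e]
  linear_combination h''

theorem cov4_neg {F F' : Fin n → Fin n → Fin n → Fin n → A} (k i j p q : Fin n)
    (h : ∀ a b c d, F a b c d = -F' a b c d) : X.cov4 k F i j p q = -X.cov4 k F' i j p q := by
  simp only [cov4, h, act_neg, map_neg]; ring

theorem cov2_ric (k j l : Fin n) :
    X.cov2 k X.ric j l = X.tr2 fun i p => X.cov4 k X.riem i j p l := by
  have : X.ric = fun j l => X.tr2 fun i p => X.riem i j p l := by
    ext j l; exact X.ric_eq j l
  rw [this, cov2_tr2]
  congr 1; ext i p
  simp only [cov4]; ring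

/-- The contracted second Bianchi identity. -/
theorem D_scal (k : Fin n) : X.D k X.scal = 2 * X.div2 X.ric k := by
  have h1 : X.D k X.scal = X.tr2 fun j l => X.tr2 fun i p => X.cov4 k X.riem i j p l := by
    rw [scal, D_tr2]
    congr 1; ext j l
    exact X.cov2_ric k j l
  have hd : X.div2 X.ric k = X.tr2 fun i p => X.cov2 i X.ric k p := by
    have : X.ric = fun a b => X.ric b a := by ext a b; exact X.ric_comm a b
    rw [div2]
    congr 1; ext i p
    conv_lhs => rw [this]
    simp only [cov2]; ring
  have h2 : X.div2 X.ric k = -X.tr2 fun j l => X.tr2 fun i p => X.cov4 i X.riem j k p l := by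
    rw [hd, X.tr2_comm, ← X.tr2_neg]
    congr 1; ext i p
    rw [X.cov2_ric, ← X.tr2_neg]
    congr 1; ext j l
    rw [X.cov4_neg (F' := fun a b c d => X.riem a b d c) i j k p l
      fun a b c d => X.riem_swap_right _ _ _ _]
    simp only [cov4]; ring
  have h3 : X.div2 X.ric k = -X.tr2 fun j l => X.tr2 fun i p => X.cov4 j X.riem k i p l := by
    rw [hd, ← X.tr2_neg]
    congr 1; ext j l
    rw [X.cov2_ric, ← X.tr2_neg]
    congr 1; ext i p
    rw [X.cov4_neg (F' := fun a b c d => X.riem b a c d) j k i p l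
      fun a b c d => X.riem_swap_left _ _ _ _]
    simp only [cov4]; ring
  -- Contracting the second Bianchi identity over both pairs: the first term becomes $\nabla_kR$ and
  -- the other two become $-\mathrm{div}\,Ric$ each.
  have h := congrArg (fun f : Fin n → Fin n → A => X.tr2 f)
    (funext fun j => funext fun l => congrArg (fun f : Fin n → Fin n → A => X.tr2 f)
      (funext fun i => funext fun p => X.cov4_riem_cyclic k i j p l))
  simp only [tr2_add] at h
  have h0 : X.tr2 (fun _ _ => (0 : A)) = 0 := by simp [tr2]
  rw [h0, h0] at h
  linear_combination h1 + h - h2 - h3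

/-- Commuting the derivatives in `∇^j ∇_i T_{jk}`. -/
theorem tr2_cov3_cov2 (T : Fin n → Fin n → A) (i k : Fin n) :
    X.tr2 (fun l j => X.cov3 l (fun a b c => X.cov2 a T b c) i j k) =
      X.cov1 i (X.div2 T) k + X.tr2 (fun m p => X.ric i m * T p k) - X.rmC T i k := by
  have h1 : X.cov1 i (X.div2 T) k =
      X.tr2 (fun l j => X.cov3 i (fun a b c => X.cov2 a T b c) l j k) := by
    have : X.div2 T = fun k => X.tr2 fun l j => X.cov2 l T j k := rfl
    rw [this, X.cov1_tr2]
    congr 1; ext l j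
    simp only [cov3]; ring
  -- The two curvature terms of the Ricci identity: contracting `l` with `j`, the one acting on `j`
  -- gives Ricci, the one acting on `k` gives the Riemann contraction.
  have h2 : X.tr2 (fun m p => X.ric i m * T p k) =
      X.tr2 (fun l j => -∑ m, X.Ω l i m j * T m k) := by
    simp only [X.raise_Ω, ← X.tr2_neg]
    rw [X.tr2_comm]
    congr 1; ext p q
    rw [X.ric_eq, ← X.tr2_mul_right]
    congr 1; ext l j
    rw [X.riem_swap_right l i p j]; ring
  have h3 : X.rmC T i k = X.tr2 (fun l j => ∑ m, X.Ω l i m k * T j m) := by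
    simp only [X.raise_Ω]
    rw [rmC]
    congr 1; ext l j; congr 1; ext p q
    rw [X.riem_swap_left i l, X.riem_swap_right i l k p]; ring
  rw [h1, h2, h3, ← X.tr2_add, ← X.tr2_sub]
  congr 1; ext l j
  linear_combination X.cov3_cov2_comm T l i j k

theorem rmC_G (i j : Fin n) : X.rmC (fun a b => X.G a b) i j = X.ric i j := by
  rw [rmC, X.ric_eq]
  congr 1; ext k p
  rw [X.riem_swap_left i k, X.riem_swap_right i k j p, neg_neg]
  rw [← X.tr2_mul_G (fun l => X.riem i k j l) p]
  congr 1; ext l q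
  rw [X.G_comm]

theorem rmC_add (S T : Fin n → Fin n → A) (i j : Fin n) :
    X.rmC (fun a b => S a b + T a b) i j = X.rmC S i j + X.rmC T i j := by
  simp only [rmC, mul_add, tr2_add]

theorem rmC_mul (c : A) (T : Fin n → Fin n → A) (i j : Fin n) :
    X.rmC (fun a b => c * T a b) i j = c * X.rmC T i j := by
  simp only [rmC, ← tr2_mul_left]
  congr 1; ext; congr 1; ext; ring

theorem tr2_rmC (T : Fin n → Fin n → A) : X.tr2 (X.rmC T) = X.ip X.ric T := by
  have : X.rmC T = fun i j => X.tr2 fun k p => X.tr2 fun l q => X.riem i k j l * T p q := rfl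
  rw [this, X.tr2_comm, ip]
  congr 1; ext k p
  rw [X.tr2_comm]
  congr 1; ext l q
  rw [X.tr2_mul_right, X.ric_eq]

theorem tr2_lap2 (T : Fin n → Fin n → A) : X.tr2 (X.lap2 T) = X.lap (X.tr2 T) := by
  have : X.lap2 T = fun i j =>
    X.tr2 fun k l => X.cov3 l (fun k i j => X.cov2 k T i j) k i j := rfl
  rw [this, X.tr2_comm, lap, ← X.tr2_swap (X.hess _)]
  congr 1; ext k l
  rw [hess]
  simp only [X.D_tr2]
  exact (X.cov1_tr2 l (fun a => X.cov2 a T) k).symm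

theorem lap2_add (S T : Fin n → Fin n → A) (i j : Fin n) :
    X.lap2 (fun a b => S a b + T a b) i j = X.lap2 S i j + X.lap2 T i j := by
  simp only [lap2, ← tr2_add]
  congr 1; ext k l
  simp only [cov2_add]
  exact X.cov3_add l _ _ k i j

theorem lap2_mul_G (f : A) (i j : Fin n) :
    X.lap2 (fun a b => f * X.G a b) i j = X.lap f * X.G i j := by
  rw [lap, ← X.tr2_mul_right, ← X.tr2_swap (fun a b => X.hess f a b * _), lap2]
  congr 1; ext k l
  have e : ∀ k i j, X.cov2 k (fun a b => f * X.G a b) i j = X.D k f * X.G i j := fun k i j => by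
    have := X.cov2_smul k f (fun a b => X.G a b) i j
    rwa [X.cov2_G, mul_zero, add_zero] at this
  simp only [e]
  have := X.cov2_G l i j
  simp only [cov2] at this
  simp only [cov3, hess, cov1, Derivation.leibniz, smul_eq_mul, act_mul_left, act_mul_right]
  linear_combination X.D k f * this

end MetricAlg

namespace MetricAlg

variable {n : ℕ} {A : Type*} [CommRing A] [Algebra ℝ A] (X : MetricAlg n A)

/-! #### The divergence theorem and the first variation of the quadratic functionals -/

theorem ip_comm (S T : Fin n → Fin n → A) : X.ip S T = X.ip T S := by
  rw [ip, ip, ← X.tr2_swap]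
  congr 1; ext i k
  rw [← X.tr2_swap]
  congr 1; ext j l
  ring

theorem ip_add_left (S S' T : Fin n → Fin n → A) :
    X.ip (fun i j => S i j + S' i j) T = X.ip S T + X.ip S' T := by
  simp only [ip, add_mul, tr2_add]

theorem ip_sub_left (S S' T : Fin n → Fin n → A) :
    X.ip (fun i j => S i j - S' i j) T = X.ip S T - X.ip S' T := by
  simp only [ip, sub_mul, tr2_sub]

theorem ip_mul_left (c : A) (S T : Fin n → Fin n → A) :
    X.ip (fun i j => c * S i j) T = c * X.ip S T := by
  simp only [ip, mul_assoc, tr2_mul_left]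

theorem ip_sub_right (S T T' : Fin n → Fin n → A) :
    X.ip S (fun i j => T i j - T' i j) = X.ip S T - X.ip S T' := by
  simp only [ip, mul_sub, tr2_sub]

theorem ip_mul_right (c : A) (S T : Fin n → Fin n → A) :
    X.ip S (fun i j => c * T i j) = c * X.ip S T := by
  rw [ip_comm, ip_mul_left, ip_comm]

theorem ip_G (T : Fin n → Fin n → A) : X.ip (fun a b => X.G a b) T = X.tr2 T := by
  rw [ip, ← X.tr2_swap T]
  congr 1; ext i k
  exact X.tr2_G_mul (fun l => T k l) i

theorem ip_swap (S T : Fin n → Fin n → A) :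
    X.ip (fun i j => S j i) (fun i j => T j i) = X.ip S T := by
  rw [ip, X.tr2_comm]; rfl

theorem tr2_ip_right (S : Fin n → Fin n → A) (T : Fin n → Fin n → Fin n → Fin n → A) :
    X.tr2 (fun a b => X.ip S (T a b)) = X.ip S (fun i j => X.tr2 fun a b => T a b i j) := by
  simp only [ip]
  rw [X.tr2_comm]
  congr 1; ext i k
  rw [X.tr2_comm]
  congr 1; ext j l
  rw [X.tr2_mul_left]

theorem tr2_ip_left (S : Fin n → Fin n → Fin n → Fin n → A) (T : Fin n → Fin n → A) :
    X.tr2 (fun a b => X.ip (S a b) T) = X.ip (fun i j => X.tr2 fun a b => S a b i j) T := by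
  rw [X.ip_comm, ← X.tr2_ip_right]
  congr 1; ext; rw [X.ip_comm]

/-- Jacobi's formula for $w^2=\det g$; by metric compatibility the trace of $g^{-1}\partial_ig$ is
twice that of `Γ i`. The inverse `w'` serves to cancel `w`. -/
theorem D_volume {w w' : A} (hw : w * w = X.G.det) (hw' : w * w' = 1) (i : Fin n) :
    X.D i w = w * ∑ m, X.Γ i m m := by
  have h := derivation_det (X.D i) X.mul_inv
  have e : (X.Gi * X.G.map (X.D i)).trace = 2 * ∑ m, X.Γ i m m := by
    rw [X.compat, mul_add, ← mul_assoc, ← mul_assoc, X.inv_mul, one_mul, Matrix.trace_add,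
      Matrix.mul_assoc, Matrix.trace_mul_comm, Matrix.mul_assoc, X.mul_inv, mul_one,
      Matrix.trace_transpose, Matrix.trace]
    simp only [Matrix.diag_apply]; ring
  rw [e, ← hw, Derivation.leibniz, smul_eq_mul] at h
  apply two_mul_cancel
  calc 2 * X.D i w = (w * X.D i w + w * X.D i w) * w' := by linear_combination -2 * X.D i w * hw'
    _ = _ := by rw [h]; linear_combination (2 * w * ∑ m, X.Γ i m m) * hw'

/-- `∂_i (w V^i) = w div V`, where `w` is the volume density. -/
theorem sum_D_volume {w w' : A} (hw : w * w = X.G.det) (hw' : w * w' = 1) (V : Fin n → A) :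
    ∑ a, X.D a (w * ∑ l, X.Gi a l * V l) = w * X.div1 V := by
  have h : ∀ k i j, X.D k (X.Gi i j) =
      -(∑ m, X.Γ k i m * X.Gi m j) - ∑ m, X.Gi i m * X.Γ k j m := fun k i j => by
    have := congrFun (congrFun (X.D_Gi k) i) j
    simpa [Matrix.mul_apply] using this
  -- By symmetry of `Γ` the contraction coming from the derivative of the inverse metric cancels the
  -- derivative of the density.
  have e1 : ∑ a, ∑ l, (∑ m, X.Γ a a m * X.Gi m l) * V l =
      ∑ a, (∑ m, X.Γ a m m) * ∑ l, X.Gi a l * V l := by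
    simp only [Finset.sum_mul, Finset.mul_sum]
    rw [Finset.sum_congr rfl fun a _ => Finset.sum_comm, Finset.sum_comm]
    refine Finset.sum_congr rfl fun m _ => ?_
    rw [Finset.sum_comm]
    exact Finset.sum_congr rfl fun l _ => Finset.sum_congr rfl fun a _ => by
      rw [X.torsion a m a]; ring
  have e2 : ∑ a, ∑ l, (∑ m, X.Gi a m * X.Γ a l m) * V l = X.tr2 fun a m => X.act a V m := by
    simp only [tr2, act, Finset.sum_mul, Finset.mul_sum]
    refine Finset.sum_congr rfl fun a _ => ?_
    rw [Finset.sum_comm]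
    exact Finset.sum_congr rfl fun l _ => Finset.sum_congr rfl fun a _ => by ring
  have e3 : X.div1 V = ∑ a, ∑ l, X.Gi a l * X.D a (V l) - X.tr2 fun a m => X.act a V m := by
    rw [div1]; simp only [cov1]; rw [tr2_sub]; rfl
  rw [e3, ← e2]
  simp only [Derivation.leibniz, smul_eq_mul, map_sum, X.D_volume hw hw', h]
  have e4 : ∀ a, ∑ l, (X.Gi a l * X.D a (V l) + V l * (-(∑ m, X.Γ a a m * X.Gi m l) -
      ∑ m, X.Gi a m * X.Γ a l m)) = ∑ l, X.Gi a l * X.D a (V l) -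
      ∑ l, (∑ m, X.Γ a a m * X.Gi m l) * V l - ∑ l, (∑ m, X.Gi a m * X.Γ a l m) * V l :=
    fun a => by
      rw [← Finset.sum_sub_distrib, ← Finset.sum_sub_distrib]
      exact Finset.sum_congr rfl fun _ _ => by ring
  rw [Finset.sum_add_distrib, ← Finset.mul_sum, Finset.sum_congr rfl fun a _ => e4 a,
    Finset.sum_sub_distrib, Finset.sum_sub_distrib, e1]
  have e5 : ∑ a, (∑ l, X.Gi a l * V l) * (w * ∑ m, X.Γ a m m) =
      w * ∑ a, (∑ m, X.Γ a m m) * ∑ l, X.Gi a l * V l := by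
    rw [Finset.mul_sum]; exact Finset.sum_congr rfl fun _ _ => by ring
  rw [e5]; ring

section Variation

variable (δ : Derivation ℝ A A) (hδ : ∀ i a, δ (X.D i a) = X.D i (δ a))

/-- The variation of the metric. -/
def var (i j : Fin n) : A := δ (X.G i j)

/-- The variation of the Christoffel symbols, with all indices lowered. -/
def varΓ (l i j : Fin n) : A := ∑ m, X.G l m * δ (X.Γ i m j)

theorem var_comm (i j : Fin n) : X.var δ i j = X.var δ j i := by rw [var, var, X.G_comm]

theorem varΓ_comm (l i j : Fin n) : X.varΓ δ l i j = X.varΓ δ l j i := by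
  simp only [varΓ]
  exact Finset.sum_congr rfl fun m _ => by rw [X.torsion]

include hδ in
theorem map_δ_D (i : Fin n) (T : Matrix (Fin n) (Fin n) A) :
    (T.map (X.D i)).map δ = (T.map δ).map (X.D i) := by
  ext a b; simp [hδ i]

include hδ in
-- The variation of $\nabla g=0$: as `δ` commutes with the `D i`, what is not a covariant derivative
-- of `h` is the variation of the connection.
theorem cov2_var (i j l : Fin n) :
    X.cov2 i (X.var δ) j l = X.varΓ δ l i j + X.varΓ δ j i l := by
  have h : X.covM i (X.G.map δ) = ((X.Γ i).map δ)ᵀ * X.G + X.G * (X.Γ i).map δ := by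
    have h1 := congrArg (fun T : Matrix (Fin n) (Fin n) A => T.map δ) (X.compat i)
    simp only [map_derivation_add, map_derivation_mul, map_derivation_transpose,
      X.map_δ_D δ hδ] at h1
    rw [covM, h1]
    noncomm_ring
  have h' := congrFun (congrFun h j) l
  rw [covM_apply] at h'
  have e : X.cov2 i (X.var δ) j l = X.cov2 i (fun a b => X.G.map δ a b) j l := rfl
  rw [e, h', Matrix.add_apply]
  simp only [Matrix.mul_apply, varΓ, Matrix.transpose_apply, Matrix.map_apply]
  congr 1
  exact Finset.sum_congr rfl fun m _ => by rw [X.G_comm, mul_comm]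

include hδ in
-- Koszul's trick applied to `cov2_var`: of the six terms on the right, four cancel by symmetry of
-- the varied connection.
theorem two_varΓ (l i j : Fin n) : 2 * X.varΓ δ l i j =
    X.cov2 i (X.var δ) j l + X.cov2 j (X.var δ) i l - X.cov2 l (X.var δ) i j := by
  rw [X.cov2_var δ hδ, X.cov2_var δ hδ, X.cov2_var δ hδ, X.varΓ_comm δ l j i,
    X.varΓ_comm δ i l j, X.varΓ_comm δ j l i]
  ring

include hδ in
-- Palatini's identity $\delta\Omega_{ij}=\nabla_i\delta\Gamma_j-\nabla_j\delta\Gamma_i$, with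
-- frozen directions. The upper index may be lowered under the derivatives since `G` is parallel.
theorem δ_Ω (i j : Fin n) : X.G * (X.Ω i j).map δ =
    X.covM i (X.G * (X.Γ j).map δ) - X.covM j (X.G * (X.Γ i).map δ) := by
  simp only [Ω, covM, map_derivation_sub, map_derivation_add, map_derivation_mul,
    X.map_δ_D δ hδ, X.compat]
  noncomm_ring

include hδ in
theorem δ_ric (j k : Fin n) : δ (X.ric j k) =
    X.tr2 (fun i l => X.cov3 i (X.varΓ δ) l j k) - X.tr2 (fun i l => X.cov3 j (X.varΓ δ) l i k) := by
  have h1 : δ (X.ric j k) = X.tr2 fun i l => (X.G * (X.Ω i j).map δ) l k := by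
    simp only [Matrix.mul_apply]
    rw [X.tr2_sum, ric, map_sum]
    refine Finset.sum_congr rfl fun m _ => ?_
    rw [← X.tr2_mul_G (fun i => δ (X.Ω i j m k)) m]
    congr 1; ext p q
    rw [X.G_comm, Matrix.map_apply]; ring
  have e : ∀ i j l, X.covM i (X.G * (X.Γ j).map δ) l k =
      X.cov3 i (X.varΓ δ) l j k + ∑ m, X.Γ i m j * X.varΓ δ l m k := fun i j l => by
    rw [covM_apply]
    simp only [cov3, cov2, act, varΓ, Matrix.mul_apply, Matrix.map_apply]
    ring
  rw [h1, ← tr2_sub]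
  congr 1; ext i l
  rw [X.δ_Ω δ hδ, Matrix.sub_apply, e, e]
  have : ∑ m, X.Γ i m j * X.varΓ δ l m k = ∑ m, X.Γ j m i * X.varΓ δ l m k :=
    Finset.sum_congr rfl fun m _ => by rw [X.torsion]
  rw [this]; ring

include hδ in
-- The second trace in Palatini's formula is half a Hessian, because the trace of the varied
-- connection is $\frac12d(\mathrm{tr}\,h)$.
theorem two_δ_ric (j k : Fin n) : 2 * δ (X.ric j k) =
    2 * X.tr2 (fun i l => X.cov3 i (X.varΓ δ) l j k) - X.hess (X.tr2 (X.var δ)) j k := by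
  have hc : ∀ k, X.D k (X.tr2 (X.var δ)) = 2 * X.tr2 fun i l => X.varΓ δ l i k := fun k => by
    rw [D_tr2, ← tr2_mul_left]
    simp only [X.two_varΓ δ hδ]
    rw [tr2_sub, tr2_add]
    have : X.tr2 (fun i l => X.cov2 l (X.var δ) i k) = X.tr2 fun i l => X.cov2 i (X.var δ) k l := by
      rw [← X.tr2_swap]
      congr 1; ext a b
      have : X.var δ = fun a b => X.var δ b a := by ext a b; exact X.var_comm δ a b
      conv_lhs => rw [this]
      simp only [cov2]; ring
    rw [this]; ring
  have h2 : X.hess (X.tr2 (X.var δ)) j k = 2 * X.tr2 fun i l => X.cov3 j (X.varΓ δ) l i k := by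
    rw [hess]
    simp only [hc]
    have h := X.cov1_tr2 j (fun k i l => X.varΓ δ l i k) k
    have e : X.cov1 j (fun k => 2 * X.tr2 fun i l => X.varΓ δ l i k) k =
        2 * X.cov1 j (fun k => X.tr2 fun i l => X.varΓ δ l i k) k := by
      simp only [two_mul, cov1, act_add, map_add]; ring
    rw [e, h]
    congr 2; ext i l
    simp only [cov3]; ring
  rw [X.δ_ric δ hδ, h2]; ring

/-- The subtracted term is the variation $-g^{-1}hg^{-1}$ of the inverse metric. -/
theorem δ_tr2 (F : Fin n → Fin n → A) :
    δ (X.tr2 F) = X.tr2 (fun i j => δ (F i j)) - X.ip F (X.var δ) := by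
  have h : ∀ i j, δ (X.Gi i j) = -∑ q, (∑ p, X.Gi i p * X.var δ p q) * X.Gi q j := fun i j => by
    have := congrFun (congrFun (map_derivation_inv δ X.mul_inv) i) j
    simpa [Matrix.mul_apply, var] using this
  have e : X.ip F (X.var δ) = ∑ i, ∑ j, F i j * ∑ q, (∑ p, X.Gi i p * X.var δ p q) * X.Gi q j := by
    simp only [ip, tr2, Finset.mul_sum, Finset.sum_mul]
    refine Finset.sum_congr rfl fun i _ => ?_
    rw [Finset.sum_comm]
    refine Finset.sum_congr rfl fun j _ => ?_
    rw [Finset.sum_comm]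
    refine Finset.sum_congr rfl fun q _ => Finset.sum_congr rfl fun p _ => ?_
    rw [X.Gi_comm q j]; ring
  rw [e]
  simp only [tr2, map_sum, Derivation.leibniz, smul_eq_mul, h, ← Finset.sum_sub_distrib]
  exact Finset.sum_congr rfl fun _ _ => Finset.sum_congr rfl fun _ _ => by ring

theorem δ_scal : δ X.scal = X.tr2 (fun i j => δ (X.ric i j)) - X.ip X.ric (X.var δ) :=
  X.δ_tr2 δ _

/-- The composition `Ric ∘ Ric`. -/
def ricRic (i k : Fin n) : A := X.tr2 fun m p => X.ric i m * X.ric p k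

/-- The two factors `ric` contribute equally, and so do the two inverse metrics; hence both twos. -/
theorem δ_ip_ric : δ (X.ip X.ric X.ric) =
    2 * X.ip X.ric (fun i j => δ (X.ric i j)) - 2 * X.ip X.ricRic (X.var δ) := by
  have e1 : X.ip X.ric X.ric = X.tr2 fun i k => X.tr2 fun j l => X.ric i j * X.ric k l := rfl
  have hR : ∀ i k, (X.tr2 fun j l => X.ric i j * X.ric k l) = X.ricRic i k := fun i k => by
    rw [ricRic]; congr 1; ext j l; rw [X.ric_comm k l]
  have hR' : ∀ j l, (X.tr2 fun i k => X.ric i j * X.ric k l) = X.ricRic j l := fun i k => by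
    rw [ricRic]; congr 1; ext j l; rw [X.ric_comm j i]
  rw [e1, δ_tr2]
  simp only [δ_tr2]
  rw [tr2_sub, X.tr2_ip_left]
  simp only [hR, hR']
  simp only [Derivation.leibniz, smul_eq_mul, tr2_add]
  have e2 : X.tr2 (fun i k => X.tr2 fun j l => X.ric i j * δ (X.ric k l)) =
      X.ip X.ric (fun i j => δ (X.ric i j)) := rfl
  have e3 : X.tr2 (fun i k => X.tr2 fun j l => X.ric k l * δ (X.ric i j)) =
      X.ip X.ric (fun i j => δ (X.ric i j)) := by
    rw [← e2, ← X.tr2_swap]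
    congr 1; ext i k
    rw [← X.tr2_swap]
  rw [e2, e3]
  have e4 : X.ip (fun i k => X.ricRic i k) (X.var δ) = X.ip X.ricRic (X.var δ) := rfl
  rw [e4]
  ring

theorem two_δ_volume {w w' : A} (hw : w * w = X.G.det) (hw' : w * w' = 1) :
    2 * δ w = w * X.tr2 (X.var δ) := by
  have h := derivation_det δ X.mul_inv
  have e : (X.Gi * X.G.map δ).trace = X.tr2 (X.var δ) := by
    simp only [Matrix.trace, Matrix.diag_apply, Matrix.mul_apply, tr2, Matrix.map_apply, var]
    exact Finset.sum_congr rfl fun _ _ => Finset.sum_congr rfl fun _ _ => by rw [X.G_comm]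
  rw [e, ← hw, Derivation.leibniz, smul_eq_mul] at h
  calc 2 * δ w = (w * δ w + w * δ w) * w' := by linear_combination -2 * δ w * hw'
    _ = _ := by rw [h]; linear_combination (w * X.tr2 (X.var δ)) * hw'

end Variation

end MetricAlg

/-! ### The gradient of the quadratic functionals -/

namespace MetricAlg

variable {n : ℕ} {A : Type*} [CommRing A] [Algebra ℝ A] (X : MetricAlg n A)

/-- The Lagrangian `|Ric|² + τ R²`. -/
def lag (τ : A) : A := X.ip X.ric X.ric + τ * X.scal ^ 2

/-- Twice the gradient of the functional `∫ |Ric|² + τ R²`. -/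
def grad (τ : A) (i j : Fin n) : A :=
  2 * (1 + 2 * τ) * X.hess X.scal i j - 2 * X.lap2 X.ric i j - (1 + 4 * τ) * X.lap X.scal * X.G i j
    - 4 * X.rmC X.ric i j - 4 * τ * X.scal * X.ric i j + X.lag τ * X.G i j

theorem tr2_mul_metric (c : A) : X.tr2 (fun i j => c * X.G i j) = c * n :=
  (X.tr2_mul_left c (fun i j => X.G i j)).trans (by rw [X.tr2_G])

theorem ip_mul_metric (c : A) (T : Fin n → Fin n → A) :
    X.ip (fun i j => c * X.G i j) T = c * X.tr2 T :=
  (X.ip_mul_left c (fun i j => X.G i j) T).trans (by rw [X.ip_G])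

theorem rmC_mul_metric (c : A) (i j : Fin n) :
    X.rmC (fun i j => c * X.G i j) i j = c * X.ric i j :=
  (X.rmC_mul c (fun i j => X.G i j) i j).trans (by rw [X.rmC_G])

/-- The curvature contractions give $-4(|Ric|^2+\tau R^2)$, and $\Delta R$ collects
$2(1+2\tau)-2-n(1+4\tau)$. -/
theorem tr2_grad (τ : A) :
    X.tr2 (X.grad τ) = (n - 4) * X.lag τ - (n + 4 * (n - 1) * τ) * X.lap X.scal := by
  have e : X.grad τ = fun i j => 2 * (1 + 2 * τ) * X.hess X.scal i j - 2 * X.lap2 X.ric i j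
    - (1 + 4 * τ) * X.lap X.scal * X.G i j
    - 4 * X.rmC X.ric i j - 4 * τ * X.scal * X.ric i j + X.lag τ * X.G i j := rfl
  rw [e, X.tr2_add, X.tr2_sub, X.tr2_sub, X.tr2_sub, X.tr2_sub]
  simp only [X.tr2_mul_left, X.tr2_mul_metric]
  have e1 : X.tr2 (fun i j => X.rmC X.ric i j) = X.ip X.ric X.ric := X.tr2_rmC X.ric
  have e2 : X.tr2 (fun i j => X.lap2 X.ric i j) = X.lap X.scal := X.tr2_lap2 X.ric
  have e3 : X.tr2 (fun i j => X.ric i j) = X.scal := rfl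
  have e4 : X.tr2 (fun i j => X.hess X.scal i j) = X.lap X.scal := rfl
  rw [e1, e2, e3, e4, lag]
  ring

/-- Ideals keep track of locality: for the kernel of evaluation at a point, membership means
vanishing there. -/
theorem tr2_mem {J : Ideal A} {F : Fin n → Fin n → A} (h : ∀ i j, F i j ∈ J) : X.tr2 F ∈ J :=
  J.sum_mem fun i _ => J.sum_mem fun j _ => J.mul_mem_left _ (h i j)

theorem cov2_mem {J : Ideal A} {T : Fin n → Fin n → A} (h : ∀ i j, T i j ∈ J)
    (h' : ∀ k i j, X.D k (T i j) ∈ J) (k i j : Fin n) : X.cov2 k T i j ∈ J :=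
  J.sub_mem (J.sub_mem (h' _ _ _) (J.sum_mem fun _ _ => J.mul_mem_left _ (h _ _)))
    (J.sum_mem fun _ _ => J.mul_mem_left _ (h _ _))

theorem mem_of_two_mul_mem {J : Ideal A} {a : A} (h : 2 * a ∈ J) : a ∈ J := by
  have : a = algebraMap ℝ A (1 / 2) * (2 * a) := by
    have h2 : (2 : A) = algebraMap ℝ A 2 := (map_ofNat _ 2).symm
    rw [← mul_assoc]
    conv_rhs => rw [h2]
    rw [← map_mul]; norm_num
  exact this ▸ J.mul_mem_left _ h

theorem div1_add (v w : Fin n → A) : X.div1 (fun i => v i + w i) = X.div1 v + X.div1 w := by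
  simp only [div1, ← tr2_add, cov1, act_add, map_add]
  congr 1; ext; ring

theorem div1_sub (v w : Fin n → A) : X.div1 (fun i => v i - w i) = X.div1 v - X.div1 w := by
  simp only [div1, ← tr2_sub, cov1, act_sub, map_sub]
  congr 1; ext; ring

/-- `∇^l T_{ab} ∇_l H^{ab}` up to a divergence. -/
theorem tr2_ip_cov2_cov2 (T H : Fin n → Fin n → A) :
    X.tr2 (fun i l => X.ip (X.cov2 l H) (X.cov2 i T)) =
      X.div1 (fun i => X.ip (X.cov2 i T) H) - X.ip (X.lap2 T) H := by
  have e : X.lap2 T = fun i j =>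
    X.tr2 fun k l => X.cov3 l (fun k i j => X.cov2 k T i j) k i j := rfl
  rw [e, ← X.tr2_ip_left, div1, ← X.tr2_swap (fun l j => X.cov1 l _ j), ← X.tr2_sub]
  congr 1; ext i l
  have h := X.cov1_ip l (fun i => X.cov2 i T) H i
  rw [X.ip_comm (X.cov2 l H)]
  linear_combination -h

/-- `∇^i T^{cd} ∇_c H_{di}` up to a divergence. -/
theorem tr2_ip_cov2_cov2' (T H : Fin n → Fin n → A) (hH : ∀ i j, H i j = H j i) :
    X.tr2 (fun i l => X.ip (fun a b => X.cov2 a H b l) (X.cov2 i T)) =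
      X.div1 (fun c => X.ip (fun d i => X.cov2 i T c d) H) -
      X.ip (fun i k => X.tr2 (fun l j => X.cov3 l (fun a b c => X.cov2 a T b c) i j k)) H := by
  have h1 : X.tr2 (fun i l => X.ip (fun a b => X.cov2 a H b l) (X.cov2 i T)) =
      X.tr2 fun a c => X.ip (fun d i => X.cov2 i T c d) (X.cov2 a H) := by
    simp only [ip]
    rw [X.tr2_comm]
    congr 1; ext a c
    rw [X.tr2_comm]
    rw [← X.tr2_swap]
    congr 1; ext b d
    congr 1; ext i l
    ring
  have h2 : X.ip (fun i k => X.tr2 (fun l j => X.cov3 l (fun a b c => X.cov2 a T b c) i j k)) H =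
      X.ip (fun k i => X.tr2 (fun l j => X.cov3 l (fun a b c => X.cov2 a T b c) i j k)) H := by
    have : H = fun i j => H j i := by ext i j; exact hH i j
    conv_lhs => rw [this]
    exact X.ip_swap (fun k i => X.tr2
      (fun l j => X.cov3 l (fun a b c => X.cov2 a T b c) i j k)) H
  rw [h1, h2, ← X.tr2_ip_left, div1, ← X.tr2_sub]
  congr 1; ext a c
  have h := X.cov1_ip a (fun c d i => X.cov2 i T c d) H c
  have e : (fun p q => X.cov3 a (fun c d i => X.cov2 i T c d) c p q) =
      fun i j => X.cov3 a (fun a b c => X.cov2 a T b c) j c i := by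
    ext p q; simp only [cov3]; ring
  rw [e] at h
  linear_combination -h

/-- `T^{ij} ∇²_{ij} f` up to a divergence. -/
theorem ip_hess (T : Fin n → Fin n → A) (f : A) :
    X.ip T (X.hess f) = X.div1 (fun j => X.tr2 fun k b => T j k * X.D b f) -
      X.div1 (fun k => f * X.div2 T k) + f * X.div1 (X.div2 T) := by
  have h1 : X.div1 (fun j => X.tr2 fun k b => T j k * X.D b f) =
      X.tr2 (fun k b => X.div2 T k * X.D b f) + X.ip T (X.hess f) := by
    have e : X.tr2 (fun k b => X.div2 T k * X.D b f) =
        X.tr2 fun a j => X.tr2 fun k b => X.cov2 a T j k * X.D b f := by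
      simp only [div2]
      rw [X.tr2_comm]
      congr 1; ext k b
      rw [← X.tr2_mul_right]
    rw [e, ip, div1, ← X.tr2_swap (fun i k => X.tr2 fun j l => T i j * X.hess f k l), ← tr2_add]
    congr 1; ext a j
    rw [X.cov1_tr2 a (fun j k b => T j k * X.D b f), ← tr2_add]
    congr 1; ext k b
    simp only [cov3, cov2, hess, cov1, Derivation.leibniz, smul_eq_mul, act_mul_left,
      act_mul_right]
    ring
  have h2 : X.div1 (fun k => f * X.div2 T k) =
      X.tr2 (fun k b => X.div2 T k * X.D b f) + f * X.div1 (X.div2 T) := by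
    rw [div1, div1, ← X.tr2_swap (fun k b => X.div2 T k * X.D b f), ← tr2_mul_left, ← tr2_add]
    congr 1; ext a j
    rw [cov1_smul]; ring
  rw [h1, h2]; ring

theorem div2_mul_G (f : A) (k : Fin n) : X.div2 (fun a b => f * X.G a b) k = X.D k f := by
  have e : ∀ k i j, X.cov2 k (fun a b => f * X.G a b) i j = X.D k f * X.G i j := fun k i j => by
    have := X.cov2_smul k f (fun a b => X.G a b) i j
    rwa [X.cov2_G, mul_zero, add_zero] at this
  simp only [div2, e]
  exact X.tr2_mul_G (fun l => X.D l f) k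

theorem div2_add (S T : Fin n → Fin n → A) (k : Fin n) :
    X.div2 (fun a b => S a b + T a b) k = X.div2 S k + X.div2 T k := by
  simp only [div2, cov2_add, tr2_add]

/-- The first variation of the quadratic curvature functional. -/
theorem first_variation (δ : Derivation ℝ A A) (hδ : ∀ i a, δ (X.D i a) = X.D i (δ a))
    {w w' : A} (hw : w * w = X.G.det) (hw' : w * w' = 1) (τ : A) (hτ : ∀ i, X.D i τ = 0)
    (hτ' : δ τ = 0) :
    ∃ V : Fin n → A,
      (∀ J : Ideal A, (∀ i j, X.var δ i j ∈ J) → (∀ k i j, X.D k (X.var δ i j) ∈ J) →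
        ∀ i, V i ∈ J) ∧
      2 * δ (w * X.lag τ) = w * X.ip (X.grad τ) (X.var δ) + ∑ i, X.D i (V i) := by
  set H := X.var δ with hH
  -- Half the derivative of the Lagrangian with respect to the Ricci tensor at fixed metric.
  set T : Fin n → Fin n → A := fun i j => X.ric i j + τ * X.scal * X.G i j with hT
  set V₁ : Fin n → A := fun l => X.ip (fun i j => X.varΓ δ l i j) T with hV₁
  set V₂ : Fin n → A := fun i => X.ip (X.cov2 i T) H with hV₂
  set V₃ : Fin n → A := fun c => X.ip (fun d i => X.cov2 i T c d) H with hV₃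
  set V₄ : Fin n → A := fun j => X.tr2 fun k b => T j k * X.D b (X.tr2 H) with hV₄
  set V₅ : Fin n → A := fun k => X.tr2 H * X.div2 T k with hV₅
  set V : Fin n → A := fun i => V₁ i + V₁ i - (V₃ i + V₃ i) + V₂ i - V₄ i + V₅ i with hV
  set K : Fin n → Fin n → A := fun i k =>
    X.tr2 (fun l j => X.cov3 l (fun a b c => X.cov2 a T b c) i j k) with hK
  have hvar : ∀ l i j, 2 * X.varΓ δ l i j = X.cov2 i H j l + X.cov2 j H i l - X.cov2 l H i j :=
    X.two_varΓ δ hδ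
  have hTs : ∀ i j, T i j = T j i := fun i j => by
    simp only [hT]; rw [X.ric_comm, X.G_comm]
  have hcT : ∀ k i j, X.cov2 k T i j = X.cov2 k T j i := fun k i j => by
    have : T = fun i j => T j i := by ext i j; exact hTs i j
    conv_lhs => rw [this]
    simp only [cov2]; ring
  -- Palatini's formula with all derivatives moved from `H` to `T`.
  have key : 2 * X.ip T (fun j k => δ (X.ric j k)) =
      X.div1 V + 2 * X.ip K H - X.ip (X.lap2 T) H - X.tr2 H * X.div1 (X.div2 T) := by
    have h1 : 2 * X.ip T (fun j k => δ (X.ric j k)) =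
        2 * X.tr2 (fun i l => X.ip (fun j k => X.cov3 i (X.varΓ δ) l j k) T)
          - X.ip T (X.hess (X.tr2 H)) := by
      rw [← X.ip_mul_right]
      simp only [X.two_δ_ric δ hδ]
      rw [X.ip_sub_right, X.ip_mul_right, X.tr2_ip_left, X.ip_comm T]
    have h2 : X.tr2 (fun i l => X.ip (fun j k => X.cov3 i (X.varΓ δ) l j k) T) =
        X.div1 V₁ - X.tr2 fun i l => X.ip (X.varΓ δ l) (X.cov2 i T) := by
      rw [div1, ← X.tr2_sub]
      congr 1; ext i l
      have h := X.cov1_ip i (X.varΓ δ) T l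
      linear_combination -h
    have h3 : 2 * X.tr2 (fun i l => X.ip (X.varΓ δ l) (X.cov2 i T)) =
        2 * X.tr2 (fun i l => X.ip (fun a b => X.cov2 a H b l) (X.cov2 i T)) -
          X.tr2 (fun i l => X.ip (X.cov2 l H) (X.cov2 i T)) := by
      rw [← X.tr2_mul_left, ← X.tr2_mul_left, ← X.tr2_sub]
      congr 1; ext i l
      rw [← X.ip_mul_left]
      simp only [hvar]
      rw [X.ip_sub_left, X.ip_add_left]
      have : X.ip (fun a b => X.cov2 b H a l) (X.cov2 i T) =
          X.ip (fun a b => X.cov2 a H b l) (X.cov2 i T) := by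
        have e : X.cov2 i T = fun a b => X.cov2 i T b a := by ext a b; exact hcT i a b
        conv_lhs => rw [e]
        exact X.ip_swap (fun a b => X.cov2 a H b l) _
      rw [this]
      have e' : X.ip (fun i j => X.cov2 l H i j) (X.cov2 i T) = X.ip (X.cov2 l H) (X.cov2 i T) :=
        rfl
      rw [e']; ring
    rw [X.tr2_ip_cov2_cov2, X.tr2_ip_cov2_cov2' T H (X.var_comm δ)] at h3
    have h4 := X.ip_hess T (X.tr2 H)
    have h5 : X.div1 V = X.div1 V₁ + X.div1 V₁ - (X.div1 V₃ + X.div1 V₃) + X.div1 V₂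
        - X.div1 V₄ + X.div1 V₅ := by
      simp only [hV]
      rw [X.div1_add, X.div1_sub, X.div1_add, X.div1_sub, X.div1_add V₁, X.div1_add V₃]
    rw [h5, h1]
    linear_combination 2 * h2 - h3 - h4
  -- The contracted Bianchi identity makes the divergence of `T` a multiple of $\nabla R$.
  have hdiv : ∀ k, 2 * X.div2 T k = (1 + 2 * τ) * X.D k X.scal := fun k => by
    simp only [hT]
    rw [X.div2_add, X.div2_mul_G]
    have h := X.D_scal k
    have e : X.div2 (fun a b => X.ric a b) k = X.div2 X.ric k := rfl
    rw [e, Derivation.leibniz, hτ, smul_eq_mul, smul_eq_mul]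
    linear_combination -h
  have hcov : ∀ i k, 2 * X.cov1 i (X.div2 T) k = (1 + 2 * τ) * X.hess X.scal i k := fun i k => by
    have e1 : 2 * X.cov1 i (X.div2 T) k = X.cov1 i (fun k => 2 * X.div2 T k) k := by
      simp only [two_mul, cov1, act_add, map_add]; ring
    rw [e1]
    simp only [hdiv]
    rw [X.cov1_smul, hess]
    have : X.D i (1 + 2 * τ) = 0 := by simp [hτ, two_mul]
    rw [this]; ring
  have hdd : 2 * X.div1 (X.div2 T) = (1 + 2 * τ) * X.lap X.scal := by
    rw [div1, ← X.tr2_mul_left]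
    simp only [hcov]
    rw [X.tr2_mul_left]; rfl
  -- The composition `ricRic` produced by commuting derivatives will cancel the one produced by
  -- varying the inverse metrics.
  have hKe : ∀ i k, 2 * K i k = (1 + 2 * τ) * X.hess X.scal i k + 2 * X.ricRic i k +
      2 * τ * X.scal * X.ric i k - 2 * (X.rmC X.ric i k + τ * X.scal * X.ric i k) := fun i k => by
    simp only [hK]
    rw [X.tr2_cov3_cov2 T i k]
    have e1 : X.tr2 (fun m p => X.ric i m * T p k) =
        X.ricRic i k + τ * X.scal * X.ric i k := by
      simp only [hT, mul_add]
      rw [X.tr2_add]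
      congr 1
      rw [← X.tr2_mul_G (fun m => X.ric i m) k, ← X.tr2_mul_left]
      congr 1; ext m p; ring
    have e2 : X.rmC T i k = X.rmC X.ric i k + τ * X.scal * X.ric i k := by
      simp only [hT]
      rw [X.rmC_add, X.rmC_mul_metric]
    rw [e1, e2]
    linear_combination hcov i k
  have hlap : X.lap2 T = fun i j => X.lap2 X.ric i j + τ * X.lap X.scal * X.G i j := by
    ext i j
    simp only [hT]
    rw [X.lap2_add, X.lap2_mul_G]
    have e : X.lap (τ * X.scal) = τ * X.lap X.scal := by
      rw [lap, lap, ← X.tr2_mul_left]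
      congr 1; ext a b
      simp only [hess, Derivation.leibniz, hτ, smul_eq_mul, mul_zero, add_zero]
      rw [X.cov1_smul, hτ]; ring
    rw [e]
  -- Raising the index and multiplying by `w` makes the covariant divergence of `V` a sum of
  -- coordinate derivatives; the factor two is that of `2 * δ (w * X.lag τ)`.
  refine ⟨fun a => 2 * (w * ∑ l, X.Gi a l * V l), fun J h1 h2 i => ?_, ?_⟩
  · have hc := X.cov2_mem h1 h2
    have hΓ : ∀ l i j, X.varΓ δ l i j ∈ J := fun l i j => mem_of_two_mul_mem <| by
      rw [hvar]
      exact J.sub_mem (J.add_mem (hc _ _ _) (hc _ _ _)) (hc _ _ _)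
    have htr : X.tr2 H ∈ J := X.tr2_mem h1
    have m1 : ∀ l, V₁ l ∈ J := fun l => X.tr2_mem fun _ _ => X.tr2_mem fun _ _ =>
      J.mul_mem_right _ (hΓ _ _ _)
    have m2 : ∀ l, V₂ l ∈ J := fun l => X.tr2_mem fun _ _ => X.tr2_mem fun _ _ =>
      J.mul_mem_left _ (h1 _ _)
    have m3 : ∀ l, V₃ l ∈ J := fun l => X.tr2_mem fun _ _ => X.tr2_mem fun _ _ =>
      J.mul_mem_left _ (h1 _ _)
    have m4 : ∀ l, V₄ l ∈ J := fun l => X.tr2_mem fun _ _ => J.mul_mem_left _ <| by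
      rw [X.D_tr2]
      exact X.tr2_mem (hc _)
    have m5 : ∀ l, V₅ l ∈ J := fun l => J.mul_mem_right _ htr
    refine J.mul_mem_left _ (J.mul_mem_left _ (J.sum_mem fun l _ => J.mul_mem_left _ ?_))
    exact J.add_mem (J.sub_mem (J.add_mem (J.sub_mem (J.add_mem (m1 l) (m1 l))
      (J.add_mem (m3 l) (m3 l))) (m2 l)) (m4 l)) (m5 l)
  · have hd : ∑ i, X.D i (2 * (w * ∑ l, X.Gi i l * V l)) = 2 * (w * X.div1 V) := by
      rw [← X.sum_D_volume hw hw' V, Finset.mul_sum]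
      refine Finset.sum_congr rfl fun i _ => ?_
      rw [two_mul, map_add]; ring
    rw [hd]
    have hvol := X.two_δ_volume δ hw hw'
    have hlagδ : δ (X.lag τ) = 2 * X.ip T (fun j k => δ (X.ric j k)) - 2 * X.ip X.ricRic H
        - 2 * τ * X.scal * X.ip X.ric H := by
      rw [lag, map_add, X.δ_ip_ric, Derivation.leibniz, hτ', Derivation.leibniz_pow, X.δ_scal]
      have : X.ip T (fun j k => δ (X.ric j k)) = X.ip X.ric (fun j k => δ (X.ric j k)) +
          τ * X.scal * X.tr2 (fun j k => δ (X.ric j k)) := by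
        simp only [hT]
        rw [X.ip_add_left, X.ip_mul_metric]
      rw [this]
      simp only [smul_eq_mul, nsmul_eq_mul, mul_zero, add_zero, Nat.cast_ofNat, pow_one,
        Nat.add_one_sub_one]
      ring
    have hKip : 2 * X.ip K H = (1 + 2 * τ) * X.ip (X.hess X.scal) H + 2 * X.ip X.ricRic H +
        2 * τ * X.scal * X.ip X.ric H
        - 2 * (X.ip (X.rmC X.ric) H + τ * X.scal * X.ip X.ric H) := by
      rw [← X.ip_mul_left]
      simp only [hKe]
      rw [X.ip_sub_left, X.ip_add_left, X.ip_add_left]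
      simp only [X.ip_mul_left]
      rw [X.ip_add_left]
      simp only [X.ip_mul_left]
    have hlapip : X.ip (X.lap2 T) H = X.ip (X.lap2 X.ric) H + τ * X.lap X.scal * X.tr2 H := by
      rw [hlap, X.ip_add_left, X.ip_mul_metric]
    have hgrad : X.ip (X.grad τ) H = 2 * (1 + 2 * τ) * X.ip (X.hess X.scal) H
        - 2 * X.ip (X.lap2 X.ric) H - (1 + 4 * τ) * X.lap X.scal * X.tr2 H
        - 4 * X.ip (X.rmC X.ric) H - 4 * τ * X.scal * X.ip X.ric H + X.lag τ * X.tr2 H := by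
      have e : X.grad τ = fun i j => 2 * (1 + 2 * τ) * X.hess X.scal i j - 2 * X.lap2 X.ric i j
        - (1 + 4 * τ) * X.lap X.scal * X.G i j
        - 4 * X.rmC X.ric i j - 4 * τ * X.scal * X.ric i j + X.lag τ * X.G i j := rfl
      rw [e, X.ip_add_left, X.ip_sub_left, X.ip_sub_left, X.ip_sub_left, X.ip_sub_left]
      simp only [X.ip_mul_left, X.ip_mul_metric]
    rw [Derivation.leibniz, smul_eq_mul, smul_eq_mul, hlagδ, hgrad]
    linear_combination X.lag τ * hvol + 2 * w * key + 2 * w * hKip - 2 * w * hlapip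
      - w * X.tr2 H * hdd

end MetricAlg

namespace MetricAlg

variable {n : ℕ} {A : Type*} [CommRing A] [Algebra ℝ A] (X : MetricAlg n A)

/-! #### The Levi-Civita connection and changes of coordinates -/

/-- The metric with the connection given by the Christoffel formula. -/
def ofMetric (D : Fin n → Derivation ℝ A A) (D_comm : ∀ i j a, D i (D j a) = D j (D i a))
    (G Gi : Matrix (Fin n) (Fin n) A) (symm : Gᵀ = G) (mul_inv : G * Gi = 1) : MetricAlg n A where
  D := D
  D_comm := D_comm
  G := G
  Gi := Gi
  symm := symm
  mul_inv := mul_inv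
  Γ i := Matrix.of fun k j => algebraMap ℝ A (1 / 2) *
    ∑ l, Gi k l * (D i (G j l) + D j (G i l) - D l (G i j))
  torsion i j k := by
    have h : ∀ i j, G i j = G j i := fun i j => congrFun (congrFun symm j) i
    simp only [Matrix.of_apply]
    congr 1
    refine Finset.sum_congr rfl fun l _ => ?_
    rw [h i j]; ring
  compat i := by
    have hs : ∀ i j, G i j = G j i := fun i j => congrFun (congrFun symm j) i
    have h2 : (2 : A) * algebraMap ℝ A (1 / 2) = 1 := by
      have : (2 : A) = algebraMap ℝ A 2 := (map_ofNat _ 2).symm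
      rw [this, ← map_mul]; norm_num
    have h : ∀ l j, 2 * (∑ m, G l m * (algebraMap ℝ A (1 / 2) *
        ∑ p, Gi m p * (D i (G j p) + D j (G i p) - D p (G i j)))) =
        D i (G j l) + D j (G i l) - D l (G i j) := fun l j => by
      have e : ∀ p, ∑ m, G l m * Gi m p = (1 : Matrix (Fin n) (Fin n) A) l p := fun p => by
        rw [← mul_inv]; rfl
      calc _ = ∑ m, ∑ p, (2 * algebraMap ℝ A (1 / 2)) * (G l m * Gi m p *
            (D i (G j p) + D j (G i p) - D p (G i j))) := by
            simp only [Finset.mul_sum]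
            exact Finset.sum_congr rfl fun _ _ => Finset.sum_congr rfl fun _ _ => by ring
        _ = ∑ p, (∑ m, G l m * Gi m p) * (D i (G j p) + D j (G i p) - D p (G i j)) := by
            rw [h2, Finset.sum_comm]
            simp only [Finset.sum_mul, one_mul]
        _ = _ := by simp [e, Matrix.one_apply]
    ext a b
    apply two_mul_cancel
    have e1 := h a b
    have e2 := h b a
    simp only [Matrix.map_apply, Matrix.add_apply, Matrix.mul_apply, Matrix.transpose_apply,
      Matrix.of_apply]
    have e3 : ∑ m, algebraMap ℝ A (1 / 2) *
        (∑ p, Gi m p * (D i (G a p) + D a (G i p) - D p (G i a))) * G m b =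
        ∑ m, G b m * (algebraMap ℝ A (1 / 2) *
        ∑ p, Gi m p * (D i (G a p) + D a (G i p) - D p (G i a))) :=
      Finset.sum_congr rfl fun m _ => by rw [hs m b, mul_comm]
    rw [e3, mul_add, e1, e2, hs b a]; ring

/-- The lowered difference of the connections is symmetric in its two lower indices (no torsion) and
antisymmetric in an overlapping pair (both metric), hence zero. -/
theorem connection_unique (Γ' : Fin n → Matrix (Fin n) (Fin n) A)
    (ht : ∀ i j k, Γ' i k j = Γ' j k i)
    (hc : ∀ i, X.G.map (X.D i) = (Γ' i)ᵀ * X.G + X.G * Γ' i) : Γ' = X.Γ := by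
  set C : Fin n → Matrix (Fin n) (Fin n) A := fun i => X.G * (X.Γ i - Γ' i) with hC
  have h1 : ∀ i l j, C i l j = C j l i := fun i l j => by
    simp only [hC, Matrix.mul_apply, Matrix.sub_apply]
    exact Finset.sum_congr rfl fun m _ => by rw [ht, X.torsion]
  have h2 : ∀ i l j, C i l j = -C i j l := fun i l j => by
    have h : C i + (C i)ᵀ = 0 := by
      have := (X.compat i).symm.trans (hc i)
      simp only [hC, Matrix.transpose_mul, Matrix.transpose_sub, X.symm, mul_sub, sub_mul]
      rw [← sub_eq_zero] at this
      rw [← this]; abel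
    exact eq_neg_of_add_eq_zero_left (congrFun (congrFun h l) j)
  have h3 : ∀ i, C i = 0 := fun i => by
    ext l j
    apply two_mul_cancel
    have a1 := h2 i l j
    have a2 := h1 i j l
    have a3 := h2 l j i
    have a4 := h1 l i j
    have a5 := h2 j i l
    have a6 := h1 j l i
    rw [Matrix.zero_apply, mul_zero]
    linear_combination a1 - a2 - a3 + a4 + a5 - a6
  funext i
  have := congrArg (X.Gi * ·) (h3 i)
  simp only [hC, ← mul_assoc, X.inv_mul, one_mul, mul_zero] at this
  exact (sub_eq_zero.mp this).symm

theorem tr2_eq_trace (F : Fin n → Fin n → A) :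
    X.tr2 F = (X.Gi * (Matrix.of F)ᵀ).trace := by
  simp only [tr2, Matrix.trace, Matrix.diag_apply, Matrix.mul_apply, Matrix.transpose_apply,
    Matrix.of_apply]

theorem ip_eq_trace (S T : Fin n → Fin n → A) :
    X.ip S T = (X.Gi * Matrix.of S * X.Gi * (Matrix.of T)ᵀ).trace := by
  have e : ∀ i k, X.tr2 (fun j l => S i j * T k l) =
      (Matrix.of S * X.Gi * (Matrix.of T)ᵀ) i k := fun i k => by
    simp only [tr2, Matrix.mul_apply, Matrix.transpose_apply, Matrix.of_apply, Finset.sum_mul]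
    rw [Finset.sum_comm]
    exact Finset.sum_congr rfl fun _ _ => Finset.sum_congr rfl fun _ _ => by ring
  rw [ip, ← X.tr2_swap]
  simp only [e]
  rw [tr2_eq_trace, mul_assoc, mul_assoc, mul_assoc]
  rfl

section ChangeOfCoordinates

variable {B : Type*} [CommRing B] [Algebra ℝ B] (Y : MetricAlg n B) (f : B →+* A)
  {J J' : Matrix (Fin n) (Fin n) A} (hJJ' : J * J' = 1)
  (hf : ∀ i b, X.D i (f b) = ∑ a, J a i * f (Y.D a b))
  (hJ : ∀ i a j, X.D i (J a j) = X.D j (J a i))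
  (hG : X.G = Jᵀ * Y.G.map f * J)

include hf in
theorem map_D_map (i : Fin n) (T : Matrix (Fin n) (Fin n) B) :
    (T.map f).map (X.D i) = ∑ a, J a i • (T.map (Y.D a)).map f := by
  ext p q
  simp [hf, Matrix.sum_apply]

include hJJ' hf hJ hG in
-- Here `f` pulls functions back and `J` is the Jacobian: `hf` is the chain rule, `hJ` the symmetry
-- of second derivatives, `hG` the law for the metric. The transformed connection is torsion-free
-- and metric, so `connection_unique` identifies it.
theorem pullback_connection (i : Fin n) :
    J * X.Γ i = (∑ a, J a i • (Y.Γ a).map f) * J + J.map (X.D i) := by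
  set Γt : Fin n → Matrix (Fin n) (Fin n) A := fun i => ∑ a, J a i • (Y.Γ a).map f with hΓt
  set Γ' : Fin n → Matrix (Fin n) (Fin n) A := fun i => J' * (Γt i * J + J.map (X.D i)) with hΓ'
  have hJΓ : ∀ i, J * Γ' i = Γt i * J + J.map (X.D i) := fun i => by
    simp only [hΓ', ← mul_assoc, hJJ', one_mul]
  have hDG : ∀ i, (Y.G.map f).map (X.D i) = (Γt i)ᵀ * Y.G.map f + Y.G.map f * Γt i := fun i => by
    rw [X.map_D_map Y f hf]
    simp only [hΓt, Y.compat, Matrix.transpose_sum, Finset.sum_mul, Finset.mul_sum,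
      ← Finset.sum_add_distrib]
    refine Finset.sum_congr rfl fun a _ => ?_
    rw [Matrix.map_add f (map_add f), Matrix.map_mul, Matrix.map_mul, Matrix.transpose_map,
      Matrix.transpose_smul, Matrix.smul_mul, Matrix.mul_smul, ← smul_add]
  clear_value Γ'
  have hu : Γ' = X.Γ := by
    refine X.connection_unique Γ' (fun i j k => ?_) fun i => ?_
    · simp only [hΓ', Matrix.mul_apply (M := J')]
      refine Finset.sum_congr rfl fun c _ => ?_
      congr 1
      have e : ∀ i j, (Γt i * J) c j = ∑ a, ∑ b, J a i * f (Y.Γ a c b) * J b j := fun i j => by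
        simp only [hΓt, Matrix.mul_apply, Matrix.sum_apply, Matrix.smul_apply, Matrix.map_apply,
          smul_eq_mul, Finset.sum_mul]
        exact Finset.sum_comm
      rw [Matrix.add_apply, Matrix.add_apply, e, e, Matrix.map_apply, Matrix.map_apply, hJ]
      congr 1
      rw [Finset.sum_comm]
      exact Finset.sum_congr rfl fun a _ => Finset.sum_congr rfl fun b _ => by
        rw [Y.torsion]; ring
    · rw [hG, map_derivation_mul, map_derivation_mul, map_derivation_transpose, hDG]
      have e1 : (Γ' i)ᵀ * (Jᵀ * Y.G.map f * J) = (J * Γ' i)ᵀ * Y.G.map f * J := by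
        rw [Matrix.transpose_mul]
        noncomm_ring
      have e2 : Jᵀ * Y.G.map f * J * Γ' i = Jᵀ * Y.G.map f * (J * Γ' i) := by noncomm_ring
      rw [e1, e2, hJΓ, Matrix.transpose_add, Matrix.transpose_mul]
      noncomm_ring
  rw [← hu, hJΓ]

include hJJ' hf hJ hG in
-- The inhomogeneous terms of the connection law cancel, because second derivatives of `J` commute
-- and $\partial_iJ_{bj}$ is symmetric in `i`, `j`.
theorem pullback_Ω (i j : Fin n) :
    J * X.Ω i j = (∑ a, ∑ b, (J a i * J b j) • (Y.Ω a b).map f) * J := by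
  set Γt : Fin n → Matrix (Fin n) (Fin n) A := fun i => ∑ a, J a i • (Y.Γ a).map f with hΓt
  have hc : ∀ i, J * X.Γ i = Γt i * J + J.map (X.D i) := X.pullback_connection Y f hJJ' hf hJ hG
  have hD : ∀ i j, J * (X.Γ j).map (X.D i) = (Γt j).map (X.D i) * J + Γt j * J.map (X.D i)
      + (J.map (X.D j)).map (X.D i) - J.map (X.D i) * X.Γ j := fun i j => by
    have := congrArg (fun T : Matrix (Fin n) (Fin n) A => T.map (X.D i)) (hc j)
    simp only [map_derivation_mul, map_derivation_add] at this
    rw [← this]; abel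
  have hΓ : ∀ i j, J * X.Γ i * X.Γ j = Γt i * (Γt j * J + J.map (X.D j))
      + J.map (X.D i) * X.Γ j := fun i j => by
    rw [hc, add_mul, mul_assoc, hc]
  have h1 : J * X.Ω i j =
      ((Γt j).map (X.D i) - (Γt i).map (X.D j) + Γt i * Γt j - Γt j * Γt i) * J := by
    rw [Ω, mul_sub, mul_add, mul_sub, hD, hD, ← mul_assoc, ← mul_assoc, hΓ, hΓ, X.map_D_comm i j]
    noncomm_ring
  have h2 : ∀ i j, (Γt j).map (X.D i) = ∑ b, X.D i (J b j) • (Y.Γ b).map f +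
      ∑ a, ∑ b, (J a i * J b j) • ((Y.Γ b).map (Y.D a)).map f := fun i j => by
    ext p q
    simp only [hΓt, Matrix.map_apply, Matrix.sum_apply, Matrix.smul_apply, Matrix.add_apply,
      map_sum, smul_eq_mul, Derivation.leibniz, hf, Finset.sum_add_distrib, Finset.mul_sum]
    rw [add_comm]
    congr 1
    · exact Finset.sum_congr rfl fun _ _ => mul_comm _ _
    · rw [Finset.sum_comm]
      exact Finset.sum_congr rfl fun _ _ => Finset.sum_congr rfl fun _ _ => by ring
  have h3 : ∀ i j, Γt i * Γt j = ∑ a, ∑ b, (J a i * J b j) • (Y.Γ a * Y.Γ b).map f := fun i j => by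
    simp only [hΓt, Finset.sum_mul, Finset.mul_sum, Matrix.smul_mul, Matrix.mul_smul, smul_smul,
      Matrix.map_mul]
    rw [Finset.sum_comm]
    exact Finset.sum_congr rfl fun _ _ => Finset.sum_congr rfl fun _ _ => by rw [mul_comm]
  rw [h1]
  congr 1
  have e : ∀ T : Fin n → Fin n → Matrix (Fin n) (Fin n) B,
      ∑ a, ∑ b, (J a j * J b i) • (T b a).map f = ∑ a, ∑ b, (J a i * J b j) • (T a b).map f :=
    fun T => by
      rw [Finset.sum_comm]
      exact Finset.sum_congr rfl fun _ _ => Finset.sum_congr rfl fun _ _ => by rw [mul_comm]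
  have hs : ∑ b, X.D i (J b j) • (Y.Γ b).map f = ∑ b, X.D j (J b i) • (Y.Γ b).map f :=
    Finset.sum_congr rfl fun b _ => by rw [hJ]
  rw [h2, h2 j i, h3, h3 j i, hs, e (fun b a => (Y.Γ b).map (Y.D a)), e (fun b a => Y.Γ a * Y.Γ b)]
  rw [add_sub_add_left_eq_sub]
  simp only [← Finset.sum_sub_distrib, ← Finset.sum_add_distrib, ← smul_sub, ← smul_add]
  refine Finset.sum_congr rfl fun a _ => Finset.sum_congr rfl fun b _ => ?_
  congr 1
  rw [Ω, Matrix.map_sub f (map_sub f), Matrix.map_add f (map_add f), Matrix.map_sub f (map_sub f)]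

include hJJ' hf hJ hG in
theorem pullback_ric :
    Matrix.of X.ric = Jᵀ * (Matrix.of Y.ric).map f * J := by
  have hΩ : ∀ i j, X.Ω i j = J' * (∑ a, ∑ b, (J a i * J b j) • (Y.Ω a b).map f) * J :=
    fun i j => by
      have hJ'J : J' * J = 1 := mul_eq_one_comm.mp hJJ'
      rw [mul_assoc, ← X.pullback_Ω Y f hJJ' hf hJ hG, ← mul_assoc, hJ'J, one_mul]
  ext i j
  have h1 : X.ric i j = ∑ k, ∑ d, ∑ a, ∑ b, ∑ c,
      J a k * J' k c * (J b i * f (Y.Ω a b c d) * J d j) := by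
    rw [ric]
    refine Finset.sum_congr rfl fun k _ => ?_
    rw [hΩ]
    simp only [Matrix.mul_apply, Matrix.sum_apply, Matrix.smul_apply, Matrix.map_apply,
      smul_eq_mul, Finset.sum_mul, Finset.mul_sum]
    exact Finset.sum_congr rfl fun d _ => Finset.sum_congr rfl fun c _ =>
      Finset.sum_congr rfl fun a _ => Finset.sum_congr rfl fun b _ => by ring
  -- In the trace that defines Ricci the Jacobian of the contracted lower index meets the inverse
  -- Jacobian of the upper one.
  have h2 : ∀ a c, ∑ k, J a k * J' k c = (1 : Matrix (Fin n) (Fin n) A) a c := fun a c => by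
    rw [← hJJ']; rfl
  have h3 : X.ric i j = ∑ d, ∑ a, ∑ b, ∑ c,
      (1 : Matrix (Fin n) (Fin n) A) a c * (J b i * f (Y.Ω a b c d) * J d j) := by
    rw [h1, Finset.sum_comm]
    refine Finset.sum_congr rfl fun d _ => ?_
    rw [Finset.sum_comm]
    refine Finset.sum_congr rfl fun a _ => ?_
    rw [Finset.sum_comm]
    refine Finset.sum_congr rfl fun b _ => ?_
    rw [Finset.sum_comm]
    refine Finset.sum_congr rfl fun c _ => ?_
    rw [← h2, Finset.sum_mul]
  have h4 : X.ric i j = ∑ d, ∑ a, ∑ b, J b i * f (Y.Ω a b a d) * J d j := by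
    rw [h3]
    simp [Matrix.one_apply]
  rw [Matrix.of_apply, h4]
  simp only [Matrix.mul_apply, Matrix.transpose_apply, Matrix.map_apply, Matrix.of_apply, ric,
    map_sum, Finset.sum_mul, Finset.mul_sum]
  refine Finset.sum_congr rfl fun d _ => ?_
  rw [Finset.sum_comm]

include hJJ' hG in
theorem pullback_inv : J * X.Gi * Jᵀ = Y.Gi.map f := by
  have h1 : Y.G.map f * Y.Gi.map f = 1 := by
    rw [← Matrix.map_mul, Y.mul_inv]; exact Matrix.map_one f (map_zero f) (map_one f)
  have hJ'J : J' * J = 1 := mul_eq_one_comm.mp hJJ'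
  have ht : J'ᵀ * Jᵀ = 1 := by rw [← Matrix.transpose_mul, hJJ', Matrix.transpose_one]
  have h2 : Y.G.map f * (J * X.Gi * Jᵀ) = 1 := by
    have : Y.G.map f * J = J'ᵀ * X.G := by
      rw [hG, ← mul_assoc, ← mul_assoc, ht, one_mul]
    rw [← mul_assoc, ← mul_assoc, this, mul_assoc J'ᵀ, X.mul_inv, mul_one, ht]
  have h1' : Y.Gi.map f * Y.G.map f = 1 := mul_eq_one_comm.mp h1
  calc J * X.Gi * Jᵀ = Y.Gi.map f * (Y.G.map f * (J * X.Gi * Jᵀ)) := by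
        rw [← mul_assoc, h1', one_mul]
    _ = _ := by rw [h2, mul_one]

include hJJ' hf hJ hG in
theorem pullback_scal : X.scal = f Y.scal := by
  have h := X.pullback_inv Y f hJJ' hG
  rw [scal, scal, tr2_eq_trace, tr2_eq_trace, X.pullback_ric Y f hJJ' hf hJ hG]
  have e : f (Y.Gi * (Matrix.of Y.ric)ᵀ).trace =
      (Y.Gi.map f * ((Matrix.of Y.ric).map f)ᵀ).trace := by
    rw [← Matrix.transpose_map, ← Matrix.map_mul]
    simp only [Matrix.trace, map_sum]
    rfl
  rw [e, ← h, Matrix.transpose_mul, Matrix.transpose_mul, Matrix.transpose_transpose,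
    ← mul_assoc X.Gi, ← mul_assoc, Matrix.trace_mul_comm]
  congr 1
  noncomm_ring

include hJJ' hf hJ hG in
theorem pullback_ip_ric : X.ip X.ric X.ric = f (Y.ip Y.ric Y.ric) := by
  have h := X.pullback_inv Y f hJJ' hG
  rw [ip_eq_trace, ip_eq_trace, X.pullback_ric Y f hJJ' hf hJ hG]
  have e : f (Y.Gi * (Matrix.of Y.ric) * Y.Gi * (Matrix.of Y.ric)ᵀ).trace =
      (Y.Gi.map f * (Matrix.of Y.ric).map f * Y.Gi.map f * ((Matrix.of Y.ric).map f)ᵀ).trace := by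
    rw [← Matrix.transpose_map, ← Matrix.map_mul, ← Matrix.map_mul, ← Matrix.map_mul]
    simp only [Matrix.trace, map_sum]
    rfl
  rw [e, ← h, Matrix.transpose_mul, Matrix.transpose_mul, Matrix.transpose_transpose]
  generalize (Matrix.of Y.ric).map f = R
  have e2 : X.Gi * (Jᵀ * R * J) * X.Gi * (Jᵀ * (Rᵀ * J)) =
      (X.Gi * (Jᵀ * R * J) * X.Gi * Jᵀ * Rᵀ) * J := by noncomm_ring
  rw [e2, Matrix.trace_mul_comm]
  congr 1
  noncomm_ring

end ChangeOfCoordinates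

end MetricAlg

/-! ### The ring of smooth functions on an open set -/

section SmoothFunctions

variable {V : Type*} [NormedAddCommGroup V] [NormedSpace ℝ V]

/-- The extension by zero of a function on a set. -/
def extendZero (W : Set V) (a : W → ℝ) : V → ℝ := Function.extend Subtype.val a 0

theorem extendZero_apply {W : Set V} (a : W → ℝ) {x : V} (hx : x ∈ W) :
    extendZero W a x = a ⟨x, hx⟩ :=
  Subtype.val_injective.extend_apply a 0 (⟨x, hx⟩ : W)

/-- The algebra of smooth functions on `W`. -/
def smoothAlg (W : Set V) : Subalgebra ℝ (W → ℝ) where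
  carrier := {a | ContDiffOn ℝ ∞ (extendZero W a) W}
  mul_mem' {a b} ha hb := (ha.mul hb).congr fun x hx => by
    simp [extendZero_apply, hx]
  add_mem' {a b} ha hb := (ha.add hb).congr fun x hx => by
    simp [extendZero_apply, hx]
  algebraMap_mem' c := (contDiffOn_const (c := c)).congr fun x hx => by
    simp [extendZero_apply, hx]

variable {W : Set V}

/-- A smooth function as an element of the algebra. -/
def smoothAlg.mk (F : V → ℝ) (hF : ContDiffOn ℝ ∞ F W) : smoothAlg W :=
  ⟨fun x => F x, hF.congr fun x hx => by rw [extendZero_apply _ hx]⟩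

/-- Evaluation at a point. -/
def ev {x : V} (hx : x ∈ W) : smoothAlg W →ₐ[ℝ] ℝ :=
  (Pi.evalAlgHom ℝ (fun _ : W => ℝ) ⟨x, hx⟩).comp (smoothAlg W).val

theorem smoothAlg.ext_ev {a b : smoothAlg W} (h : ∀ x (hx : x ∈ W), ev hx a = ev hx b) : a = b :=
  Subtype.ext (funext fun x => h x.1 x.2)

theorem ev_mk {x : V} (hx : x ∈ W) (F : V → ℝ) (hF : ContDiffOn ℝ ∞ F W) :
    ev hx (smoothAlg.mk F hF) = F x := rfl

/-- The function `F` represents the element `a` of the algebra of smooth functions. -/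
def Represents (F : V → ℝ) (a : smoothAlg W) : Prop := ∀ x (hx : x ∈ W), ev hx a = F x

theorem Represents.contDiffOn {F : V → ℝ} {a : smoothAlg W} (h : Represents F a) :
    ContDiffOn ℝ ∞ F W :=
  a.2.congr fun x hx => by rw [extendZero_apply _ hx]; exact (h x hx).symm

theorem contDiffOn_fderiv_apply (hW : IsOpen W) {F : V → ℝ} (hF : ContDiffOn ℝ ∞ F W) (v : V) :
    ContDiffOn ℝ ∞ (fun x => fderiv ℝ F x v) W :=
  (hF.fderiv_of_isOpen hW (by simp)).clm_apply contDiffOn_const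

theorem extendZero_eventuallyEq (hW : IsOpen W) {F : V → ℝ} {a : smoothAlg W}
    (h : Represents F a) {x : V} (hx : x ∈ W) : extendZero W a.1 =ᶠ[nhds x] F := by
  filter_upwards [hW.mem_nhds hx] with z hz
  rw [extendZero_apply _ hz]
  exact h z hz

theorem contDiffAt_extendZero (hW : IsOpen W) (a : smoothAlg W) {x : V} (hx : x ∈ W) :
    ContDiffAt ℝ ∞ (extendZero W a.1) x := a.2.contDiffAt (hW.mem_nhds hx)

/-- The directional derivative. -/
def dirDeriv (hW : IsOpen W) (v : V) : Derivation ℝ (smoothAlg W) (smoothAlg W) :=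
  Derivation.mk'
    -- At a point of the open set `W` the derivative depends only on the germ, so the extension by
    -- zero is harmless.
    { toFun := fun a => smoothAlg.mk (fun x => fderiv ℝ (extendZero W a.1) x v)
        (contDiffOn_fderiv_apply hW a.2 v)
      map_add' := fun a b => smoothAlg.ext_ev fun x hx => by
        rw [map_add, ev_mk, ev_mk, ev_mk]
        have h : extendZero W (a + b).1 =ᶠ[nhds x]
            fun z => extendZero W a.1 z + extendZero W b.1 z :=
          extendZero_eventuallyEq hW (fun z hz => by
            rw [extendZero_apply _ hz, extendZero_apply _ hz]; rfl) hx
        rw [h.fderiv_eq, fderiv_fun_add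
          ((contDiffAt_extendZero hW a hx).differentiableAt (by simp))
          ((contDiffAt_extendZero hW b hx).differentiableAt (by simp))]
        rfl
      map_smul' := fun c a => smoothAlg.ext_ev fun x hx => by
        rw [RingHom.id_apply, map_smul, ev_mk, ev_mk]
        have h : extendZero W (c • a).1 =ᶠ[nhds x] fun z => c • extendZero W a.1 z :=
          extendZero_eventuallyEq hW (fun z hz => by
            rw [extendZero_apply _ hz]; rfl) hx
        rw [h.fderiv_eq, fderiv_fun_const_smul
          ((contDiffAt_extendZero hW a hx).differentiableAt (by simp))]
        rfl }
    fun a b => smoothAlg.ext_ev fun x hx => by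
      simp only [LinearMap.coe_mk, AddHom.coe_mk, smul_eq_mul, map_add, map_mul]
      rw [ev_mk, ev_mk, ev_mk]
      have h : extendZero W (a * b).1 =ᶠ[nhds x]
          fun z => extendZero W a.1 z * extendZero W b.1 z :=
        extendZero_eventuallyEq hW (fun z hz => by
          rw [extendZero_apply _ hz, extendZero_apply _ hz]; rfl) hx
      rw [h.fderiv_eq, fderiv_fun_mul
        ((contDiffAt_extendZero hW a hx).differentiableAt (by simp))
        ((contDiffAt_extendZero hW b hx).differentiableAt (by simp))]
      simp only [ContinuousLinearMap.add_apply, ContinuousLinearMap.smul_apply, smul_eq_mul,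
        extendZero_apply _ hx]
      rfl

theorem Represents.dirDeriv {F : V → ℝ} {a : smoothAlg W} (h : Represents F a) (hW : IsOpen W)
    (v : V) : Represents (fun x => fderiv ℝ F x v) (dirDeriv hW v a) := fun x hx => by
  change fderiv ℝ (extendZero W a.1) x v = _
  rw [(extendZero_eventuallyEq hW h hx).fderiv_eq]

theorem represents_extendZero (a : smoothAlg W) : Represents (extendZero W a.1) a :=
  fun _ hx => (extendZero_apply _ hx).symm

theorem dirDeriv_comm (hW : IsOpen W) (v w : V) (a : smoothAlg W) :
    dirDeriv hW v (dirDeriv hW w a) = dirDeriv hW w (dirDeriv hW v a) := by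
  refine smoothAlg.ext_ev fun x hx => ?_
  set F := extendZero W a.1
  have hF : ContDiffAt ℝ ∞ F x := contDiffAt_extendZero hW a hx
  have hF' : DifferentiableAt ℝ (fderiv ℝ F) x :=
    (hF.fderiv_right (m := 1) (by norm_cast)).differentiableAt (by simp)
  rw [((represents_extendZero a).dirDeriv hW w).dirDeriv hW v x hx,
    ((represents_extendZero a).dirDeriv hW v).dirDeriv hW w x hx]
  have e : ∀ v w, fderiv ℝ (fun z => fderiv ℝ F z w) x v = fderiv ℝ (fderiv ℝ F) x v w :=
    fun v w => by
      rw [fderiv_clm_apply hF' (by fun_prop)]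
      simp
  change fderiv ℝ (fun z => fderiv ℝ F z w) x v = fderiv ℝ (fun z => fderiv ℝ F z v) x w
  rw [e, e]
  exact (hF.isSymmSndFDerivAt
    (by rw [minSmoothness_of_isRCLikeNormedField]; exact WithTop.coe_le_coe.2 le_top)) v w

end SmoothFunctions

/-! ### Families of metrics on open sets of coordinates -/

section Families

variable {n : ℕ} {P : Type*} [NormedAddCommGroup P] [NormedSpace ℝ P]

local notation "𝔼" => EuclideanSpace ℝ (Fin n)

/-- A smooth family of (pseudo-)metrics on an open set of parameters and coordinates. -/
structure MetricFamily (W : Set (P × EuclideanSpace ℝ (Fin n)))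
    (g : P → EuclideanSpace ℝ (Fin n) → Matrix (Fin n) (Fin n) ℝ) : Prop where
  isOpen : IsOpen W
  smooth : ∀ i j, ContDiffOn ℝ ∞ (fun x : P × EuclideanSpace ℝ (Fin n) => g x.1 x.2 i j) W
  symm : ∀ x ∈ W, (g x.1 x.2)ᵀ = g x.1 x.2
  det_pos : ∀ x ∈ W, 0 < (g x.1 x.2).det

variable {W : Set (P × EuclideanSpace ℝ (Fin n))}
  {g : P → EuclideanSpace ℝ (Fin n) → Matrix (Fin n) (Fin n) ℝ} (h : MetricFamily W g)

/-- A partial derivative at a fixed parameter is a directional derivative on the product, in a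
direction without parameter component. -/
theorem Represents.pd {f : P → EuclideanSpace ℝ (Fin n) → ℝ} {a : smoothAlg W}
    (ha : Represents (fun x : P × EuclideanSpace ℝ (Fin n) => f x.1 x.2) a) (hW : IsOpen W)
    (i : Fin n) : Represents (fun x : P × EuclideanSpace ℝ (Fin n) => pd i (f x.1) x.2)
      (QuadraticCurvature.dirDeriv hW (0, EuclideanSpace.single i 1) a) := fun x hx => by
  rw [ha.dirDeriv hW _ x hx]
  simp only [QuadraticCurvature.pd]
  have hd : DifferentiableAt ℝ (fun x : P × EuclideanSpace ℝ (Fin n) => f x.1 x.2) (x.1, x.2) :=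
    (ha.contDiffOn.contDiffAt (hW.mem_nhds hx)).differentiableAt (by simp)
  have hc := hd.hasFDerivAt.comp x.2 ((hasFDerivAt_const x.1 x.2).prodMk (hasFDerivAt_id x.2))
  have : f x.1 = (fun x : P × EuclideanSpace ℝ (Fin n) => f x.1 x.2) ∘ fun y => (x.1, y) := rfl
  rw [this]
  have hc' := hc.fderiv
  erw [hc']
  simp

namespace MetricFamily

/-- The matrix of components of the metric over the ring of smooth functions. -/
def metric : Matrix (Fin n) (Fin n) (smoothAlg W) :=
  Matrix.of fun i j => smoothAlg.mk (fun x => g x.1 x.2 i j) (h.smooth i j)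

theorem map_metric {x : P × EuclideanSpace ℝ (Fin n)} (hx : x ∈ W) :
    h.metric.map (ev hx) = g x.1 x.2 := rfl

theorem ev_det {x : P × EuclideanSpace ℝ (Fin n)} (hx : x ∈ W) :
    ev hx h.metric.det = (g x.1 x.2).det := by
  rw [← h.map_metric hx]
  exact (ev hx).toRingHom.map_det _

/-- The square root of the determinant. -/
def vol : smoothAlg W := smoothAlg.mk (fun x => √(g x.1 x.2).det) <| by
  refine ContDiffOn.sqrt ?_ fun x hx => (h.det_pos x hx).ne'
  exact h.metric.det.2.congr fun x hx => by
    rw [extendZero_apply _ hx]; exact (h.ev_det hx).symm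

/-- The inverse of the volume density. -/
def volInv : smoothAlg W := smoothAlg.mk (fun x => (√(g x.1 x.2).det)⁻¹) <|
  ContDiffOn.inv h.vol.2 (fun x hx => by
    rw [extendZero_apply _ hx]
    exact (Real.sqrt_pos.2 (h.det_pos x hx)).ne') |>.congr fun x hx => by
      rw [Pi.inv_apply, extendZero_apply _ hx]; rfl

theorem vol_mul_vol : h.vol * h.vol = h.metric.det := smoothAlg.ext_ev fun x hx => by
  rw [h.ev_det, map_mul, vol, ev_mk]
  exact Real.mul_self_sqrt (h.det_pos x hx).le

theorem vol_mul_volInv : h.vol * h.volInv = 1 := smoothAlg.ext_ev fun x hx => by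
  rw [map_mul, vol, volInv, ev_mk, ev_mk, map_one]
  exact mul_inv_cancel₀ (Real.sqrt_pos.2 (h.det_pos x hx)).ne'

theorem isUnit_det : IsUnit h.metric.det := by
  rw [← h.vol_mul_vol]
  have := IsUnit.of_mul_eq_one _ h.vol_mul_volInv
  exact this.mul this

/-- The metric over the ring of smooth functions. -/
def alg : MetricAlg n (smoothAlg W) :=
  MetricAlg.ofMetric (fun i => dirDeriv h.isOpen (0, EuclideanSpace.single i 1))
    (fun _ _ _ => dirDeriv_comm _ _ _ _) h.metric h.metric⁻¹
    (by
      refine Matrix.ext fun i j => smoothAlg.ext_ev fun x hx => ?_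
      exact congrFun (congrFun (h.symm x hx) i) j)
    (Matrix.mul_nonsing_inv _ h.isUnit_det)

/-- The lemmas `rep_*` form the dictionary between the coordinate expressions and their algebraic
counterparts; through it identities in the ring become pointwise identities. -/
theorem rep_G (i j : Fin n) : Represents (fun x => g x.1 x.2 i j) (h.alg.G i j) :=
  fun _ _ => rfl

theorem map_Gi {x : P × EuclideanSpace ℝ (Fin n)} (hx : x ∈ W) :
    h.alg.Gi.map (ev hx) = (g x.1 x.2)⁻¹ := by
  symm
  apply Matrix.inv_eq_right_inv
  rw [← h.map_metric hx]
  change h.alg.G.map (ev hx) * _ = 1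
  rw [← Matrix.map_mul, h.alg.mul_inv]
  exact Matrix.map_one _ (map_zero _) (map_one _)

theorem rep_Gi (i j : Fin n) : Represents (fun x => (g x.1 x.2)⁻¹ i j) (h.alg.Gi i j) :=
  fun x hx => congrFun (congrFun (h.map_Gi hx) i) j

theorem rep_D {f : P → EuclideanSpace ℝ (Fin n) → ℝ} {a : smoothAlg W}
    (ha : Represents (fun x : P × EuclideanSpace ℝ (Fin n) => f x.1 x.2) a) (i : Fin n) :
    Represents (fun x : P × EuclideanSpace ℝ (Fin n) => pd i (f x.1) x.2) (h.alg.D i a) :=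
  ha.pd h.isOpen i

theorem rep_Γ (k i j : Fin n) :
    Represents (fun x => christoffel (g x.1) k i j x.2) (h.alg.Γ i k j) := fun x hx => by
  have e : h.alg.Γ i k j = algebraMap ℝ _ (1 / 2) * ∑ l, h.alg.Gi k l *
    (h.alg.D i (h.alg.G j l) + h.alg.D j (h.alg.G i l) - h.alg.D l (h.alg.G i j)) := rfl
  have hp : ∀ p i j, ev hx (h.alg.D p (h.alg.G i j)) = pd p (fun z => g x.1 z i j) x.2 :=
    fun p i j => h.rep_D (f := fun p z => g p z i j) (h.rep_G i j) p x hx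
  rw [e, map_mul, map_sum, AlgHom.commutes]
  simp only [map_mul, map_add, map_sub, hp, h.rep_Gi _ _ x hx, christoffel]
  rfl

theorem rep_Ω (i j k l : Fin n) :
    Represents (fun x => curv (g x.1) i j k l x.2) (h.alg.Ω i j l k) := fun x hx => by
  have h1 : ∀ i l j k, ev hx (h.alg.D i (h.alg.Γ j l k)) =
    pd i (christoffel (g x.1) l j k) x.2 := fun i l j k =>
      h.rep_D (f := fun p => christoffel (g p) l j k) (h.rep_Γ l j k) i x hx
  have h2 := fun k i j => h.rep_Γ k i j x hx
  simp only [MetricAlg.Ω, Matrix.sub_apply, Matrix.add_apply, Matrix.mul_apply, Matrix.map_apply,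
    map_sub, map_add, map_sum, map_mul, h1, h2, curv, Finset.sum_sub_distrib]
  ring

theorem rep_riem (i j k l : Fin n) :
    Represents (fun x => riem (g x.1) i j k l x.2) (h.alg.riem i j k l) := fun x hx => by
  have h1 := fun i j k l => h.rep_Ω i j k l x hx
  have h2 := fun i j => h.rep_G i j x hx
  simp only [MetricAlg.riem, Matrix.mul_apply, map_sum, map_mul, h1, h2, riem]

theorem rep_ric (i j : Fin n) :
    Represents (fun x => ric (g x.1) x.2 i j) (h.alg.ric i j) := fun x hx => by
  have h1 := fun i j k l => h.rep_Ω i j k l x hx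
  simp only [MetricAlg.ric, map_sum, h1, ric, Matrix.of_apply]

theorem ev_tr2 {x : P × EuclideanSpace ℝ (Fin n)} (hx : x ∈ W)
    (F : Fin n → Fin n → smoothAlg W) :
    ev hx (h.alg.tr2 F) = ∑ i, ∑ j, (g x.1 x.2)⁻¹ i j * ev hx (F i j) := by
  have h2 := fun i j => h.rep_Gi i j x hx
  simp only [MetricAlg.tr2, map_sum, map_mul, h2]

theorem rep_scal : Represents (fun x => scal (g x.1) x.2) h.alg.scal := fun x hx => by
  have h1 := fun i j => h.rep_ric i j x hx
  rw [MetricAlg.scal, h.ev_tr2]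
  simp only [h1, scal]

theorem rep_hess {f : P → EuclideanSpace ℝ (Fin n) → ℝ} {a : smoothAlg W}
    (ha : Represents (fun x : P × EuclideanSpace ℝ (Fin n) => f x.1 x.2) a) (i j : Fin n) :
    Represents (fun x : P × EuclideanSpace ℝ (Fin n) => hess (g x.1) (f x.1) i j x.2)
      (h.alg.hess a i j) := fun x hx => by
  have h1 := fun k => h.rep_D ha k
  have h2 : ev hx (h.alg.D i (h.alg.D j a)) = pd i (pd j (f x.1)) x.2 :=
    h.rep_D (f := fun p => pd j (f p)) (h1 j) i x hx
  have h3 := fun k i j => h.rep_Γ k i j x hx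
  have h4 := fun k => h1 k x hx
  simp only [MetricAlg.hess, MetricAlg.cov1, MetricAlg.act, map_sub, map_sum, map_mul, h2, h3, h4,
    hess]

theorem rep_lap {f : P → EuclideanSpace ℝ (Fin n) → ℝ} {a : smoothAlg W}
    (ha : Represents (fun x : P × EuclideanSpace ℝ (Fin n) => f x.1 x.2) a) :
    Represents (fun x : P × EuclideanSpace ℝ (Fin n) => lap (g x.1) (f x.1) x.2)
      (h.alg.lap a) := fun x hx => by
  have h1 := fun i j => h.rep_hess ha i j x hx
  rw [MetricAlg.lap, h.ev_tr2]
  simp only [h1, lap]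

section Tensors

variable {T : P → EuclideanSpace ℝ (Fin n) → Matrix (Fin n) (Fin n) ℝ}
  {S : Fin n → Fin n → smoothAlg W}
  (hT : ∀ i j, Represents (fun x : P × EuclideanSpace ℝ (Fin n) => T x.1 x.2 i j) (S i j))

include hT

theorem rep_cov2 (k i j : Fin n) :
    Represents (fun x : P × EuclideanSpace ℝ (Fin n) => covDeriv (g x.1) (T x.1) k i j x.2)
      (h.alg.cov2 k S i j) := fun x hx => by
  have h1 := h.rep_D (f := fun p z => T p z i j) (hT i j) k x hx
  have h2 := fun i j => hT i j x hx
  have h3 := fun k i j => h.rep_Γ k i j x hx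
  simp only [MetricAlg.cov2, MetricAlg.act, map_sub, map_sum, map_mul, h1, h2, h3, covDeriv,
    Finset.sum_add_distrib]
  ring

theorem rep_lap2 (i j : Fin n) :
    Represents (fun x : P × EuclideanSpace ℝ (Fin n) => tensorLap (g x.1) (T x.1) i j x.2)
      (h.alg.lap2 S i j) := fun x hx => by
  have h0 := h.rep_cov2 hT
  have h1 : ∀ l k i j, ev hx (h.alg.D l (h.alg.cov2 k S i j)) =
    pd l (covDeriv (g x.1) (T x.1) k i j) x.2 := fun l k i j =>
      h.rep_D (f := fun p => covDeriv (g p) (T p) k i j) (h0 k i j) l x hx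
  have h2 := fun k i j => h0 k i j x hx
  have h3 := fun k i j => h.rep_Γ k i j x hx
  rw [MetricAlg.lap2, h.ev_tr2]
  simp only [tensorLap]
  refine Finset.sum_congr rfl fun k _ => Finset.sum_congr rfl fun l _ => ?_
  simp only [MetricAlg.cov3, MetricAlg.act, map_sub, map_sum, map_mul, h1, h2, h3, covDeriv2,
    Finset.sum_add_distrib]
  ring

theorem rep_rmC (i j : Fin n) :
    Represents (fun x : P × EuclideanSpace ℝ (Fin n) => riemContract (g x.1) (T x.1) i j x.2)
      (h.alg.rmC S i j) := fun x hx => by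
  have h1 := fun i j k l => h.rep_riem i j k l x hx
  have h2 := fun i j => hT i j x hx
  rw [MetricAlg.rmC, h.ev_tr2]
  simp only [h.ev_tr2, map_mul, h1, h2, riemContract, Finset.mul_sum]
  refine Finset.sum_congr rfl fun k _ => ?_
  rw [Finset.sum_comm]
  refine Finset.sum_congr rfl fun l _ => Finset.sum_congr rfl fun p _ =>
    Finset.sum_congr rfl fun q _ => by ring

theorem rep_normSq :
    Represents (fun x : P × EuclideanSpace ℝ (Fin n) => normSq (g x.1) (T x.1) x.2)
      (h.alg.ip S S) := fun x hx => by
  have h2 := fun i j => hT i j x hx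
  rw [MetricAlg.ip, h.ev_tr2]
  simp only [h.ev_tr2, map_mul, h2, normSq, Finset.mul_sum]
  refine Finset.sum_congr rfl fun k _ => ?_
  rw [Finset.sum_comm]
  refine Finset.sum_congr rfl fun l _ => Finset.sum_congr rfl fun p _ =>
    Finset.sum_congr rfl fun q _ => by ring

end Tensors

end MetricFamily

end Families

/-! ### The first variation in coordinates -/

section Local

variable {n : ℕ}

/-- The Lagrangian `|Ric|² + t R²`. -/
def lagrangian (t : ℝ) (G : EuclideanSpace ℝ (Fin n) → Matrix (Fin n) (Fin n) ℝ)
    (y : EuclideanSpace ℝ (Fin n)) : ℝ :=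
  normSq G (ric G) y + t * scal G y ^ 2

/-- The Lagrangian density. -/
def density (t : ℝ) (G : EuclideanSpace ℝ (Fin n) → Matrix (Fin n) (Fin n) ℝ)
    (y : EuclideanSpace ℝ (Fin n)) : ℝ :=
  √(G y).det * lagrangian t G y

/-- Twice the gradient of the functional `∫ |Ric|² + t R²`. -/
def gradient (t : ℝ) (G : EuclideanSpace ℝ (Fin n) → Matrix (Fin n) (Fin n) ℝ) (i j : Fin n)
    (y : EuclideanSpace ℝ (Fin n)) : ℝ :=
  2 * (1 + 2 * t) * hess G (scal G) i j y - 2 * tensorLap G (ric G) i j y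
    - (1 + 4 * t) * lap G (scal G) y * G y i j - 4 * riemContract G (ric G) i j y
    - 4 * t * scal G y * ric G y i j + lagrangian t G y * G y i j

/-- The inner product of two-tensors. -/
def pairing (G : EuclideanSpace ℝ (Fin n) → Matrix (Fin n) (Fin n) ℝ) (S T : Fin n → Fin n → ℝ)
    (y : EuclideanSpace ℝ (Fin n)) : ℝ :=
  ∑ i, ∑ k, (G y)⁻¹ i k * ∑ j, ∑ l, (G y)⁻¹ j l * (S i j * T k l)

/-- The first variation of the Lagrangian density. -/
def firstVar (t : ℝ) (G H : EuclideanSpace ℝ (Fin n) → Matrix (Fin n) (Fin n) ℝ)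
    (y : EuclideanSpace ℝ (Fin n)) : ℝ :=
  deriv (fun s : ℝ => density t (fun z => G z + s • H z) y) 0

/-- A smooth symmetric two-tensor on an open set. -/
structure LocalTensor (U : Set (EuclideanSpace ℝ (Fin n)))
    (T : EuclideanSpace ℝ (Fin n) → Matrix (Fin n) (Fin n) ℝ) : Prop where
  smooth : ∀ i j, ContDiffOn ℝ ∞ (fun y => T y i j) U
  symm : ∀ y ∈ U, (T y)ᵀ = T y

namespace LocalTensor

variable {U : Set (EuclideanSpace ℝ (Fin n))}
  {S T : EuclideanSpace ℝ (Fin n) → Matrix (Fin n) (Fin n) ℝ}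

theorem add (hS : LocalTensor U S) (hT : LocalTensor U T) : LocalTensor U (fun y => S y + T y) where
  smooth i j := (hS.smooth i j).add (hT.smooth i j)
  symm y hy := by rw [Matrix.transpose_add, hS.symm y hy, hT.symm y hy]

theorem smul (hT : LocalTensor U T) (c : ℝ) : LocalTensor U (fun y => c • T y) where
  smooth i j := (hT.smooth i j).const_smul c
  symm y hy := by rw [Matrix.transpose_smul, hT.symm y hy]

theorem mono (hT : LocalTensor U T) {U' : Set (EuclideanSpace ℝ (Fin n))} (h : U' ⊆ U) :
    LocalTensor U' T where
  smooth i j := (hT.smooth i j).mono h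
  symm y hy := hT.symm y (h hy)

theorem continuousOn_det (hT : LocalTensor U T) : ContinuousOn (fun y => (T y).det) U := by
  simp only [Matrix.det_apply]
  exact continuousOn_finsetSum _ fun σ _ => (continuousOn_finsetProd _ fun i _ =>
    (hT.smooth _ _).continuousOn).const_smul _

end LocalTensor

/-- A family of metrics depending smoothly on parameters is a metric family where the determinant
is positive. -/
theorem metricFamily_of_smooth {P : Type*} [NormedAddCommGroup P] [NormedSpace ℝ P]
    {U : Set (EuclideanSpace ℝ (Fin n))} (hU : IsOpen U)
    {g : P → EuclideanSpace ℝ (Fin n) → Matrix (Fin n) (Fin n) ℝ}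
    (hg : ∀ i j, ContDiffOn ℝ ∞ (fun x : P × EuclideanSpace ℝ (Fin n) => g x.1 x.2 i j)
      (Set.univ ×ˢ U))
    (hs : ∀ p, ∀ y ∈ U, (g p y)ᵀ = g p y) :
    MetricFamily {x : P × EuclideanSpace ℝ (Fin n) | x.2 ∈ U ∧ 0 < (g x.1 x.2).det} g where
  isOpen := by
    have hc : ContinuousOn (fun x : P × EuclideanSpace ℝ (Fin n) => (g x.1 x.2).det)
        (Set.univ ×ˢ U) := by
      simp only [Matrix.det_apply]
      exact continuousOn_finsetSum _ fun σ _ => (continuousOn_finsetProd _ fun i _ =>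
        (hg _ _).continuousOn).const_smul _
    have := hc.isOpen_inter_preimage (isOpen_univ.prod hU) (isOpen_Ioi (a := (0 : ℝ)))
    convert this using 1
    ext x; simp
  smooth i j := (hg i j).mono fun x hx => ⟨trivial, hx.1⟩
  symm x hx := hs _ _ hx.1
  det_pos x hx := hx.2

/-- A single metric as a constant family, so that the same dictionary applies to it. -/
theorem LocalTensor.metricFamily {U : Set (EuclideanSpace ℝ (Fin n))} (hU : IsOpen U)
    {G : EuclideanSpace ℝ (Fin n) → Matrix (Fin n) (Fin n) ℝ} (hG : LocalTensor U G)
    (P : Type*) [NormedAddCommGroup P] [NormedSpace ℝ P] :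
    MetricFamily {x : P × EuclideanSpace ℝ (Fin n) | x.2 ∈ U ∧ 0 < (G x.2).det} fun _ => G :=
  metricFamily_of_smooth hU
    (fun i j => (hG.smooth i j).comp contDiff_snd.contDiffOn fun _ hx => hx.2)
    fun _ y hy => hG.symm y hy

/-- The variation parameter becomes a coordinate, which makes its derivative a derivation of the
ring. -/
theorem LocalTensor.metricFamily_line {U : Set (EuclideanSpace ℝ (Fin n))} (hU : IsOpen U)
    {G H : EuclideanSpace ℝ (Fin n) → Matrix (Fin n) (Fin n) ℝ} (hG : LocalTensor U G)
    (hH : LocalTensor U H) :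
    MetricFamily {x : ℝ × EuclideanSpace ℝ (Fin n) | x.2 ∈ U ∧ 0 < (G x.2 + x.1 • H x.2).det}
      fun s z => G z + s • H z :=
  metricFamily_of_smooth hU
    (fun i j => ((hG.smooth i j).comp contDiff_snd.contDiffOn fun _ hx => hx.2).add
      (contDiff_fst.contDiffOn.mul
        ((hH.smooth i j).comp contDiff_snd.contDiffOn fun _ hx => hx.2)))
    fun s y hy => (hG.add (hH.smul s)).symm y hy

theorem LocalTensor.metricFamily_plane {U : Set (EuclideanSpace ℝ (Fin n))} (hU : IsOpen U)
    {G H H' : EuclideanSpace ℝ (Fin n) → Matrix (Fin n) (Fin n) ℝ} (hG : LocalTensor U G)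
    (hH : LocalTensor U H) (hH' : LocalTensor U H') :
    MetricFamily {x : (ℝ × ℝ) × EuclideanSpace ℝ (Fin n) |
      x.2 ∈ U ∧ 0 < (G x.2 + (x.1.1 • H x.2 + x.1.2 • H' x.2)).det}
      fun s z => G z + (s.1 • H z + s.2 • H' z) := by
  refine metricFamily_of_smooth (P := ℝ × ℝ) (g := fun s z => G z + (s.1 • H z + s.2 • H' z)) hU
    (fun i j => ?_) fun s y hy => (hG.add ((hH.smul s.1).add (hH'.smul s.2))).symm y hy
  have hc : ∀ {T : EuclideanSpace ℝ (Fin n) → Matrix (Fin n) (Fin n) ℝ}, LocalTensor U T →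
      ContDiffOn ℝ ∞ (fun x : (ℝ × ℝ) × EuclideanSpace ℝ (Fin n) => T x.2 i j)
        (Set.univ ×ˢ U) := fun hT =>
    (hT.smooth i j).comp contDiff_snd.contDiffOn fun _ hx => hx.2
  exact (hc hG).add (((contDiff_fst.comp contDiff_fst).contDiffOn.mul (hc hH)).add
    ((contDiff_snd.comp contDiff_fst).contDiffOn.mul (hc hH')))

namespace MetricFamily

variable {P : Type*} [NormedAddCommGroup P] [NormedSpace ℝ P]
  {W : Set (P × EuclideanSpace ℝ (Fin n))}
  {g : P → EuclideanSpace ℝ (Fin n) → Matrix (Fin n) (Fin n) ℝ} (h : MetricFamily W g)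

theorem rep_lag (t : ℝ) : Represents (fun x => lagrangian t (g x.1) x.2)
    (h.alg.lag (algebraMap ℝ _ t)) := fun x hx => by
  have h1 := h.rep_normSq (T := fun p => ric (g p)) h.rep_ric x hx
  have h2 := h.rep_scal x hx
  simp only [MetricAlg.lag, map_add, map_mul, map_pow, AlgHom.commutes, h1, h2, lagrangian]
  rfl

theorem rep_density (t : ℝ) : Represents (fun x => density t (g x.1) x.2)
    (h.vol * h.alg.lag (algebraMap ℝ _ t)) := fun x hx => by
  rw [map_mul, h.rep_lag t x hx]; rfl

theorem contDiffOn_density (h : MetricFamily W g) (t : ℝ) : ContDiffOn ℝ ∞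
    (fun x : P × EuclideanSpace ℝ (Fin n) => density t (g x.1) x.2) W :=
  (h.rep_density t).contDiffOn

theorem rep_grad (t : ℝ) (i j : Fin n) : Represents (fun x => gradient t (g x.1) i j x.2)
    (h.alg.grad (algebraMap ℝ _ t) i j) := fun x hx => by
  have h1 := h.rep_lag t x hx
  have h2 := h.rep_scal x hx
  have h3 := h.rep_hess (f := fun p => scal (g p)) h.rep_scal i j x hx
  have h4 := h.rep_lap (f := fun p => scal (g p)) h.rep_scal x hx
  have h5 := h.rep_lap2 (T := fun p => ric (g p)) h.rep_ric i j x hx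
  have h6 := h.rep_rmC (T := fun p => ric (g p)) h.rep_ric i j x hx
  have h7 := h.rep_ric i j x hx
  have h8 := h.rep_G i j x hx
  simp only [MetricAlg.grad, map_add, map_sub, map_mul, map_one, map_ofNat, AlgHom.commutes,
    h1, h2, h3, h4, h5, h6, h7, h8, gradient]
  rfl

theorem ev_ip {x : P × EuclideanSpace ℝ (Fin n)} (hx : x ∈ W) (S T : Fin n → Fin n → smoothAlg W) :
    ev hx (h.alg.ip S T) =
      pairing (g x.1) (fun i j => ev hx (S i j)) (fun i j => ev hx (T i j)) x.2 := by
  simp only [MetricAlg.ip, h.ev_tr2, map_mul, pairing]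

end MetricFamily

variable {U : Set (EuclideanSpace ℝ (Fin n))}
  {G H H' : EuclideanSpace ℝ (Fin n) → Matrix (Fin n) (Fin n) ℝ}

theorem hasDerivAt_density (hU : IsOpen U) (hG : LocalTensor U G) (hH : LocalTensor U H)
    (t : ℝ) {s : ℝ} {y : EuclideanSpace ℝ (Fin n)} (hy : y ∈ U)
    (hdet : 0 < (G y + s • H y).det) :
    HasDerivAt (fun s : ℝ => density t (fun z => G z + s • H z) y)
      (fderiv ℝ (fun x : ℝ × EuclideanSpace ℝ (Fin n) =>
        density t (fun z => G z + x.1 • H z) x.2) (s, y) (1, 0)) s := by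
  have hF := hG.metricFamily_line hU hH
  have hd : DifferentiableAt ℝ (fun x : ℝ × EuclideanSpace ℝ (Fin n) =>
      density t (fun z => G z + x.1 • H z) x.2) (s, y) :=
    ((hF.contDiffOn_density t).contDiffAt (hF.isOpen.mem_nhds ⟨hy, hdet⟩)).differentiableAt
      (by simp)
  exact hd.hasFDerivAt.comp_hasDerivAt s ((hasDerivAt_id s).prodMk (hasDerivAt_const s y))

/-- With one parameter for each of `H`, `H'`, the three first variations are values of a single
total derivative, which is linear. -/
theorem firstVar_add (hU : IsOpen U) (hG : LocalTensor U G) (hH : LocalTensor U H)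
    (hH' : LocalTensor U H') (t : ℝ) {y : EuclideanSpace ℝ (Fin n)} (hy : y ∈ U)
    (hdet : 0 < (G y).det) :
    firstVar t G (fun z => H z + H' z) y = firstVar t G H y + firstVar t G H' y := by
  have hF := hG.metricFamily_plane hU hH hH'
  set Φ : (ℝ × ℝ) × EuclideanSpace ℝ (Fin n) → ℝ := fun x =>
    density t (fun z => G z + (x.1.1 • H z + x.1.2 • H' z)) x.2
  have hd : DifferentiableAt ℝ Φ ((0, 0), y) :=
    ((hF.contDiffOn_density t).contDiffAt
      (hF.isOpen.mem_nhds (show _ ∧ _ from ⟨hy, by simpa using hdet⟩))).differentiableAt (by simp)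
  have key : ∀ a b : ℝ, HasDerivAt (fun s : ℝ => Φ ((s * a, s * b), y))
      (fderiv ℝ Φ ((0, 0), y) ((a, b), 0)) 0 := fun a b => by
    have h0 : ((0 * a, 0 * b), y) = (((0 : ℝ), (0 : ℝ)), y) := by simp
    have h1 : HasDerivAt (fun s : ℝ => ((s * a, s * b), y)) (((1 * a, 1 * b), 0)) (0 : ℝ) :=
      (((hasDerivAt_id (0 : ℝ)).mul_const a).prodMk
        ((hasDerivAt_id (0 : ℝ)).mul_const b)).prodMk (hasDerivAt_const _ _)
    rw [one_mul, one_mul] at h1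
    rw [← h0] at hd
    have := hd.hasFDerivAt.comp_hasDerivAt (0 : ℝ) h1
    rwa [h0] at this
  have e1 := key 1 1
  have e2 := key 1 0
  have e3 := key 0 1
  simp only [Φ, mul_one, mul_zero, zero_smul, zero_add, add_zero, ← smul_add] at e1 e2 e3
  rw [firstVar, firstVar, firstVar, e1.deriv, e2.deriv, e3.deriv, ← map_add]
  simp

/-- `MetricAlg.first_variation` for the derivation $\partial_s$, evaluated at $s=0$. The condition
on `V` says that its support follows that of `H`. -/
theorem exists_divergence (hU : IsOpen U) (hG : LocalTensor U G) (hpos : ∀ y ∈ U, 0 < (G y).det)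
    (hH : LocalTensor U H) (t : ℝ) :
    ∃ V : Fin n → EuclideanSpace ℝ (Fin n) → ℝ, (∀ i, ContDiffOn ℝ ∞ (V i) U) ∧
      (∀ i, ∀ y, (y ∈ U → H =ᶠ[nhds y] 0) → V i y = 0) ∧
      ∀ y ∈ U, 2 * firstVar t G H y =
        √(G y).det * pairing G (fun i j => gradient t G i j y) (H y) y + ∑ i, pd i (V i) y := by
  have hF := hG.metricFamily_line hU hH
  set W := {x : ℝ × EuclideanSpace ℝ (Fin n) | x.2 ∈ U ∧ 0 < (G x.2 + x.1 • H x.2).det} with hW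
  set δ := dirDeriv hF.isOpen ((1 : ℝ), (0 : EuclideanSpace ℝ (Fin n)))
  have hmem : ∀ y ∈ U, ((0 : ℝ), y) ∈ W := fun y hy => ⟨hy, by simpa using hpos y hy⟩
  have hvar : ∀ i j, Represents (fun x : ℝ × EuclideanSpace ℝ (Fin n) => H x.2 i j)
      (hF.alg.var δ i j) := fun i j x hx => by
    have h1 := (hF.rep_G i j).dirDeriv hF.isOpen ((1 : ℝ), (0 : EuclideanSpace ℝ (Fin n))) x hx
    rw [MetricAlg.var, h1]
    have hd : DifferentiableAt ℝ (fun x : ℝ × EuclideanSpace ℝ (Fin n) =>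
        (G x.2 + x.1 • H x.2) i j) x :=
      ((hF.rep_G i j).contDiffOn.contDiffAt (hF.isOpen.mem_nhds hx)).differentiableAt (by simp)
    have h2 := hd.hasFDerivAt.comp_hasDerivAt x.1
      (((hasDerivAt_id x.1).prodMk (hasDerivAt_const x.1 x.2)))
    have h3 : HasDerivAt (fun s : ℝ => G x.2 i j + s * H x.2 i j) (1 * H x.2 i j) x.1 :=
      ((hasDerivAt_id x.1).mul_const _).const_add _
    rw [one_mul] at h3
    exact h2.unique h3
  obtain ⟨V, hV, hV'⟩ := hF.alg.first_variation δ (fun i a => dirDeriv_comm _ _ _ _)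
    hF.vol_mul_vol hF.vol_mul_volInv (algebraMap ℝ _ t) (fun i => Derivation.map_algebraMap _ t)
    (Derivation.map_algebraMap _ t)
  have hrep : ∀ i, Represents (fun x : ℝ × EuclideanSpace ℝ (Fin n) =>
      extendZero W (V i).1 (x.1, x.2)) (V i) := fun i => represents_extendZero (V i)
  refine ⟨fun i y => extendZero W (V i).1 (0, y), fun i => ?_, fun i y hy => ?_, fun y hy => ?_⟩
  · exact (hrep i).contDiffOn.comp (contDiff_const.prodMk contDiff_id).contDiffOn hmem
  · by_cases hyU : y ∈ U
    · have hz := hy hyU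
      have h0 : ∀ a b, H y a b = 0 := fun a b => by rw [hz.eq_of_nhds]; rfl
      have h1 : ∀ k a b, pd k (fun z => H z a b) y = 0 := fun k a b => by
        have : (fun z => H z a b) =ᶠ[nhds y] fun _ => (0 : ℝ) := by
          filter_upwards [hz] with z hz'
          rw [hz']; rfl
        rw [pd, this.fderiv_eq]; simp
      -- The ideal of functions vanishing at $(0,y)$ contains `H` and its first derivatives, hence
      -- the field.
      have := hV (RingHom.ker (ev (hmem y hyU)).toRingHom)
        (fun a b => (hvar a b _ (hmem y hyU)).trans (h0 a b))
        (fun k a b => (hF.rep_D (f := fun _ z => H z a b) (hvar a b) k _ (hmem y hyU)).trans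
          (h1 k a b)) i
      exact (hrep i _ (hmem y hyU)).symm.trans this
    -- Outside `U` the field vanishes because it is an extension by zero.
    · have : ((0 : ℝ), y) ∉ Set.range (Subtype.val : W → _) := by
        rintro ⟨z, hz⟩
        exact hyU (by simpa [hz] using z.2.1)
      exact Function.extend_apply' _ _ _ this
  · have h1 := congrArg (ev (hmem y hy)) hV'
    have h2 := ((hF.rep_density t).dirDeriv hF.isOpen
      ((1 : ℝ), (0 : EuclideanSpace ℝ (Fin n)))) _ (hmem y hy)
    have h3 : firstVar t G H y = fderiv ℝ (fun x : ℝ × EuclideanSpace ℝ (Fin n) =>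
        density t (fun z => G z + x.1 • H z) x.2) (0, y) (1, 0) :=
      (hasDerivAt_density hU hG hH t hy (by simpa using hpos y hy)).deriv
    have h4 : ∀ i, ev (hmem y hy) (hF.alg.D i (V i)) =
        pd i (fun y => extendZero W (V i).1 (0, y)) y := fun i =>
      hF.rep_D (f := fun s z => extendZero W (V i).1 (s, z)) (hrep i) i _ (hmem y hy)
    have h5 := fun i j => hF.rep_grad t i j _ (hmem y hy)
    have h6 := fun i j => hvar i j _ (hmem y hy)
    have h7 : ev (hmem y hy) hF.vol = √(G y).det := by
      have : ev (hmem y hy) hF.vol = √(G y + (0 : ℝ) • H y).det := rfl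
      rw [this]; simp
    have h8 : ev (hmem y hy) (δ (hF.vol * hF.alg.lag (algebraMap ℝ _ t))) = firstVar t G H y :=
      h2.trans h3.symm
    rw [map_mul (ev (hmem y hy)), h8, map_add, map_mul (ev (hmem y hy)), map_sum, hF.ev_ip,
      map_ofNat, h7] at h1
    simp only [h4, h5, h6] at h1
    rw [h1]
    simp only [zero_smul, add_zero]

theorem sum_inv_mul_gradient (hU : IsOpen U) (hG : LocalTensor U G) (t : ℝ)
    {y : EuclideanSpace ℝ (Fin n)} (hy : y ∈ U) (hpos : 0 < (G y).det) :
    ∑ i, ∑ j, (G y)⁻¹ i j * gradient t G i j y =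
      (n - 4) * lagrangian t G y - (n + 4 * (n - 1) * t) * lap G (scal G) y := by
  have hF := hG.metricFamily hU ℝ
  have hm : ((0 : ℝ), y) ∈ {x : ℝ × EuclideanSpace ℝ (Fin n) | x.2 ∈ U ∧ 0 < (G x.2).det} :=
    ⟨hy, hpos⟩
  have h1 := congrArg (ev hm) (hF.alg.tr2_grad (algebraMap ℝ _ t))
  rw [hF.ev_tr2 hm] at h1
  have h2 := fun i j => hF.rep_grad t i j _ hm
  have h3 := hF.rep_lag t _ hm
  have h4 := hF.rep_lap (f := fun _ => scal G) hF.rep_scal _ hm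
  simp only [h2, map_sub, map_mul, map_add, map_natCast, map_ofNat, map_one, AlgHom.commutes, h3,
    h4] at h1
  exact h1

/-- The metric is parallel, and its contraction with the Riemann tensor is the Ricci tensor. -/
theorem tensorLap_tracelessRic (hU : IsOpen U) (hG : LocalTensor U G)
    {y : EuclideanSpace ℝ (Fin n)} (hy : y ∈ U) (hpos : 0 < (G y).det) (i j : Fin n) :
    tensorLap G (tracelessRic G) i j y =
      tensorLap G (ric G) i j y - lap G (scal G) y / n * G y i j ∧
    riemContract G (tracelessRic G) i j y =
      riemContract G (ric G) i j y - scal G y / n * ric G y i j := by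
  have hF := hG.metricFamily hU ℝ
  have hm : ((0 : ℝ), y) ∈ {x : ℝ × EuclideanSpace ℝ (Fin n) | x.2 ∈ U ∧ 0 < (G x.2).det} :=
    ⟨hy, hpos⟩
  set c : smoothAlg {x : ℝ × EuclideanSpace ℝ (Fin n) | x.2 ∈ U ∧ 0 < (G x.2).det} :=
    algebraMap ℝ _ (-1 / n) with hc
  have hE : ∀ i j, Represents (fun x : ℝ × EuclideanSpace ℝ (Fin n) => tracelessRic G x.2 i j)
      (hF.alg.ric i j + c * hF.alg.scal * hF.alg.G i j) := fun i j x hx => by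
    have h1 := hF.rep_ric i j x hx
    have h2 := hF.rep_scal x hx
    have h3 := hF.rep_G i j x hx
    simp only [map_add, map_mul, h1, h2, h3, hc, AlgHom.commutes, tracelessRic, Matrix.sub_apply,
      Matrix.smul_apply, smul_eq_mul, Algebra.algebraMap_self, RingHom.id_apply]
    ring
  have hDc : ∀ i, hF.alg.D i c = 0 := fun i => Derivation.map_algebraMap _ _
  have hlapc : hF.alg.lap (c * hF.alg.scal) = c * hF.alg.lap hF.alg.scal := by
    rw [MetricAlg.lap, MetricAlg.lap, ← MetricAlg.tr2_mul_left]
    congr 1; ext a b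
    simp only [MetricAlg.hess, Derivation.leibniz, hDc, smul_eq_mul, mul_zero, add_zero]
    rw [MetricAlg.cov1_smul, hDc]; ring
  have a1 := hF.rep_lap2 (T := fun _ => ric G) hF.rep_ric i j _ hm
  have a2 := hF.rep_rmC (T := fun _ => ric G) hF.rep_ric i j _ hm
  have a3 := hF.rep_lap (f := fun _ => scal G) hF.rep_scal _ hm
  have a4 := hF.rep_scal _ hm
  have a5 := hF.rep_G i j _ hm
  have a6 := hF.rep_ric i j _ hm
  have hcev : ev hm c = -1 / n := by rw [hc, AlgHom.commutes]; rfl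
  constructor
  · refine (hF.rep_lap2 (T := fun _ => tracelessRic G) hE i j _ hm).symm.trans ?_
    rw [MetricAlg.lap2_add,
      MetricAlg.lap2_mul_G, hlapc]
    have e : hF.alg.lap2 (fun a b => hF.alg.ric a b) i j = hF.alg.lap2 hF.alg.ric i j := rfl
    rw [e, map_add, map_mul, map_mul, a1, a3, a5, hcev]
    ring
  · refine (hF.rep_rmC (T := fun _ => tracelessRic G) hE i j _ hm).symm.trans ?_
    rw [MetricAlg.rmC_add,
      MetricAlg.rmC_mul_metric]
    have e : hF.alg.rmC (fun a b => hF.alg.ric a b) i j = hF.alg.rmC hF.alg.ric i j := rfl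
    rw [e, map_add, map_mul, map_mul, a2, a4, a6, hcev]
    ring

end Local

/-! ### Change of coordinates -/

section Comap

variable {V V' : Type*} [NormedAddCommGroup V] [NormedSpace ℝ V] [NormedAddCommGroup V']
  [NormedSpace ℝ V'] {W : Set V} {W' : Set V'}

/-- Composition with a smooth map. -/
def smoothAlg.comap {φ : V → V'} (hφ : ContDiffOn ℝ ∞ φ W) (hm : Set.MapsTo φ W W') :
    smoothAlg W' →+* smoothAlg W where
  toFun a := smoothAlg.mk (fun x => extendZero W' a.1 (φ x)) (a.2.comp hφ hm)
  map_one' := smoothAlg.ext_ev fun x hx => by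
    rw [ev_mk, extendZero_apply _ (hm hx), map_one]; rfl
  map_zero' := smoothAlg.ext_ev fun x hx => by
    rw [ev_mk, extendZero_apply _ (hm hx), map_zero]; rfl
  map_add' a b := smoothAlg.ext_ev fun x hx => by
    rw [map_add, ev_mk, ev_mk, ev_mk]
    simp only [extendZero_apply _ (hm hx)]; rfl
  map_mul' a b := smoothAlg.ext_ev fun x hx => by
    rw [map_mul, ev_mk, ev_mk, ev_mk]
    simp only [extendZero_apply _ (hm hx)]; rfl

theorem ev_comap {φ : V → V'} (hφ : ContDiffOn ℝ ∞ φ W) (hm : Set.MapsTo φ W W') {x : V}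
    (hx : x ∈ W) (a : smoothAlg W') : ev hx (smoothAlg.comap hφ hm a) = ev (hm hx) a :=
  extendZero_apply _ (hm hx)

end Comap

section CoordinateChange

variable {n : ℕ}

/-- The Jacobian matrix. -/
def jacobian (ψ : EuclideanSpace ℝ (Fin n) → EuclideanSpace ℝ (Fin n))
    (y : EuclideanSpace ℝ (Fin n)) : Matrix (Fin n) (Fin n) ℝ :=
  Matrix.of fun a i => fderiv ℝ ψ y (EuclideanSpace.single i 1) a

/-- A coordinate as a continuous linear map. -/
def coordinate (a : Fin n) : EuclideanSpace ℝ (Fin n) →L[ℝ] ℝ := EuclideanSpace.proj a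

theorem euclidean_eq_sum (v : EuclideanSpace ℝ (Fin n)) :
    v = ∑ a, v a • EuclideanSpace.single a (1 : ℝ) := by
  ext i
  simp [Finset.sum_apply, Pi.single_apply]

/-- Verifies the hypotheses of the algebraic change of coordinates in the rings of smooth functions.
The map `ψ` is not assumed to be a diffeomorphism: only its Jacobian must be invertible. -/
theorem invariance {U U' : Set (EuclideanSpace ℝ (Fin n))} (hU : IsOpen U) (hU' : IsOpen U')
    {G G' : EuclideanSpace ℝ (Fin n) → Matrix (Fin n) (Fin n) ℝ} (hG : LocalTensor U G)
    (hG' : LocalTensor U' G') (hpos : ∀ y ∈ U, 0 < (G y).det) (hpos' : ∀ y ∈ U', 0 < (G' y).det)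
    {ψ : EuclideanSpace ℝ (Fin n) → EuclideanSpace ℝ (Fin n)} (hψ : ContDiffOn ℝ ∞ ψ U)
    (hm : Set.MapsTo ψ U U')
    (h : ∀ y ∈ U, G y = (jacobian ψ y)ᵀ * G' (ψ y) * jacobian ψ y)
    {y : EuclideanSpace ℝ (Fin n)} (hy : y ∈ U) :
    normSq G (ric G) y = normSq G' (ric G') (ψ y) ∧ scal G y = scal G' (ψ y) := by
  have hF := hG.metricFamily hU ℝ
  have hF' := hG'.metricFamily hU' ℝ
  set W : Set (ℝ × EuclideanSpace ℝ (Fin n)) := {x | x.2 ∈ U ∧ 0 < (G x.2).det}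
  set W' : Set (ℝ × EuclideanSpace ℝ (Fin n)) := {x | x.2 ∈ U' ∧ 0 < (G' x.2).det}
  set φ : ℝ × EuclideanSpace ℝ (Fin n) → ℝ × EuclideanSpace ℝ (Fin n) := fun x => (x.1, ψ x.2)
  have hsnd : ContDiffOn ℝ ∞ (fun x : ℝ × EuclideanSpace ℝ (Fin n) => ψ x.2) W :=
    hψ.comp contDiff_snd.contDiffOn fun x hx => hx.1
  have hφ : ContDiffOn ℝ ∞ φ W := contDiff_fst.contDiffOn.prodMk hsnd
  have hφm : Set.MapsTo φ W W' := fun x hx => ⟨hm hx.1, hpos' _ (hm hx.1)⟩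
  set f := smoothAlg.comap hφ hφm
  have hψa : ∀ a, ContDiffOn ℝ ∞ (fun x : ℝ × EuclideanSpace ℝ (Fin n) => ψ x.2 a) W := fun a =>
    (coordinate a).contDiff.comp_contDiffOn hsnd
  set c : Fin n → smoothAlg W := fun a => smoothAlg.mk _ (hψa a)
  set J : Matrix (Fin n) (Fin n) (smoothAlg W) := Matrix.of fun a i => hF.alg.D i (c a)
  have hψd : ∀ x ∈ W, HasFDerivAt ψ (fderiv ℝ ψ x.2) x.2 := fun x hx =>
    ((hψ.contDiffAt (hU.mem_nhds hx.1)).differentiableAt (by simp)).hasFDerivAt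
  have hJr : ∀ a i, Represents (fun x : ℝ × EuclideanSpace ℝ (Fin n) => jacobian ψ x.2 a i)
      (J a i) := fun a i x hx => by
    have h1 := hF.rep_D (f := fun _ z => ψ z a) (a := c a) (fun x hx => rfl) i x hx
    refine h1.trans ?_
    have h2 := ((coordinate a).hasFDerivAt.comp x.2
      (hψd x hx)).fderiv
    change fderiv ℝ (coordinate a ∘ ψ) x.2 _ = _
    rw [h2]
    rfl
  have hGJ : hF.alg.G = Jᵀ * hF'.alg.G.map f * J := by
    refine Matrix.ext fun i j => smoothAlg.ext_ev fun x hx => ?_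
    have h1 := congrFun (congrFun (h x.2 hx.1) i) j
    refine (hF.rep_G i j x hx).trans (h1.trans ?_)
    have h2 := fun a i => hJr a i x hx
    have h3 : ∀ a b, ev hx (f (hF'.alg.G a b)) = G' (ψ x.2) a b := fun a b =>
      ev_comap hφ hφm hx _
    simp only [Matrix.mul_apply, Matrix.transpose_apply, Matrix.map_apply, map_sum, map_mul, h2, h3]
  -- The determinant of $G=J^TG'J$ is invertible, hence so is that of `J`.
  have hdet : IsUnit J.det := by
    have h1 : IsUnit hF.alg.G.det := hF.isUnit_det
    rw [hGJ, Matrix.det_mul] at h1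
    exact isUnit_of_mul_isUnit_right h1
  have hf : ∀ i b, hF.alg.D i (f b) = ∑ a, J a i * f (hF'.alg.D a b) := fun i b => by
    refine smoothAlg.ext_ev fun x hx => ?_
    have hb := represents_extendZero b
    set F := extendZero W' b.1
    have h1 : Represents (fun x => F (φ x)) (f b) := fun x hx =>
      (ev_comap hφ hφm hx b).trans (hb _ _)
    have h2 := h1.dirDeriv hF.isOpen (0, EuclideanSpace.single i 1) x hx
    have h3 : ∀ a, ev hx (f (hF'.alg.D a b)) =
        fderiv ℝ F (φ x) (0, EuclideanSpace.single a 1) := fun a =>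
      (ev_comap hφ hφm hx _).trans (hb.dirDeriv hF'.isOpen _ _ _)
    have hFd : HasFDerivAt F (fderiv ℝ F (φ x)) (φ x) :=
      ((hb.contDiffOn.contDiffAt (hF'.isOpen.mem_nhds (hφm hx))).differentiableAt
        (by simp)).hasFDerivAt
    have hφd : HasFDerivAt φ ((ContinuousLinearMap.fst ℝ ℝ _).prod
        ((fderiv ℝ ψ x.2).comp (ContinuousLinearMap.snd ℝ ℝ _))) x :=
      hasFDerivAt_fst.prodMk ((hψd x hx).comp x hasFDerivAt_snd)
    have h4 := (hFd.comp x hφd).fderiv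
    refine h2.trans ?_
    change fderiv ℝ (F ∘ φ) x _ = _
    rw [h4]
    have h5 := fun a i => hJr a i x hx
    simp only [map_sum, map_mul, h3, h5]
    simp only [ContinuousLinearMap.comp_apply, ContinuousLinearMap.prod_apply,
      ContinuousLinearMap.coe_fst', ContinuousLinearMap.coe_snd']
    have h6 : ((0 : ℝ), fderiv ℝ ψ x.2 (EuclideanSpace.single i 1)) =
        ∑ a, jacobian ψ x.2 a i • ((0 : ℝ), EuclideanSpace.single a (1 : ℝ)) := by
      refine Prod.ext ?_ ?_
      · simp [Prod.fst_sum]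
      · rw [Prod.snd_sum]
        exact euclidean_eq_sum _
    rw [h6, map_sum]
    simp only [map_smul, smul_eq_mul]
  have hJc : ∀ i a j, hF.alg.D i (J a j) = hF.alg.D j (J a i) := fun i a j => hF.alg.D_comm _ _ _
  have hmem : ((0 : ℝ), y) ∈ W := ⟨hy, hpos y hy⟩
  have hJJ' := Matrix.mul_nonsing_inv J hdet
  have k1 := hF.rep_normSq (T := fun _ => ric G) hF.rep_ric _ hmem
  have k2 := hF'.rep_normSq (T := fun _ => ric G') hF'.rep_ric _ (hφm hmem)
  have k3 := hF.rep_scal _ hmem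
  have k4 := hF'.rep_scal _ (hφm hmem)
  have k5 := congrArg (ev hmem) (hF.alg.pullback_ip_ric hF'.alg f hJJ' hf hJc hGJ)
  have k6 := congrArg (ev hmem) (hF.alg.pullback_scal hF'.alg f hJJ' hf hJc hGJ)
  exact ⟨k1.symm.trans (k5.trans ((ev_comap hφ hφm hmem _).trans k2)),
    k3.symm.trans (k6.trans ((ev_comap hφ hφm hmem _).trans k4))⟩

end CoordinateChange

/-! ### Dimension three: the Riemann tensor and $\sigma_2$ of the Schouten tensor -/

section DimThree

/-- The Levi-Civita symbol. -/
def leviCivita (i j k : Fin 3) : ℝ :=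
  ((j : ℝ) - i) * ((k : ℝ) - i) * ((k : ℝ) - j) / 2

/-- In dimension three an antisymmetric pair amounts to the complementary index `a`; the sums `a +
1`, `a + 2` are taken modulo three. -/
theorem eq_sum_leviCivita {V : Type*} [AddCommGroup V] [Module ℝ V] (R : Fin 3 → Fin 3 → V)
    (hR : ∀ i j, R i j = -R j i) (i j : Fin 3) :
    R i j = ∑ a, leviCivita i j a • R (a + 1) (a + 2) := by
  have h0 : ∀ i, R i i = 0 := fun i => by
    have h : (2 : ℝ) • R i i = 0 := by
      rw [two_smul]; nth_rewrite 1 [hR i i]; simp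
    exact (smul_eq_zero.1 h).resolve_left two_ne_zero
  fin_cases i <;> fin_cases j <;>
    simp [Fin.sum_univ_three, leviCivita, h0] <;> norm_num
  · exact hR 0 2
  · exact hR 1 0
  · exact hR 2 1

theorem eq_sum_leviCivita₂ (R : Fin 3 → Fin 3 → Fin 3 → Fin 3 → ℝ)
    (h1 : ∀ i j k l, R i j k l = -R j i k l) (h2 : ∀ i j k l, R i j k l = -R i j l k)
    (i j k l : Fin 3) :
    R i j k l = ∑ a, ∑ b, leviCivita i j a * leviCivita k l b *
      R (a + 1) (a + 2) (b + 1) (b + 2) := by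
  rw [eq_sum_leviCivita (fun i j => R i j k l) (fun i j => h1 i j k l)]
  refine Finset.sum_congr rfl fun a _ => ?_
  rw [eq_sum_leviCivita (fun k l => R (a + 1) (a + 2) k l) (fun k l => h2 _ _ k l),
    Finset.smul_sum]
  exact Finset.sum_congr rfl fun b _ => by simp only [smul_eq_mul]; ring

/-- Both sides are antisymmetric in $(i,k)$ and in $(j,l)$, so that nine components suffice, each a
polynomial identity. The right side is the Kulkarni–Nomizu product of `B` and `g`. -/
theorem det_mul_leviCivita (g S : Matrix (Fin 3) (Fin 3) ℝ) (hg : gᵀ = g) (hS : Sᵀ = S)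
    (i k j l : Fin 3) :
    let B := ((1 / 2) * (S * g).trace) • g - g * S * g
    g.det * ∑ a, ∑ b, leviCivita i k a * leviCivita j l b * S a b =
      B i j * g k l + B k l * g i j - B i l * g k j - B k j * g i l := by
  intro B
  have g1 : g 1 0 = g 0 1 := congrFun (congrFun hg 0) 1
  have g2 : g 2 0 = g 0 2 := congrFun (congrFun hg 0) 2
  have g3 : g 2 1 = g 1 2 := congrFun (congrFun hg 1) 2
  have s1 : S 1 0 = S 0 1 := congrFun (congrFun hS 0) 1
  have s2 : S 2 0 = S 0 2 := congrFun (congrFun hS 0) 2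
  have s3 : S 2 1 = S 1 2 := congrFun (congrFun hS 1) 2
  rw [eq_sum_leviCivita₂ (fun i k j l => B i j * g k l + B k l * g i j - B i l * g k j -
    B k j * g i l) (fun i k j l => by ring) (fun i k j l => by ring), Finset.mul_sum]
  refine Finset.sum_congr rfl fun a _ => ?_
  rw [Finset.mul_sum]
  refine Finset.sum_congr rfl fun b _ => ?_
  rw [mul_left_comm]
  congr 1
  fin_cases a <;> fin_cases b <;>
    simp [B, Matrix.det_fin_three, Matrix.mul_apply, Fin.sum_univ_three, Matrix.trace,
      g1, g2, g3, s1, s2, s3] <;> ring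

/-- The Ricci contraction of the curvature tensor encoded by `S`, with the adjugate in place of the
inverse to keep it polynomial. -/
theorem sum_adjugate_leviCivita (g S : Matrix (Fin 3) (Fin 3) ℝ) (hg : gᵀ = g) (hS : Sᵀ = S)
    (i j : Fin 3) :
    ∑ k, ∑ l, g.adjugate k l * ∑ a, ∑ b, leviCivita k i a * leviCivita l j b * S a b =
      (S * g).trace * g i j - (g * S * g) i j := by
  have g1 : g 1 0 = g 0 1 := congrFun (congrFun hg 0) 1
  have g2 : g 2 0 = g 0 2 := congrFun (congrFun hg 0) 2
  have g3 : g 2 1 = g 1 2 := congrFun (congrFun hg 1) 2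
  have s1 : S 1 0 = S 0 1 := congrFun (congrFun hS 0) 1
  have s2 : S 2 0 = S 0 2 := congrFun (congrFun hS 0) 2
  have s3 : S 2 1 = S 1 2 := congrFun (congrFun hS 1) 2
  fin_cases i <;> fin_cases j <;>
    simp [Matrix.adjugate_fin_three, Matrix.mul_apply, Fin.sum_univ_three, Matrix.trace,
      leviCivita, g1, g2, g3, s1, s2, s3] <;> ring

/-- In dimension three the Ricci tensor determines the Riemann tensor. -/
theorem riemann_eq_of_dim_three (g : Matrix (Fin 3) (Fin 3) ℝ) (hg : gᵀ = g) (hdet : g.det ≠ 0)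
    (R : Fin 3 → Fin 3 → Fin 3 → Fin 3 → ℝ)
    (h1 : ∀ i j k l, R i j k l = -R j i k l) (h2 : ∀ i j k l, R i j k l = -R i j l k)
    (h3 : ∀ i j k l, R k l i j = R i j k l)
    (Rc : Matrix (Fin 3) (Fin 3) ℝ) (hRc : ∀ i j, Rc i j = ∑ k, ∑ l, g⁻¹ k l * R k i l j)
    (i k j l : Fin 3) :
    let A := Rc - ((g⁻¹ * Rc).trace / 4) • g
    R i k j l = A i j * g k l + A k l * g i j - A i l * g k j - A k j * g i l := by
  set S : Matrix (Fin 3) (Fin 3) ℝ := Matrix.of fun a b => R (a + 1) (a + 2) (b + 1) (b + 2)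
  have hS : Sᵀ = S := Matrix.ext fun a b => h3 _ _ _ _
  have hR := eq_sum_leviCivita₂ R h1 h2
  have hRS : Rc = g.det⁻¹ • ((S * g).trace • g - g * S * g) := by
    ext a b
    rw [hRc, Matrix.smul_apply, Matrix.sub_apply, Matrix.smul_apply, smul_eq_mul, smul_eq_mul,
      ← sum_adjugate_leviCivita g S hg hS]
    simp only [Matrix.inv_def, Ring.inverse_eq_inv', Matrix.smul_apply, smul_eq_mul,
      Finset.mul_sum]
    refine Finset.sum_congr rfl fun k _ => Finset.sum_congr rfl fun l _ => ?_
    rw [hR, Finset.mul_sum]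
    refine Finset.sum_congr rfl fun _ _ => ?_
    rw [Finset.mul_sum]
    exact Finset.sum_congr rfl fun _ _ => by simp only [S, Matrix.of_apply]; ring
  have hu : IsUnit g.det := hdet.isUnit
  have htr : (g⁻¹ * Rc).trace = g.det⁻¹ * (2 * (S * g).trace) := by
    rw [hRS, Matrix.mul_smul, Matrix.trace_smul, mul_sub, Matrix.mul_smul,
      Matrix.nonsing_inv_mul _ hu, ← mul_assoc, ← mul_assoc, Matrix.nonsing_inv_mul _ hu, one_mul,
      Matrix.trace_sub, Matrix.trace_smul, Matrix.trace_one]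
    simp only [smul_eq_mul, Fintype.card_fin]
    push_cast
    ring
  -- Taking the trace recovers that of `S * g` from the Ricci tensor; hence `B` of
  -- `det_mul_leviCivita` is $\det g$ times the Schouten tensor.
  have hA : Rc - ((g⁻¹ * Rc).trace / 4) • g =
      g.det⁻¹ • (((1 / 2) * (S * g).trace) • g - g * S * g) := by
    rw [htr, hRS]
    module
  have key := det_mul_leviCivita g S hg hS i k j l
  intro A
  have hA' : ∀ a b, A a b = g.det⁻¹ * (((1 / 2) * (S * g).trace) • g - g * S * g) a b :=
    fun a b => by rw [show A = _ from hA]; rfl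
  simp only [hA']
  rw [hR, ← inv_mul_cancel_left₀ hdet (∑ a, _)]
  refine (congrArg (g.det⁻¹ * ·) key).trans ?_
  ring

variable {n : ℕ}

theorem normSq_eq_trace (G T : EuclideanSpace ℝ (Fin n) → Matrix (Fin n) (Fin n) ℝ)
    (y : EuclideanSpace ℝ (Fin n)) (hG : (G y)ᵀ = G y) (hT : (T y)ᵀ = T y) :
    normSq G T y = ((G y)⁻¹ * T y * ((G y)⁻¹ * T y)).trace := by
  have e : ((G y)⁻¹)ᵀ = (G y)⁻¹ := by rw [Matrix.transpose_nonsing_inv, hG]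
  have h1 : ∀ i j, (G y)⁻¹ i j = (G y)⁻¹ j i := fun i j => congrFun (congrFun e j) i
  have h2 : ∀ i j, T y i j = T y j i := fun i j => congrFun (congrFun hT j) i
  simp only [normSq, Matrix.trace, Matrix.diag, Matrix.mul_apply, Finset.sum_mul, Finset.mul_sum]
  calc _ = ∑ i, ∑ k, ∑ j, ∑ l, (G y)⁻¹ i k * (G y)⁻¹ j l * T y i j * T y k l :=
        Finset.sum_congr rfl fun _ _ => Finset.sum_comm
    _ = ∑ k, ∑ i, ∑ j, ∑ l, (G y)⁻¹ i k * (G y)⁻¹ j l * T y i j * T y k l := Finset.sum_comm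
    _ = _ := by
        refine Finset.sum_congr rfl fun k _ => ?_
        rw [Finset.sum_comm]
        refine Finset.sum_congr rfl fun j _ => ?_
        rw [Finset.sum_comm]
        refine Finset.sum_congr rfl fun l _ => Finset.sum_congr rfl fun i _ => ?_
        rw [h1 i k, h2 k l]
        ring

theorem scal_eq_trace (G : EuclideanSpace ℝ (Fin n) → Matrix (Fin n) (Fin n) ℝ)
    (y : EuclideanSpace ℝ (Fin n)) (hR : (ric G y)ᵀ = ric G y) :
    scal G y = ((G y)⁻¹ * ric G y).trace := by
  have h2 : ∀ i j, ric G y i j = ric G y j i := fun i j => congrFun (congrFun hR j) i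
  simp only [scal, Matrix.trace, Matrix.diag, Matrix.mul_apply]
  exact Finset.sum_congr rfl fun _ _ => Finset.sum_congr rfl fun _ _ => by rw [h2]

theorem comp_eq_mul (G S T : EuclideanSpace ℝ (Fin n) → Matrix (Fin n) (Fin n) ℝ)
    (y : EuclideanSpace ℝ (Fin n)) (i j : Fin n) :
    comp G S T i j y = (S y * (G y)⁻¹ * T y) i j := by
  simp only [comp, Matrix.mul_apply, Finset.sum_mul]
  rw [Finset.sum_comm]
  exact Finset.sum_congr rfl fun _ _ => Finset.sum_congr rfl fun _ _ => by ring

theorem riemContract_eq_sum (G T : EuclideanSpace ℝ (Fin n) → Matrix (Fin n) (Fin n) ℝ)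
    (y : EuclideanSpace ℝ (Fin n)) (i j : Fin n) :
    riemContract G T i j y =
      ∑ k, ∑ l, ((G y)⁻¹ * T y * ((G y)⁻¹)ᵀ) k l * riem G i k j l y := by
  simp only [riemContract, Matrix.mul_apply, Finset.sum_mul, Matrix.transpose_apply]
  refine Finset.sum_congr rfl fun _ _ => Finset.sum_congr rfl fun _ _ => ?_
  rw [Finset.sum_comm]
  exact Finset.sum_congr rfl fun _ _ => Finset.sum_congr rfl fun _ _ => by ring

section Symmetries

variable {U : Set (EuclideanSpace ℝ (Fin n))}
  {G : EuclideanSpace ℝ (Fin n) → Matrix (Fin n) (Fin n) ℝ} (hU : IsOpen U)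
  (hG : LocalTensor U G) {y : EuclideanSpace ℝ (Fin n)} (hy : y ∈ U) (hpos : 0 < (G y).det)

include hU hG hy hpos

theorem riem_symmetries :
    (∀ i j k l, riem G i j k l y = -riem G j i k l y) ∧
    (∀ i j k l, riem G i j k l y = -riem G i j l k y) ∧
    (∀ i j k l, riem G k l i j y = riem G i j k l y) ∧
    (∀ i j, ric G y i j = ∑ k, ∑ l, (G y)⁻¹ k l * riem G k i l j y) ∧
    (ric G y)ᵀ = ric G y := by
  have hF := hG.metricFamily hU ℝ
  have hm : ((0 : ℝ), y) ∈ {x : ℝ × EuclideanSpace ℝ (Fin n) | x.2 ∈ U ∧ 0 < (G x.2).det} :=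
    ⟨hy, hpos⟩
  have h1 : ∀ i j k l, ev hm (hF.alg.riem i j k l) = riem G i j k l y :=
    fun i j k l => hF.rep_riem i j k l _ hm
  have h2 : ∀ i j, ev hm (hF.alg.ric i j) = ric G y i j := fun i j => hF.rep_ric i j _ hm
  refine ⟨fun i j k l => ?_, fun i j k l => ?_, fun i j k l => ?_, fun i j => ?_,
    Matrix.ext fun i j => ?_⟩
  · rw [← h1, ← h1, ← map_neg, ← hF.alg.riem_swap_left]
  · rw [← h1, ← h1, ← map_neg, ← hF.alg.riem_swap_right]
  · rw [← h1, ← h1, hF.alg.riem_pair]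
  · rw [← h2, hF.alg.ric_eq, hF.ev_tr2]
    simp only [h1]
  · rw [Matrix.transpose_apply, ← h2, ← h2, hF.alg.ric_comm]

end Symmetries

section

variable {U : Set (EuclideanSpace ℝ (Fin 3))}
  {G : EuclideanSpace ℝ (Fin 3) → Matrix (Fin 3) (Fin 3) ℝ} (hU : IsOpen U)
  (hG : LocalTensor U G) {y : EuclideanSpace ℝ (Fin 3)} (hy : y ∈ U) (hpos : 0 < (G y).det)

include hU hG hy hpos

theorem normSq_tracelessRic_of_dim_three :
    normSq G (tracelessRic G) y = normSq G (ric G) y - scal G y ^ 2 / 3 := by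
  obtain ⟨-, -, -, -, h5⟩ := riem_symmetries hU hG hy hpos
  have hu : IsUnit (G y).det := hpos.ne'.isUnit
  rw [normSq_eq_trace _ _ _ (hG.symm y hy) h5, normSq_eq_trace _ _ _ (hG.symm y hy)
    (by rw [tracelessRic, Matrix.transpose_sub, Matrix.transpose_smul, h5, hG.symm y hy])]
  have hs := scal_eq_trace G y h5
  have e : (G y)⁻¹ * tracelessRic G y =
      (G y)⁻¹ * ric G y - (scal G y / 3) • (1 : Matrix (Fin 3) (Fin 3) ℝ) := by
    rw [tracelessRic, mul_sub, Matrix.mul_smul, Matrix.nonsing_inv_mul _ hu]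
    norm_num
  rw [e, sub_mul, mul_sub, mul_sub, Matrix.smul_mul, Matrix.mul_smul, Matrix.mul_smul,
    Matrix.smul_mul, one_mul, mul_one, mul_one, Matrix.trace_sub, Matrix.trace_sub,
    Matrix.trace_sub, Matrix.trace_smul, Matrix.trace_smul, Matrix.trace_smul, Matrix.trace_one,
    ← hs]
  simp only [smul_eq_mul, Fintype.card_fin]
  push_cast
  ring

/-- The Riemann tensor is the Kulkarni–Nomizu product of the Schouten tensor $E+\frac1{12}Rg$ with
`g`. Contracting with `E` kills the trace of `E`, and the two mixed products give $E\circ E$ twice.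
-/
theorem riemContract_tracelessRic_of_dim_three (i j : Fin 3) :
    riemContract G (tracelessRic G) i j y =
      normSq G (tracelessRic G) y * G y i j - 2 * comp G (tracelessRic G) (tracelessRic G) i j y
        - scal G y / 6 * tracelessRic G y i j := by
  obtain ⟨h1, h2, h3, h4, h5⟩ := riem_symmetries hU hG hy hpos
  have hu : IsUnit (G y).det := hpos.ne'.isUnit
  have hg := hG.symm y hy
  have hs := scal_eq_trace G y h5
  have hE : (tracelessRic G y)ᵀ = tracelessRic G y := by
    rw [tracelessRic, Matrix.transpose_sub, Matrix.transpose_smul, h5, hg]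
  rw [riemContract_eq_sum, comp_eq_mul, normSq_eq_trace _ _ _ hg hE]
  have hd := riemann_eq_of_dim_three (G y) hg hpos.ne' (fun i j k l => riem G i j k l y) h1 h2 h3
    (ric G y) h4
  have hgi : ((G y)⁻¹)ᵀ = (G y)⁻¹ := by rw [Matrix.transpose_nonsing_inv, hg]
  -- The coefficient is $\frac13-\frac14=\frac1{12}$.
  have hA : ric G y - (((G y)⁻¹ * ric G y).trace / 4) • G y =
      tracelessRic G y + (scal G y / 12) • G y := by
    rw [tracelessRic, ← hs]
    push_cast
    module
  have htr : ((G y)⁻¹ * tracelessRic G y).trace = 0 := by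
    rw [tracelessRic, mul_sub, Matrix.mul_smul, Matrix.nonsing_inv_mul _ hu, Matrix.trace_sub,
      Matrix.trace_smul, Matrix.trace_one, ← hs]
    simp only [smul_eq_mul, Fintype.card_fin]
    push_cast
    ring
  simp only [hA] at hd
  rw [hgi]
  set E := tracelessRic G y
  set R := scal G y
  set g := G y
  set T := g⁻¹ * E * g⁻¹ with hT
  have hTt : Tᵀ = T := by
    rw [hT, Matrix.transpose_mul, Matrix.transpose_mul, hgi, hE, mul_assoc]
  have s1 : ∑ k, ∑ l, T k l * g k l = 0 := by
    have : (T * gᵀ).trace = 0 := by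
      rw [hg, hT, mul_assoc, Matrix.nonsing_inv_mul _ hu, mul_one, htr]
    simpa [Matrix.trace, Matrix.mul_apply] using this
  have s2 : ∑ k, ∑ l, T k l * E k l = (g⁻¹ * E * (g⁻¹ * E)).trace := by
    have : (T * Eᵀ).trace = (g⁻¹ * E * (g⁻¹ * E)).trace := by rw [hE, hT, mul_assoc, mul_assoc]
    simpa only [Matrix.trace, Matrix.diag, Matrix.mul_apply, Matrix.transpose_apply] using this
  have s3 : ∀ (A B : Matrix (Fin 3) (Fin 3) ℝ), ∑ k, ∑ l, T k l * (A i l * B k j) =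
      (A * T * B) i j := fun A B => by
    simp only [Matrix.mul_apply, Finset.sum_mul]
    refine Finset.sum_congr rfl fun k _ => Finset.sum_congr rfl fun l _ => ?_
    rw [← congrFun (congrFun hTt l) k, Matrix.transpose_apply]
    ring
  have s4 : E * T * g = E * g⁻¹ * E := by
    rw [hT]; simp only [mul_assoc]; rw [Matrix.nonsing_inv_mul _ hu, mul_one]
  have s5 : g * T * E = E * g⁻¹ * E := by
    rw [hT]; simp only [← mul_assoc]; rw [Matrix.mul_nonsing_inv _ hu, one_mul]
  have s6 : g * T * g = E := by
    rw [hT]; simp only [← mul_assoc]; rw [Matrix.mul_nonsing_inv _ hu, one_mul, mul_assoc,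
      Matrix.nonsing_inv_mul _ hu, mul_one]
  have key : ∀ k l, T k l * riem G i k j l y =
      T k l * g k l * (E i j + R / 6 * g i j) + T k l * E k l * g i j
        - T k l * (E i l * g k j) - T k l * (g i l * E k j)
        - R / 6 * (T k l * (g i l * g k j)) := fun k l => by
    rw [hd]
    simp only [Matrix.add_apply, Matrix.smul_apply, smul_eq_mul]
    ring
  simp only [key, Finset.sum_add_distrib, Finset.sum_sub_distrib, ← Finset.sum_mul,
    ← Finset.mul_sum, s1, s2, s3, s4, s5, s6]
  ring

end

/-- `roots` counts real roots only, so Vieta's formula for the coefficient of $X$ requires the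
polynomial to split. -/
theorem charpoly_roots_esymm_two {M : Matrix (Fin 3) (Fin 3) ℝ} (hM : M.charpoly.Splits) :
    M.charpoly.roots.esymm 2 = (M.trace ^ 2 - (M * M).trace) / 2 := by
  have hd : M.charpoly.natDegree = 3 := by rw [Matrix.charpoly_natDegree_eq_dim, Fintype.card_fin]
  have h := Polynomial.coeff_eq_esymm_roots_of_splits hM (k := 1) (by rw [hd]; norm_num)
  rw [hd, M.charpoly_monic.leadingCoeff] at h
  norm_num at h
  rw [← h]
  have e : M.charpoly = Polynomial.X ^ 3 - Polynomial.C (M.trace) * Polynomial.X ^ 2 +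
      Polynomial.C ((M.trace ^ 2 - (M * M).trace) / 2) * Polynomial.X - Polynomial.C M.det := by
    have e1 : (M.trace ^ 2 - (M * M).trace) / 2 = M 0 0 * M 1 1 + M 0 0 * M 2 2 + M 1 1 * M 2 2
        - M 0 1 * M 1 0 - M 0 2 * M 2 0 - M 1 2 * M 2 1 := by
      simp [Matrix.trace, Matrix.mul_apply, Fin.sum_univ_three]; ring
    rw [e1]
    simp [Matrix.charpoly, Matrix.det_fin_three, Matrix.charmatrix_apply, Matrix.trace,
      Fin.sum_univ_three]
    ring
  rw [e]
  simp [Polynomial.coeff_X, Polynomial.coeff_X_pow, Polynomial.coeff_C]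

/-- With $g^{-1}=B^*B$ the matrix $g^{-1}T$ has the characteristic polynomial of the symmetric
matrix $BTB^*$. Positive definiteness of `g` enters here. -/
theorem splits_charpoly_inv_mul {g T : Matrix (Fin n) (Fin n) ℝ} (hg : g.PosDef) (hT : Tᵀ = T) :
    (g⁻¹ * T).charpoly.Splits := by
  obtain ⟨B, hB⟩ : ∃ B : Matrix (Fin n) (Fin n) ℝ, g⁻¹ = Bᴴ * B := by
    open scoped MatrixOrder in
    obtain ⟨B, hB⟩ := CStarAlgebra.nonneg_iff_eq_star_mul_self.mp hg.inv.posSemidef.nonneg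
    exact ⟨B, hB⟩
  rw [hB, mul_assoc, Matrix.charpoly_mul_comm]
  have : (B * T * Bᴴ).IsHermitian := by
    rw [Matrix.IsHermitian]
    simp [Matrix.conjTranspose_mul, mul_assoc, hT]
  exact this.splits_charpoly

/-- For $A=Ric-\frac14Rg$ one has $\mathrm{tr}A=\frac14R$ and $|A|^2=|Ric|^2-\frac5{16}R^2$; then
$\sigma_2=\frac12((\mathrm{tr}A)^2-|A|^2)$. -/
theorem sigmaTwo_schouten_of_dim_three {U : Set (EuclideanSpace ℝ (Fin 3))}
    {G : EuclideanSpace ℝ (Fin 3) → Matrix (Fin 3) (Fin 3) ℝ} (hU : IsOpen U)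
    (hG : LocalTensor U G) {y : EuclideanSpace ℝ (Fin 3)} (hy : y ∈ U) (hpos : (G y).PosDef) :
    sigmaTwo G (schouten G) y = -(1 / 2) * (normSq G (ric G) y - 3 / 8 * scal G y ^ 2) := by
  obtain ⟨-, -, -, -, h5⟩ := riem_symmetries hU hG hy hpos.det_pos
  have hu : IsUnit (G y).det := hpos.det_pos.ne'.isUnit
  have hg := hG.symm y hy
  have hs := scal_eq_trace G y h5
  have hS : schouten G y = ric G y - (scal G y / 4) • G y := by
    rw [schouten]; norm_num
  rw [sigmaTwo, charpoly_roots_esymm_two (splits_charpoly_inv_mul hpos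
    (by rw [hS, Matrix.transpose_sub, Matrix.transpose_smul, h5, hg])),
    normSq_eq_trace _ _ _ hg h5, hS]
  have e : (G y)⁻¹ * (ric G y - (scal G y / 4) • G y) =
      (G y)⁻¹ * ric G y - (scal G y / 4) • (1 : Matrix (Fin 3) (Fin 3) ℝ) := by
    rw [mul_sub, Matrix.mul_smul, Matrix.nonsing_inv_mul _ hu]
  rw [e, sub_mul, mul_sub, mul_sub, Matrix.smul_mul, Matrix.mul_smul, Matrix.mul_smul,
    Matrix.smul_mul, one_mul, mul_one, mul_one, Matrix.trace_sub, Matrix.trace_sub,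
    Matrix.trace_sub, Matrix.trace_sub]
  simp only [Matrix.trace_smul, Matrix.trace_one, ← hs, smul_eq_mul, Fintype.card_fin]
  push_cast
  ring

end DimThree

/-! ### The Euler-Lagrange equations in coordinates -/

section EulerLagrange

/-- The tensor equation alone is equivalent to the vanishing of `gradient`, being $-\frac12$ of it
written in terms of $E$. The scalar equation is its trace. -/
theorem eulerLagrange_iff {n : ℕ} (hn : n ≠ 0) {U : Set (EuclideanSpace ℝ (Fin n))}
    {G : EuclideanSpace ℝ (Fin n) → Matrix (Fin n) (Fin n) ℝ} (hU : IsOpen U)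
    (hG : LocalTensor U G) {y : EuclideanSpace ℝ (Fin n)} (hy : y ∈ U) (hpos : 0 < (G y).det)
    (t : ℝ) :
    ((∀ i j : Fin n,
      tensorLap G (tracelessRic G) i j y =
        (1 + 2 * t) * hess G (scal G) i j y
          - (n + 2 + 4 * n * t) / (2 * n) * lap G (scal G) y * G y i j
          - 2 * riemContract G (tracelessRic G) i j y
          - (2 + 2 * n * t) / n * scal G y * tracelessRic G y i j
          + 1 / 2 * (normSq G (ric G) y - (4 - n * (n - 4) * t) / n ^ 2 * scal G y ^ 2)
            * G y i j) ∧
      (n + 4 * (n - 1) * t) * lap G (scal G) y =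
        (n - 4) * (normSq G (ric G) y + t * scal G y ^ 2)) ↔
    ∀ i j, gradient t G i j y = 0 := by
  have hn' : (n : ℝ) ≠ 0 := Nat.cast_ne_zero.2 hn
  have key : ∀ i j, gradient t G i j y = -2 * (tensorLap G (tracelessRic G) i j y -
      ((1 + 2 * t) * hess G (scal G) i j y
          - (n + 2 + 4 * n * t) / (2 * n) * lap G (scal G) y * G y i j
          - 2 * riemContract G (tracelessRic G) i j y
          - (2 + 2 * n * t) / n * scal G y * tracelessRic G y i j
          + 1 / 2 * (normSq G (ric G) y - (4 - n * (n - 4) * t) / n ^ 2 * scal G y ^ 2)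
            * G y i j)) := fun i j => by
    obtain ⟨h1, h2⟩ := tensorLap_tracelessRic hU hG hy hpos i j
    rw [h1, h2, gradient, lagrangian, tracelessRic]
    simp only [Matrix.sub_apply, Matrix.smul_apply, smul_eq_mul]
    field_simp
    ring
  constructor
  · rintro ⟨h, -⟩ i j
    rw [key, h]; ring
  · intro h
    refine ⟨fun i j => ?_, ?_⟩
    · have := key i j
      rw [h] at this
      linarith
    · have := sum_inv_mul_gradient hU hG t hy hpos
      simp only [h, mul_zero, Finset.sum_const_zero] at this
      rw [lagrangian] at this
      linarith

/-- The case $n=3$, $t=-\frac38$ of `eulerLagrange_iff`: the coefficient of $\Delta R$ in the scalar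
equation vanishes, and the Riemann contraction becomes algebraic in $E$. The other two scalar
equalities are identities. -/
theorem eulerLagrange_sigmaTwo_iff {U : Set (EuclideanSpace ℝ (Fin 3))}
    {G : EuclideanSpace ℝ (Fin 3) → Matrix (Fin 3) (Fin 3) ℝ} (hU : IsOpen U)
    (hG : LocalTensor U G) {y : EuclideanSpace ℝ (Fin 3)} (hy : y ∈ U) (hpos : (G y).PosDef) :
    ((∀ i j : Fin 3,
      tensorLap G (tracelessRic G) i j y =
        1 / 4 * hess G (scal G) i j y
          - 1 / 12 * lap G (scal G) y * G y i j
          + 4 * comp G (tracelessRic G) (tracelessRic G) i j y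
          + 5 / 12 * scal G y * tracelessRic G y i j
          - 1 / 2 * (3 * normSq G (tracelessRic G) y - 1 / 72 * scal G y ^ 2) * G y i j) ∧
      -2 * sigmaTwo G (schouten G) y = normSq G (ric G) y - 3 / 8 * scal G y ^ 2 ∧
      normSq G (ric G) y - 3 / 8 * scal G y ^ 2 =
        normSq G (tracelessRic G) y - 1 / 24 * scal G y ^ 2 ∧
      normSq G (tracelessRic G) y - 1 / 24 * scal G y ^ 2 = 0) ↔
    ∀ i j, gradient (-3 / 8) G i j y = 0 := by
  rw [← eulerLagrange_iff three_ne_zero hU hG hy hpos.det_pos]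
  have h1 := normSq_tracelessRic_of_dim_three hU hG hy hpos.det_pos
  have h2 := sigmaTwo_schouten_of_dim_three hU hG hy hpos
  have h3 := riemContract_tracelessRic_of_dim_three hU hG hy hpos.det_pos
  have h4 : normSq G (ric G) y = normSq G (tracelessRic G) y + scal G y ^ 2 / 3 := by rw [h1]; ring
  rw [h2]
  simp only [h3, h4]
  refine and_congr (forall_congr' fun i => forall_congr' fun j => ?_) ?_
  · refine iff_of_eq (congrArg _ ?_)
    push_cast
    ring
  · push_cast
    constructor
    · rintro ⟨-, -, h⟩
      linarith
    · intro h
      refine ⟨by ring, by ring, by linarith⟩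

end EulerLagrange

/-! ### Components of two-tensors in charts and their transformation -/

section ManifoldCharts

variable {n : ℕ} {M : Type*} [TopologicalSpace M] [ChartedSpace (EuclideanSpace ℝ (Fin n)) M]

variable [IsManifold (𝓡 n) ∞ M]

/-- The coordinate fields are the frame of the tangent bundle trivialization at `c`. -/
theorem coordVec_eq (c : M) (i : Fin n) {y : EuclideanSpace ℝ (Fin n)}
    (hy : y ∈ (extChartAt (𝓡 n) c).target) :
    coordVec c i y = (trivializationAt (EuclideanSpace ℝ (Fin n)) (TangentSpace (𝓡 n)) c).symm
      ((extChartAt (𝓡 n) c).symm y) (EuclideanSpace.single i 1) := by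
  have : IsManifold (𝓡 n) 1 M := IsManifold.of_le (n := ∞) (by simp)
  have hs : (extChartAt (𝓡 n) c).symm y ∈ (chartAt (EuclideanSpace ℝ (Fin n)) c).source := by
    rw [← extChartAt_source (𝓡 n)]; exact (extChartAt (𝓡 n) c).map_target hy
  have := TangentBundle.symmL_trivializationAt (I := 𝓡 n) hs
  have h2 := congrArg (fun L => L (EuclideanSpace.single i (1 : ℝ))) this
  rw [(extChartAt (𝓡 n) c).right_inv hy] at h2
  simp only [modelWithCornersSelf_coe, Set.range_id, mfderivWithin_univ] at h2
  exact h2.symm.trans (Bundle.Trivialization.symmL_apply (trivializationAt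
    (EuclideanSpace ℝ (Fin n)) (TangentSpace (𝓡 n)) c) hs _)

/-- The components are read off in the trivialization of the bundle of bilinear forms, so smoothness
of the section becomes smoothness of the components. -/
theorem coeff_apply (T : TwoTensor n M) (c : M) {y : EuclideanSpace ℝ (Fin n)}
    (hy : y ∈ (extChartAt (𝓡 n) c).target) (i j : Fin n) :
    T.coeff c y i j = (trivializationAt
      (EuclideanSpace ℝ (Fin n) →L[ℝ] EuclideanSpace ℝ (Fin n) →L[ℝ] ℝ)
      (fun p : M => TangentSpace (𝓡 n) p →L[ℝ] TangentSpace (𝓡 n) p →L[ℝ] ℝ) c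
      ⟨(extChartAt (𝓡 n) c).symm y, T ((extChartAt (𝓡 n) c).symm y)⟩).2
        (EuclideanSpace.single i 1) (EuclideanSpace.single j 1) := by
  have hs : (extChartAt (𝓡 n) c).symm y ∈ (chartAt (EuclideanSpace ℝ (Fin n)) c).source := by
    rw [← extChartAt_source (𝓡 n)]; exact (extChartAt (𝓡 n) c).map_target hy
  have hb : (extChartAt (𝓡 n) c).symm y ∈ (trivializationAt (EuclideanSpace ℝ (Fin n))
    (TangentSpace (𝓡 n)) c).baseSet := hs
  rw [hom_trivializationAt_apply]
  simp only
  erw [inCoordinates_apply_eq₂ hb hb (Set.mem_univ _)]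
  rw [← coordVec_eq c i hy, ← coordVec_eq c j hy]
  simp [TwoTensor.coeff]

set_option synthInstance.maxHeartbeats 400000 in
set_option maxHeartbeats 1000000 in
theorem contDiffOn_coeff {T : TwoTensor n M} (hT : T.IsSmooth) (c : M) (i j : Fin n) :
    ContDiffOn ℝ ∞ (fun y => T.coeff c y i j) (extChartAt (𝓡 n) c).target := by
  have : IsManifold (𝓡 n) 1 M := IsManifold.of_le (n := ∞) (by simp)
  have h1 := (Bundle.Trivialization.contMDiffOn_section_iff (IB := 𝓡 n) (n := ∞) (s := T)
    (trivializationAt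
      (EuclideanSpace ℝ (Fin n) →L[ℝ] EuclideanSpace ℝ (Fin n) →L[ℝ] ℝ)
      (fun p : M => TangentSpace (𝓡 n) p →L[ℝ] TangentSpace (𝓡 n) p →L[ℝ] ℝ) c)
    (Bundle.Trivialization.open_baseSet _) subset_rfl).1 (ContMDiff.contMDiffOn hT)
  have h2 := h1.comp (contMDiffOn_extChartAt_symm (I := 𝓡 n) (n := ∞) c) (fun y hy => by
    have hs : (extChartAt (𝓡 n) c).symm y ∈ (chartAt (EuclideanSpace ℝ (Fin n)) c).source := by
      rw [← extChartAt_source (𝓡 n)]; exact (extChartAt (𝓡 n) c).map_target hy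
    simpa using hs)
  have h3 := contMDiffOn_iff_contDiffOn.1 h2
  have h4 := (h3.clm_apply (contDiffOn_const (c := EuclideanSpace.single i (1 : ℝ)))).clm_apply
    (contDiffOn_const (c := EuclideanSpace.single j (1 : ℝ)))
  exact h4.congr fun y hy => coeff_apply T c hy i j

theorem localTensor_coeff {T : TwoTensor n M} (hT : T.IsSmooth) (hs : ∀ p v w, T p v w = T p w v)
    (c : M) : LocalTensor (extChartAt (𝓡 n) c).target (T.coeff c) where
  smooth i j := contDiffOn_coeff hT c i j
  symm y hy := Matrix.ext fun i j => hs _ _ _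

theorem isOpen_transition (c d : M) : IsOpen {y | y ∈ (extChartAt (𝓡 n) c).target ∧
    (extChartAt (𝓡 n) c).symm y ∈ (extChartAt (𝓡 n) d).source} :=
  (continuousOn_extChartAt_symm c).isOpen_inter_preimage (isOpen_extChartAt_target c)
    (isOpen_extChartAt_source d)

theorem contDiffOn_transition (c d : M) :
    ContDiffOn ℝ ∞ (extChartAt (𝓡 n) d ∘ (extChartAt (𝓡 n) c).symm)
      {y | y ∈ (extChartAt (𝓡 n) c).target ∧
        (extChartAt (𝓡 n) c).symm y ∈ (extChartAt (𝓡 n) d).source} := by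
  refine contMDiffOn_iff_contDiffOn.1 ?_
  refine (contMDiffOn_extChartAt (I := 𝓡 n) (n := ∞) (x := d)).comp
    ((contMDiffOn_extChartAt_symm (I := 𝓡 n) (n := ∞) c).mono fun y hy => hy.1) fun y hy => ?_
  rw [← extChartAt_source (𝓡 n)]; exact hy.2

theorem coordVec_chain (c d : M) (i : Fin n) {y : EuclideanSpace ℝ (Fin n)}
    (hy : y ∈ (extChartAt (𝓡 n) c).target)
    (hd : (extChartAt (𝓡 n) c).symm y ∈ (extChartAt (𝓡 n) d).source) :
    (coordVec c i y : EuclideanSpace ℝ (Fin n)) =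
      ∑ a, jacobian (extChartAt (𝓡 n) d ∘ (extChartAt (𝓡 n) c).symm) y a i •
        (coordVec d a (extChartAt (𝓡 n) d ((extChartAt (𝓡 n) c).symm y)) :
          EuclideanSpace ℝ (Fin n)) := by
  set ψ := extChartAt (𝓡 n) d ∘ (extChartAt (𝓡 n) c).symm
  have hψ : ContDiffAt ℝ ∞ ψ y := (contDiffOn_transition c d).contDiffAt
    ((isOpen_transition c d).mem_nhds ⟨hy, hd⟩)
  have hψ' : MDifferentiableAt 𝓘(ℝ, EuclideanSpace ℝ (Fin n)) 𝓘(ℝ, EuclideanSpace ℝ (Fin n)) ψ y :=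
    (hψ.differentiableAt (by simp)).mdifferentiableAt
  have hds : MDifferentiableAt 𝓘(ℝ, EuclideanSpace ℝ (Fin n)) (𝓡 n)
      (extChartAt (𝓡 n) d).symm (ψ y) :=
    ((contMDiffOn_extChartAt_symm (I := 𝓡 n) (n := ∞) d).contMDiffAt
      ((isOpen_extChartAt_target d).mem_nhds
        ((extChartAt (𝓡 n) d).map_source hd))).mdifferentiableAt (by simp)
  have he : (extChartAt (𝓡 n) c).symm =ᶠ[𝓝 y] (extChartAt (𝓡 n) d).symm ∘ ψ := by
    filter_upwards [(isOpen_transition c d).mem_nhds ⟨hy, hd⟩] with z hz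
    exact ((extChartAt (𝓡 n) d).left_inv hz.2).symm
  have h1 := (he.mfderiv_eq (I := 𝓘(ℝ, EuclideanSpace ℝ (Fin n))) (I' := 𝓡 n)).trans
    (mfderiv_comp y hds hψ')
  rw [mfderiv_eq_fderiv] at h1
  have h2 := congrArg (fun L : EuclideanSpace ℝ (Fin n) →L[ℝ] EuclideanSpace ℝ (Fin n) =>
    L (EuclideanSpace.single i (1 : ℝ))) h1
  refine h2.trans ?_
  have h3 := euclidean_eq_sum (fderiv ℝ ψ y (EuclideanSpace.single i 1))
  refine (congrArg (fun v : EuclideanSpace ℝ (Fin n) => (mfderiv 𝓘(ℝ, EuclideanSpace ℝ (Fin n))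
    (𝓡 n) (extChartAt (𝓡 n) d).symm (ψ y) : EuclideanSpace ℝ (Fin n) →L[ℝ]
      EuclideanSpace ℝ (Fin n)) v) h3).trans ?_
  set L : EuclideanSpace ℝ (Fin n) →L[ℝ] EuclideanSpace ℝ (Fin n) :=
    mfderiv 𝓘(ℝ, EuclideanSpace ℝ (Fin n)) (𝓡 n) (extChartAt (𝓡 n) d).symm (ψ y)
  change L _ = _
  rw [map_sum]
  exact Finset.sum_congr rfl fun a _ => map_smul _ _ _

/-- Returning through a chart gives the same point only propositionally. All tangent spaces are the
model space by definition, so the same vectors may be used at both points. -/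
theorem apply_congr (T : TwoTensor n M) {p q : M} (h : p = q) (v w : EuclideanSpace ℝ (Fin n)) :
    (T p : EuclideanSpace ℝ (Fin n) →L[ℝ] EuclideanSpace ℝ (Fin n) →L[ℝ] ℝ) v w =
    (T q : EuclideanSpace ℝ (Fin n) →L[ℝ] EuclideanSpace ℝ (Fin n) →L[ℝ] ℝ) v w := by
  subst h; rfl

theorem coeff_change (T : TwoTensor n M) (c d : M) {y : EuclideanSpace ℝ (Fin n)}
    (hy : y ∈ (extChartAt (𝓡 n) c).target)
    (hd : (extChartAt (𝓡 n) c).symm y ∈ (extChartAt (𝓡 n) d).source) :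
    T.coeff c y = (jacobian (extChartAt (𝓡 n) d ∘ (extChartAt (𝓡 n) c).symm) y)ᵀ *
      T.coeff d (extChartAt (𝓡 n) d ((extChartAt (𝓡 n) c).symm y)) *
      jacobian (extChartAt (𝓡 n) d ∘ (extChartAt (𝓡 n) c).symm) y := by
  ext i j
  have h1 := apply_congr T ((extChartAt (𝓡 n) d).left_inv hd) (coordVec c i y) (coordVec c j y)
  refine (h1.symm : _ = _).trans ?_
  rw [coordVec_chain c d i hy hd, coordVec_chain c d j hy hd]
  simp only [map_sum, ContinuousLinearMap.sum_apply, map_smul, ContinuousLinearMap.smul_apply,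
    smul_eq_mul, Matrix.mul_apply, Matrix.transpose_apply, Finset.sum_mul, Finset.mul_sum]
  refine Finset.sum_congr rfl fun a _ => Finset.sum_congr rfl fun b _ => ?_
  simp only [TwoTensor.coeff, Matrix.of_apply]
  ring
end ManifoldCharts

/-! ### Metrics, variations and the curvature at a point -/

section ManifoldMetrics

variable {n : ℕ} {M : Type*} [TopologicalSpace M] [ChartedSpace (EuclideanSpace ℝ (Fin n)) M]
  [IsManifold (𝓡 n) ∞ M]

theorem bilin_add_apply {p : M} (A B : TangentSpace (𝓡 n) p →L[ℝ] TangentSpace (𝓡 n) p →L[ℝ] ℝ)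
    (v w : TangentSpace (𝓡 n) p) : (A + B) v w = A v w + B v w := rfl

theorem bilin_smul_apply {p : M} (s : ℝ)
    (A : TangentSpace (𝓡 n) p →L[ℝ] TangentSpace (𝓡 n) p →L[ℝ] ℝ) (v w : TangentSpace (𝓡 n) p) :
    (s • A) v w = s * A v w := rfl

theorem bilin_ext {p : M} {A B : TangentSpace (𝓡 n) p →L[ℝ] TangentSpace (𝓡 n) p →L[ℝ] ℝ}
    (h : ∀ v w, A v w = B v w) : A = B :=
  ContinuousLinearMap.ext fun v => ContinuousLinearMap.ext fun w => h v w

/-- A smooth Riemannian metric. -/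
structure IsMetric (g : TwoTensor n M) : Prop where
  smooth : g.IsSmooth
  symm : ∀ p v w, g p v w = g p w v
  pos : ∀ p v, v ≠ 0 → 0 < g p v v

/-- A variation of a metric: a smooth symmetric two-tensor vanishing outside `K`. -/
structure IsVariation (K : Set M) (h : TwoTensor n M) : Prop where
  smooth : h.IsSmooth
  symm : ∀ p v w, h p v w = h p w v
  zero : ∀ p, p ∉ K → ∀ v w, h p v w = 0

theorem IsMetric.localTensor {g : TwoTensor n M} (hg : IsMetric g) (c : M) :
    LocalTensor (extChartAt (𝓡 n) c).target (g.coeff c) := localTensor_coeff hg.smooth hg.symm c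

theorem IsVariation.localTensor {K : Set M} {h : TwoTensor n M} (hh : IsVariation K h) (c : M) :
    LocalTensor (extChartAt (𝓡 n) c).target (h.coeff c) := localTensor_coeff hh.smooth hh.symm c

theorem IsVariation.add {K : Set M} {h h' : TwoTensor n M} (hh : IsVariation K h)
    (hh' : IsVariation K h') : IsVariation K fun p => h p + h' p where
  smooth := ContMDiff.add_section hh.smooth hh'.smooth
  symm p v w := by rw [bilin_add_apply, bilin_add_apply, hh.symm p v w, hh'.symm p v w]
  zero p hp v w := by rw [bilin_add_apply, hh.zero p hp, hh'.zero p hp, add_zero]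

theorem IsVariation.mul {K : Set M} {h : TwoTensor n M} (hh : IsVariation K h) {f : M → ℝ}
    (hf : ContMDiff (𝓡 n) 𝓘(ℝ, ℝ) ∞ f) : IsVariation (tsupport f ∩ K) fun p => f p • h p where
  smooth := ContMDiff.smul_section hf hh.smooth
  symm p v w := by rw [bilin_smul_apply, bilin_smul_apply, hh.symm p v w]
  zero p hp v w := by
    rw [bilin_smul_apply]
    by_cases hpK : p ∈ K
    · rw [image_eq_zero_of_notMem_tsupport fun hp' => hp ⟨hp', hpK⟩, zero_mul]
    · rw [hh.zero p hpK, mul_zero]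

theorem coeff_line (g h : TwoTensor n M) (s : ℝ) (c : M) :
    TwoTensor.coeff (fun p => g p + s • h p) c = fun y => g.coeff c y + s • h.coeff c y := by
  ext y i j
  rfl

theorem coeff_add (g h : TwoTensor n M) (c : M) :
    TwoTensor.coeff (fun p => g p + h p) c = fun y => g.coeff c y + h.coeff c y := by
  ext y i j
  rfl

theorem apply_sum_coordVec (T : TwoTensor n M) (c : M) (x x' y : EuclideanSpace ℝ (Fin n)) :
    T ((extChartAt (𝓡 n) c).symm y) (∑ i, x i • coordVec c i y) (∑ i, x' i • coordVec c i y) =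
      ∑ i, ∑ j, x i * x' j * T.coeff c y i j := by
  simp only [map_sum, ContinuousLinearMap.sum_apply, map_smul, ContinuousLinearMap.smul_apply,
    smul_eq_mul, Finset.mul_sum]
  rw [Finset.sum_comm]
  exact Finset.sum_congr rfl fun a _ => Finset.sum_congr rfl fun b _ => by
    simp only [TwoTensor.coeff, Matrix.of_apply]
    ring

theorem symmL_eq_sum (c : M) {y : EuclideanSpace ℝ (Fin n)}
    (hy : y ∈ (extChartAt (𝓡 n) c).target) (x : EuclideanSpace ℝ (Fin n)) :
    (trivializationAt (EuclideanSpace ℝ (Fin n)) (TangentSpace (𝓡 n)) c).symmL ℝ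
      ((extChartAt (𝓡 n) c).symm y) x = ∑ i, x i • coordVec c i y := by
  have hs : (extChartAt (𝓡 n) c).symm y ∈ (chartAt (EuclideanSpace ℝ (Fin n)) c).source := by
    rw [← extChartAt_source (𝓡 n)]; exact (extChartAt (𝓡 n) c).map_target hy
  nth_rewrite 1 [euclidean_eq_sum x]
  rw [map_sum]
  refine Finset.sum_congr rfl fun i _ => ?_
  rw [map_smul, coordVec_eq c i hy]
  exact congrArg (x i • ·) (Bundle.Trivialization.symmL_apply (trivializationAt
    (EuclideanSpace ℝ (Fin n)) (TangentSpace (𝓡 n)) c) hs _)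

theorem exists_coordinates (c : M) {y : EuclideanSpace ℝ (Fin n)}
    (hy : y ∈ (extChartAt (𝓡 n) c).target)
    (v : TangentSpace (𝓡 n) ((extChartAt (𝓡 n) c).symm y)) :
    ∃ x : EuclideanSpace ℝ (Fin n), v = ∑ i, x i • coordVec c i y := by
  have hs : (extChartAt (𝓡 n) c).symm y ∈ (chartAt (EuclideanSpace ℝ (Fin n)) c).source := by
    rw [← extChartAt_source (𝓡 n)]; exact (extChartAt (𝓡 n) c).map_target hy
  exact ⟨_, ((trivializationAt (EuclideanSpace ℝ (Fin n))
    (TangentSpace (𝓡 n)) c).symmL_continuousLinearMapAt (R := ℝ) hs v).symm.trans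
    (symmL_eq_sum c hy _)⟩

theorem sum_coordVec_ne_zero (c : M) {y : EuclideanSpace ℝ (Fin n)}
    (hy : y ∈ (extChartAt (𝓡 n) c).target) {x : EuclideanSpace ℝ (Fin n)} (hx : x ≠ 0) :
    ∑ i, x i • coordVec c i y ≠ 0 := by
  have hs : (extChartAt (𝓡 n) c).symm y ∈ (chartAt (EuclideanSpace ℝ (Fin n)) c).source := by
    rw [← extChartAt_source (𝓡 n)]; exact (extChartAt (𝓡 n) c).map_target hy
  rw [← symmL_eq_sum c hy]
  intro h0
  apply hx
  have := (trivializationAt (EuclideanSpace ℝ (Fin n))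
    (TangentSpace (𝓡 n)) c).continuousLinearMapAt_symmL (R := ℝ) hs x
  rw [h0, map_zero] at this
  exact this.symm

theorem IsMetric.posDef {g : TwoTensor n M} (hg : IsMetric g) (c : M)
    {y : EuclideanSpace ℝ (Fin n)} (hy : y ∈ (extChartAt (𝓡 n) c).target) :
    (g.coeff c y).PosDef := by
  refine Matrix.PosDef.of_dotProduct_mulVec_pos ?_ fun x hx => ?_
  · exact Matrix.ext fun i j => hg.symm _ _ _
  · have h1 := hg.pos _ _ (sum_coordVec_ne_zero c hy (x := WithLp.toLp 2 x) (by simpa using hx))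
    rw [apply_sum_coordVec] at h1
    refine h1.trans_eq ?_
    simp only [dotProduct, Matrix.mulVec, Finset.mul_sum, star_trivial]
    exact Finset.sum_congr rfl fun a _ => Finset.sum_congr rfl fun b _ => by ring

theorem IsMetric.det_pos {g : TwoTensor n M} (hg : IsMetric g) (c : M)
    {y : EuclideanSpace ℝ (Fin n)} (hy : y ∈ (extChartAt (𝓡 n) c).target) :
    0 < (g.coeff c y).det := (hg.posDef c hy).det_pos

/-- In the chart at `p` the quadratic form is jointly continuous in the parameter, the point and the
vector; compactness of the unit sphere gives a neighbourhood valid for all unit vectors, and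
homogeneity does the rest. -/
theorem eventually_pos {g h : TwoTensor n M} (hg : IsMetric g) {K : Set M} (hh : IsVariation K h)
    (p : M) : ∀ᶠ z : ℝ × M in 𝓝 (0, p), ∀ v, v ≠ 0 → 0 < (g z.2 + z.1 • h z.2) v v := by
  set G := g.coeff p
  set H := h.coeff p
  set y₀ := extChartAt (𝓡 n) p p
  have hy₀ : y₀ ∈ (extChartAt (𝓡 n) p).target := mem_extChartAt_target p
  have hU := (isOpen_extChartAt_target (I := 𝓡 n) p).mem_nhds hy₀
  have hGc : ∀ i j, ContinuousAt (fun y => G y i j) y₀ := fun i j =>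
    ((hg.localTensor p).smooth i j).continuousOn.continuousAt hU
  have hHc : ∀ i j, ContinuousAt (fun y => H y i j) y₀ := fun i j =>
    ((hh.localTensor p).smooth i j).continuousOn.continuousAt hU
  have key : ∀ᶠ z : ℝ × EuclideanSpace ℝ (Fin n) in 𝓝 (0, y₀),
      ∀ x ∈ Metric.sphere (0 : EuclideanSpace ℝ (Fin n)) 1,
        0 < ∑ i, ∑ j, x i * x j * (G z.2 i j + z.1 * H z.2 i j) := by
    refine (isCompact_sphere (0 : EuclideanSpace ℝ (Fin n)) 1).eventually_forall_of_forall_eventually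
      (P := fun (z : ℝ × EuclideanSpace ℝ (Fin n)) x =>
        0 < ∑ i, ∑ j, x i * x j * (G z.2 i j + z.1 * H z.2 i j)) fun x hx => ?_
    have hc : ContinuousAt (fun w : (ℝ × EuclideanSpace ℝ (Fin n)) × EuclideanSpace ℝ (Fin n) =>
        ∑ i, ∑ j, w.2 i * w.2 j * (G w.1.2 i j + w.1.1 * H w.1.2 i j)) ((0, y₀), x) := by
      refine tendsto_finsetSum _ fun i _ => tendsto_finsetSum _ fun j _ => ?_
      have hx' : ∀ i, ContinuousAt (fun w : (ℝ × EuclideanSpace ℝ (Fin n)) ×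
          EuclideanSpace ℝ (Fin n) => w.2 i) ((0, y₀), x) := fun i =>
        ((coordinate i).continuous.comp continuous_snd).continuousAt
      have h2 : ContinuousAt (fun w : (ℝ × EuclideanSpace ℝ (Fin n)) ×
          EuclideanSpace ℝ (Fin n) => w.1.2) ((0, y₀), x) :=
        (continuous_snd.comp continuous_fst).continuousAt
      have h1 : ContinuousAt (fun w : (ℝ × EuclideanSpace ℝ (Fin n)) ×
          EuclideanSpace ℝ (Fin n) => w.1.1) ((0, y₀), x) :=
        (continuous_fst.comp continuous_fst).continuousAt
      have hG2 : ContinuousAt (fun w : (ℝ × EuclideanSpace ℝ (Fin n)) ×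
          EuclideanSpace ℝ (Fin n) => G w.1.2 i j) ((0, y₀), x) :=
        ContinuousAt.comp (g := fun y => G y i j) (f := fun w : (ℝ × EuclideanSpace ℝ (Fin n)) ×
          EuclideanSpace ℝ (Fin n) => w.1.2) (hGc i j) h2
      have hH2 : ContinuousAt (fun w : (ℝ × EuclideanSpace ℝ (Fin n)) ×
          EuclideanSpace ℝ (Fin n) => H w.1.2 i j) ((0, y₀), x) :=
        ContinuousAt.comp (g := fun y => H y i j) (f := fun w : (ℝ × EuclideanSpace ℝ (Fin n)) ×
          EuclideanSpace ℝ (Fin n) => w.1.2) (hHc i j) h2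
      exact ((hx' i).mul (hx' j)).mul (hG2.add (h1.mul hH2))
    refine hc.eventually (lt_mem_nhds (a := (0 : ℝ)) ?_)
    have hx0 : x ≠ 0 := by
      rintro rfl
      simp at hx
    have h1 := hg.pos _ _ (sum_coordVec_ne_zero p hy₀ hx0)
    rw [apply_sum_coordVec] at h1
    simpa using h1
  have ht : Filter.Tendsto (fun z : ℝ × M => (z.1, extChartAt (𝓡 n) p z.2)) (𝓝 (0, p))
      (𝓝 (0, y₀)) := by
    have : ContinuousAt (fun z : ℝ × M => (z.1, extChartAt (𝓡 n) p z.2)) (0, p) :=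
      continuousAt_fst.prodMk (ContinuousAt.comp (f := Prod.snd) (continuousAt_extChartAt p)
        continuousAt_snd)
    exact this
  have hsrc : ∀ᶠ z : ℝ × M in 𝓝 (0, p), z.2 ∈ (extChartAt (𝓡 n) p).source :=
    continuousAt_snd.eventually (extChartAt_source_mem_nhds (I := 𝓡 n) p)
  filter_upwards [ht.eventually key, hsrc] with z hz hz2 v hv
  obtain ⟨s, q⟩ := z
  simp only at hz hz2 v hv ⊢
  obtain ⟨y, hy, rfl⟩ : ∃ y ∈ (extChartAt (𝓡 n) p).target, (extChartAt (𝓡 n) p).symm y = q :=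
    ⟨_, (extChartAt (𝓡 n) p).map_source hz2, (extChartAt (𝓡 n) p).left_inv hz2⟩
  rw [(extChartAt (𝓡 n) p).right_inv hy] at hz
  obtain ⟨x, rfl⟩ := exists_coordinates p hy v
  refine lt_of_lt_of_eq ?_ (apply_sum_coordVec (fun p => g p + s • h p) p x x y).symm
  have hx1 : x ≠ 0 := by
    rintro rfl
    exact hv (Finset.sum_eq_zero fun i _ => zero_smul ℝ _)
  have hn : 0 < ‖x‖ := norm_pos_iff.2 hx1
  have h3 := hz (‖x‖⁻¹ • x) (by simp [norm_smul, hn.ne'])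
  have h4 : ∑ i, ∑ j, x i * x j * TwoTensor.coeff (fun p => g p + s • h p) p y i j =
      ‖x‖ ^ 2 * ∑ i, ∑ j, (‖x‖⁻¹ • x) i * (‖x‖⁻¹ • x) j * (G y i j + s * H y i j) := by
    simp only [Finset.mul_sum, coeff_line]
    refine Finset.sum_congr rfl fun i _ => Finset.sum_congr rfl fun j _ => ?_
    simp only [PiLp.smul_apply, smul_eq_mul, Matrix.add_apply, Matrix.smul_apply]
    field_simp
    rfl
  rw [h4]
  positivity

/-- Compactness of `K` makes the bound on the parameter uniform; outside `K` the metric is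
unchanged. -/
theorem IsMetric.eventually_line {g h : TwoTensor n M} (hg : IsMetric g) {K : Set M}
    (hK : IsCompact K) (hh : IsVariation K h) :
    ∀ᶠ s : ℝ in 𝓝 0, IsMetric fun p => g p + s • h p := by
  have := hK.eventually_forall_of_forall_eventually
    (P := fun (s : ℝ) q => ∀ v, v ≠ 0 → 0 < (g q + s • h q) v v)
    fun p _ => eventually_pos hg hh p
  filter_upwards [this] with s hs
  refine ⟨ContMDiff.add_section hg.smooth (ContMDiff.const_smul_section hh.smooth),
    fun p v w => by
      rw [bilin_add_apply, bilin_add_apply, bilin_smul_apply, bilin_smul_apply, hg.symm p v w,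
        hh.symm p v w], fun p v hv => ?_⟩
  by_cases hp : p ∈ K
  · exact hs p hp v hv
  · rw [bilin_add_apply, bilin_smul_apply, hh.zero p hp, mul_zero, add_zero]
    exact hg.pos p v hv

/-- The curvature functions are defined at each point in the chart preferred there; by `invariance`
any chart may be used. -/
theorem IsMetric.curvature_eq {g : TwoTensor n M} (hg : IsMetric g) (c : M) {p : M}
    (hp : p ∈ (extChartAt (𝓡 n) c).source) :
    ricNormSq g p = normSq (g.coeff c) (ric (g.coeff c)) (extChartAt (𝓡 n) c p) ∧
      scalarCurvature g p = scal (g.coeff c) (extChartAt (𝓡 n) c p) := by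
  have hp' : extChartAt (𝓡 n) p p ∈ {y | y ∈ (extChartAt (𝓡 n) p).target ∧
    (extChartAt (𝓡 n) p).symm y ∈ (extChartAt (𝓡 n) c).source} :=
    ⟨mem_extChartAt_target p, by rwa [extChartAt_to_inv]⟩
  have := invariance (isOpen_transition p c) (isOpen_extChartAt_target c)
    ((hg.localTensor p).mono fun y hy => hy.1) (hg.localTensor c)
    (fun y hy => hg.det_pos p hy.1) (fun y hy => hg.det_pos c hy) (contDiffOn_transition p c)
    (fun y hy => (extChartAt (𝓡 n) c).map_source hy.2)
    (fun y hy => coeff_change g p c hy.1 hy.2) hp'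
  rw [Function.comp_apply, extChartAt_to_inv] at this
  exact this

end ManifoldMetrics

/-! ### The Riemannian measure in charts -/

section Volume

variable {n : ℕ} {M : Type*} [TopologicalSpace M] [ChartedSpace (EuclideanSpace ℝ (Fin n)) M]

/-- The coordinates of the points of a set in the domain of a chart. -/
def chartImage (c : M) (A : Set M) : Set (EuclideanSpace ℝ (Fin n)) :=
  (extChartAt (𝓡 n) c).target ∩ (extChartAt (𝓡 n) c).symm ⁻¹' A

theorem isCompact_chartImage {c : M} {C : Set M} (hC : IsCompact C)
    (hCc : C ⊆ (extChartAt (𝓡 n) c).source) : IsCompact (chartImage (n := n) c C) := by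
  have : chartImage (n := n) c C = extChartAt (𝓡 n) c '' C := by
    rw [chartImage, (extChartAt (𝓡 n) c).image_eq_target_inter_inv_preimage hCc]
  rw [this]
  exact hC.image_of_continuousOn ((continuousOn_extChartAt c).mono hCc)

theorem chartImage_inter (c : M) (A B : Set M) :
    chartImage (n := n) c (A ∩ B) = (extChartAt (𝓡 n) c).symm ⁻¹' A ∩ chartImage c B := by
  ext y; simp [chartImage, and_left_comm]

variable [MeasurableSpace M] [BorelSpace M]

theorem measurableSet_chartImage (c : M) {A : Set M} (hA : MeasurableSet A) :
    MeasurableSet (chartImage (n := n) c A) := by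
  classical
  have hm : MeasurableSet (extChartAt (𝓡 n) c).target :=
    (isOpen_extChartAt_target c).measurableSet
  -- The inverse chart is known to be continuous only on the target; a constant outside makes it
  -- measurable on the whole space.
  have h1 := (continuousOn_extChartAt_symm (I := 𝓡 n) c).measurable_piecewise
    (continuousOn_const (c := c) (s := (extChartAt (𝓡 n) c).targetᶜ)) hm
  have : chartImage (n := n) c A = (extChartAt (𝓡 n) c).target ∩
      ((extChartAt (𝓡 n) c).target.piecewise (extChartAt (𝓡 n) c).symm fun _ => c) ⁻¹' A := by
    ext y
    simp only [chartImage, Set.mem_inter_iff, Set.mem_preimage]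
    refine and_congr_right fun hy => ?_
    rw [Set.piecewise_eq_of_mem _ _ _ hy]
  rw [this]
  exact hm.inter (h1 hA)

/-- The density of the volume in a chart. -/
def volumeDensity (g : TwoTensor n M) (c : M) (y : EuclideanSpace ℝ (Fin n)) : ℝ≥0∞ :=
  ENNReal.ofReal √(g.coeff c y).det

theorem map_withDensity_apply (g : TwoTensor n M) (c : M) {A B : Set M} (hA : MeasurableSet A)
    (hB : MeasurableSet B) :
    Measure.map (extChartAt (𝓡 n) c).symm
      ((volume.restrict (chartImage c A)).withDensity (volumeDensity g c)) B =
      ∫⁻ y in chartImage c (B ∩ A), volumeDensity g c y := by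
  have hm := measurableSet_chartImage (n := n) c hA
  have h1 : AEMeasurable (extChartAt (𝓡 n) c).symm
      ((volume.restrict (chartImage c A)).withDensity (volumeDensity g c)) :=
    (((continuousOn_extChartAt_symm (I := 𝓡 n) c).mono Set.inter_subset_left).aemeasurable
      hm).mono_ac (withDensity_absolutelyContinuous _ _)
  rw [Measure.map_apply_of_aemeasurable h1 hB, withDensity_apply', Measure.restrict_restrict' hm,
    chartImage_inter]

theorem chartVolume_apply (g : TwoTensor n M) (c : M) {B : Set M} (hB : MeasurableSet B) :
    chartVolume g c B = ∫⁻ y in chartImage c B, volumeDensity g c y := by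
  have := map_withDensity_apply g c MeasurableSet.univ hB
  rw [Set.inter_univ] at this
  rw [← this]
  have e : chartImage (n := n) c (Set.univ : Set M) = (extChartAt (𝓡 n) c).target := by simp [chartImage]
  rw [e]
  rfl

theorem chartVolume_inter_source (g : TwoTensor n M) (c : M) {B : Set M} (hB : MeasurableSet B) :
    chartVolume g c (B ∩ (extChartAt (𝓡 n) c).source) = chartVolume g c B := by
  rw [chartVolume_apply g c hB, chartVolume_apply g c
    (hB.inter (isOpen_extChartAt_source c).measurableSet)]
  congr 2
  ext y
  simp only [chartImage, Set.mem_inter_iff, Set.mem_preimage]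
  exact ⟨fun h => ⟨h.1, h.2.1⟩, fun h => ⟨h.1, h.2, (extChartAt (𝓡 n) c).map_target h.1⟩⟩

theorem det_jacobian (ψ : EuclideanSpace ℝ (Fin n) → EuclideanSpace ℝ (Fin n))
    (y : EuclideanSpace ℝ (Fin n)) : (jacobian ψ y).det = (fderiv ℝ ψ y).det := by
  have h : jacobian ψ y = LinearMap.toMatrix (EuclideanSpace.basisFun (Fin n) ℝ).toBasis
      (EuclideanSpace.basisFun (Fin n) ℝ).toBasis (fderiv ℝ ψ y : _ →ₗ[ℝ] _) := by
    ext i j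
    simp [jacobian, LinearMap.toMatrix_apply]
  rw [h, LinearMap.det_toMatrix]

variable [IsManifold (𝓡 n) ∞ M]

/-- Change of variables: $\sqrt{\det g}$ transforms by the absolute value of the Jacobian
determinant. -/
theorem chartVolume_eq (g : TwoTensor n M) (c d : M) {B : Set M} (hB : MeasurableSet B)
    (hc : B ⊆ (extChartAt (𝓡 n) c).source) (hd : B ⊆ (extChartAt (𝓡 n) d).source) :
    chartVolume g c B = chartVolume g d B := by
  rw [chartVolume_apply g c hB, chartVolume_apply g d hB]
  set ψ := extChartAt (𝓡 n) d ∘ (extChartAt (𝓡 n) c).symm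
  have hsub : ∀ y ∈ chartImage c B, y ∈ {y | y ∈ (extChartAt (𝓡 n) c).target ∧
      (extChartAt (𝓡 n) c).symm y ∈ (extChartAt (𝓡 n) d).source} := fun y hy => ⟨hy.1, hd hy.2⟩
  have himg : ψ '' chartImage c B = chartImage d B := by
    ext z
    constructor
    · rintro ⟨y, hy, rfl⟩
      refine ⟨(extChartAt (𝓡 n) d).map_source (hd hy.2), ?_⟩
      change (extChartAt (𝓡 n) d).symm (extChartAt (𝓡 n) d ((extChartAt (𝓡 n) c).symm y)) ∈ B
      rw [(extChartAt (𝓡 n) d).left_inv (hd hy.2)]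
      exact hy.2
    · intro hz
      have hz2 : (extChartAt (𝓡 n) d).symm z ∈ B := hz.2
      refine ⟨extChartAt (𝓡 n) c ((extChartAt (𝓡 n) d).symm z),
        ⟨(extChartAt (𝓡 n) c).map_source (hc hz2), ?_⟩, ?_⟩
      · rw [Set.mem_preimage, (extChartAt (𝓡 n) c).left_inv (hc hz2)]
        exact hz2
      · change extChartAt (𝓡 n) d ((extChartAt (𝓡 n) c).symm
          (extChartAt (𝓡 n) c ((extChartAt (𝓡 n) d).symm z))) = z
        rw [(extChartAt (𝓡 n) c).left_inv (hc hz2), (extChartAt (𝓡 n) d).right_inv hz.1]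
  have hinj : Set.InjOn ψ (chartImage c B) := fun y hy z hz hyz => by
    have h1 := (extChartAt (𝓡 n) d).injOn (hd hy.2) (hd hz.2) hyz
    exact (extChartAt (𝓡 n) c).symm.injOn hy.1 hz.1 h1
  have hderiv : ∀ y ∈ chartImage c B,
      HasFDerivWithinAt ψ (fderiv ℝ ψ y) (chartImage c B) y := fun y hy =>
    (((contDiffOn_transition c d).contDiffAt
      ((isOpen_transition c d).mem_nhds (hsub y hy))).differentiableAt
        (by simp)).hasFDerivAt.hasFDerivWithinAt
  rw [← himg, lintegral_image_eq_lintegral_abs_det_fderiv_mul volume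
    (measurableSet_chartImage c hB) hderiv hinj]
  refine setLIntegral_congr_fun (measurableSet_chartImage c hB) fun y hy => ?_
  have h1 := congrArg Matrix.det (coeff_change g c d (hsub y hy).1 (hsub y hy).2)
  rw [Matrix.det_mul, Matrix.det_mul, Matrix.det_transpose, det_jacobian] at h1
  simp only [volumeDensity]
  rw [← ENNReal.ofReal_mul (abs_nonneg _), h1]
  congr 1
  rw [mul_comm _ (TwoTensor.coeff g d _).det, mul_assoc, mul_comm, ← pow_two,
    Real.sqrt_mul (sq_nonneg _), Real.sqrt_sq_eq_abs]
  rfl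

/-- Gluing chart measures along a countable disjoint cover gives a measure that agrees with every
chart measure on its domain, hence dominates them all; their supremum therefore cannot exceed it. -/
theorem volumeMeasure_apply [SecondCountableTopology M] (g : TwoTensor n M) (c : M) {B : Set M}
    (hB : MeasurableSet B) (hc : B ⊆ (extChartAt (𝓡 n) c).source) :
    volumeMeasure g B = chartVolume g c B := by
  refine le_antisymm ?_ (Measure.le_iff.1 (le_iSup (fun c => chartVolume g c) c) B hB)
  have : Nonempty M := ⟨c⟩
  obtain ⟨t, ht, hcov⟩ := TopologicalSpace.countable_cover_nhds
    (fun p : M => extChartAt_source_mem_nhds (I := 𝓡 n) p)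
  have htn : t.Nonempty := by
    by_contra h
    rw [Set.not_nonempty_iff_eq_empty] at h
    rw [h] at hcov
    simp only [Set.mem_empty_iff_false, Set.iUnion_of_empty, Set.iUnion_empty] at hcov
    exact Set.empty_ne_univ hcov
  obtain ⟨f, rfl⟩ := ht.exists_eq_range htn
  set A : ℕ → Set M := disjointed fun k => (extChartAt (𝓡 n) (f k)).source
  have hAm : ∀ k, MeasurableSet (A k) := fun k =>
    MeasurableSet.disjointed (fun k => (isOpen_extChartAt_source (f k)).measurableSet) k
  have hAs : ∀ k, A k ⊆ (extChartAt (𝓡 n) (f k)).source := fun k => disjointed_subset _ k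
  have hAd : Pairwise (Function.onFun Disjoint A) := disjoint_disjointed _
  have hAu : ⋃ k, A k = Set.univ := by
    rw [iUnion_disjointed, ← hcov, Set.biUnion_range]
  set ν : Measure M := Measure.sum fun k => (chartVolume g (f k)).restrict (A k)
  have hsplit : ∀ (μ : Measure M) {B : Set M}, MeasurableSet B → μ B = ∑' k, μ (B ∩ A k) :=
    fun μ B hB => by
      rw [← measure_iUnion (fun i j hij => (hAd hij).mono Set.inter_subset_right
        Set.inter_subset_right) fun k => hB.inter (hAm k), ← Set.inter_iUnion, hAu, Set.inter_univ]
  have hν : ∀ (d : M) {B : Set M}, MeasurableSet B → B ⊆ (extChartAt (𝓡 n) d).source →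
      ν B = chartVolume g d B := fun d B hB hBd => by
    rw [Measure.sum_apply _ hB, hsplit _ hB]
    refine tsum_congr fun k => ?_
    rw [Measure.restrict_apply hB]
    exact chartVolume_eq g _ _ (hB.inter (hAm k)) (Set.inter_subset_right.trans (hAs k))
      (Set.inter_subset_left.trans hBd)
  have hle : volumeMeasure g ≤ ν := iSup_le fun d => Measure.le_iff.2 fun B hB => by
    have hm := hB.inter (isOpen_extChartAt_source (I := 𝓡 n) d).measurableSet
    rw [← chartVolume_inter_source g d hB, ← hν d hm Set.inter_subset_right]
    exact measure_mono Set.inter_subset_left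
  exact (Measure.le_iff.1 hle B hB).trans_eq (hν c hB hc)

theorem volumeMeasure_restrict [SecondCountableTopology M] (g : TwoTensor n M) (c : M) {A : Set M}
    (hA : MeasurableSet A) (hc : A ⊆ (extChartAt (𝓡 n) c).source) :
    (volumeMeasure g).restrict A = Measure.map (extChartAt (𝓡 n) c).symm
      ((volume.restrict (chartImage c A)).withDensity (volumeDensity g c)) := by
  refine Measure.ext fun B hB => ?_
  rw [Measure.restrict_apply hB, map_withDensity_apply g c hA hB,
    volumeMeasure_apply g c (hB.inter hA) (Set.inter_subset_right.trans hc),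
    chartVolume_apply g c (hB.inter hA)]

section Integral

variable [SecondCountableTopology M] {g : TwoTensor n M} {c : M} {A : Set M}
  (hg : ContinuousOn (fun y => (g.coeff c y).det) (extChartAt (𝓡 n) c).target)
  (hA : MeasurableSet A) (hc : A ⊆ (extChartAt (𝓡 n) c).source) {f : M → ℝ}
  (hf : ContinuousOn f (extChartAt (𝓡 n) c).source)

include hg hA hc hf

theorem setIntegral_volumeMeasure :
    ∫ p in A, f p ∂(volumeMeasure g) =
      ∫ y in chartImage c A, √(g.coeff c y).det * f ((extChartAt (𝓡 n) c).symm y) := by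
  have hm := measurableSet_chartImage (n := n) c hA
  have h1 : AEMeasurable (extChartAt (𝓡 n) c).symm
      ((volume.restrict (chartImage c A)).withDensity (volumeDensity g c)) :=
    (((continuousOn_extChartAt_symm (I := 𝓡 n) c).mono Set.inter_subset_left).aemeasurable
      hm).mono_ac (withDensity_absolutelyContinuous _ _)
  have hfm : AEStronglyMeasurable f ((volumeMeasure g).restrict A) :=
    ((hf.mono hc).aemeasurable hA).aestronglyMeasurable
  rw [volumeMeasure_restrict g c hA hc] at hfm ⊢
  rw [integral_map h1 hfm]
  have h2 : AEMeasurable (fun y => (√(g.coeff c y).det).toNNReal)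
      (volume.restrict (chartImage c A)) :=
    (((hg.mono Set.inter_subset_left).sqrt).aemeasurable hm).real_toNNReal
  refine (integral_withDensity_eq_integral_smul₀ h2 _).trans ?_
  refine integral_congr_ae (Filter.Eventually.of_forall fun y => ?_)
  simp only [NNReal.smul_def, Real.coe_toNNReal _ (Real.sqrt_nonneg _), smul_eq_mul]

theorem integrableOn_volumeMeasure
    (hi : IntegrableOn (fun y => √(g.coeff c y).det * f ((extChartAt (𝓡 n) c).symm y))
      (chartImage c A)) : IntegrableOn f A (volumeMeasure g) := by
  have hm := measurableSet_chartImage (n := n) c hA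
  have h1 : AEMeasurable (extChartAt (𝓡 n) c).symm
      ((volume.restrict (chartImage c A)).withDensity (volumeDensity g c)) :=
    (((continuousOn_extChartAt_symm (I := 𝓡 n) c).mono Set.inter_subset_left).aemeasurable
      hm).mono_ac (withDensity_absolutelyContinuous _ _)
  have hfm : AEStronglyMeasurable f ((volumeMeasure g).restrict A) :=
    ((hf.mono hc).aemeasurable hA).aestronglyMeasurable
  rw [IntegrableOn, volumeMeasure_restrict g c hA hc] at *
  rw [integrable_map_measure hfm h1]
  have h2 : AEMeasurable (fun y => (√(g.coeff c y).det).toNNReal)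
      (volume.restrict (chartImage c A)) :=
    (((hg.mono Set.inter_subset_left).sqrt).aemeasurable hm).real_toNNReal
  refine (integrable_withDensity_iff_integrable_smul₀ h2).2 ?_
  refine hi.congr (Filter.Eventually.of_forall fun y => ?_)
  simp only [NNReal.smul_def, Real.coe_toNNReal _ (Real.sqrt_nonneg _), smul_eq_mul,
    Function.comp_apply]

end Integral

end Volume

/-! ### Differentiation of the energy in coordinates -/

section LocalVariation

variable {n : ℕ} {U : Set (EuclideanSpace ℝ (Fin n))}
  {G H : EuclideanSpace ℝ (Fin n) → Matrix (Fin n) (Fin n) ℝ}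

theorem contDiffOn_curvature (hU : IsOpen U) (hG : LocalTensor U G) (hpos : ∀ y ∈ U, 0 < (G y).det) :
    ContDiffOn ℝ ∞ (fun y => normSq G (ric G) y) U ∧ ContDiffOn ℝ ∞ (fun y => scal G y) U := by
  have hF := hG.metricFamily hU ℝ
  have hm : Set.MapsTo (fun y => ((0 : ℝ), y)) U
    {x : ℝ × EuclideanSpace ℝ (Fin n) | x.2 ∈ U ∧ 0 < (G x.2).det} := fun y hy => ⟨hy, hpos y hy⟩
  have hc : ContDiffOn ℝ ∞ (fun y : EuclideanSpace ℝ (Fin n) => ((0 : ℝ), y)) U :=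
    (contDiff_const.prodMk contDiff_id).contDiffOn
  have key : ∀ {f : EuclideanSpace ℝ (Fin n) → ℝ}
      {a : smoothAlg {x : ℝ × EuclideanSpace ℝ (Fin n) | x.2 ∈ U ∧ 0 < (G x.2).det}},
      Represents (fun x : ℝ × EuclideanSpace ℝ (Fin n) => f x.2) a → ContDiffOn ℝ ∞ f U :=
    fun ha => ha.contDiffOn.comp hc hm
  exact ⟨key (hF.rep_normSq (T := fun _ => ric G) hF.rep_ric), key hF.rep_scal⟩

theorem pairing_zero (G : EuclideanSpace ℝ (Fin n) → Matrix (Fin n) (Fin n) ℝ)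
    (S : Fin n → Fin n → ℝ) (y : EuclideanSpace ℝ (Fin n)) :
    pairing G S (0 : Matrix (Fin n) (Fin n) ℝ) y = 0 := by
  simp [pairing]

theorem firstVar_eq_zero (hU : IsOpen U) (hG : LocalTensor U G) (hpos : ∀ y ∈ U, 0 < (G y).det)
    (hH : LocalTensor U H) (t : ℝ) {y : EuclideanSpace ℝ (Fin n)} (hy : y ∈ U)
    (h0 : H =ᶠ[𝓝 y] 0) : firstVar t G H y = 0 := by
  obtain ⟨V, -, hV0, hV⟩ := exists_divergence hU hG hpos hH t
  have h1 := hV y hy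
  have h2 : ∀ i, pd i (V i) y = 0 := fun i => by
    have : V i =ᶠ[𝓝 y] fun _ => (0 : ℝ) := by
      filter_upwards [h0.eventuallyEq_nhds] with z hz
      exact hV0 i z fun _ => hz
    rw [pd, this.fderiv_eq]
    simp
  rw [h0.eq_of_nhds, Pi.zero_apply, pairing_zero] at h1
  simp only [h2, Finset.sum_const_zero, mul_zero, add_zero] at h1
  linarith

/-- Differentiation under the integral sign; compactness of `C` provides a parameter interval with a
uniform bound. The set `S` is merely measurable, as the pieces of a compact set of the manifold will
be. -/
theorem hasDerivAt_integral_density (hU : IsOpen U) (hG : LocalTensor U G)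
    (hpos : ∀ y ∈ U, 0 < (G y).det) (hH : LocalTensor U H) (t : ℝ)
    {C S : Set (EuclideanSpace ℝ (Fin n))} (hC : IsCompact C) (hCU : C ⊆ U) (hSC : S ⊆ C)
    (hS : MeasurableSet S) :
    IntegrableOn (firstVar t G H) S ∧
    HasDerivAt (fun s : ℝ => ∫ y in S, density t (fun z => G z + s • H z) y)
      (∫ y in S, firstVar t G H y) 0 := by
  have hF := hG.metricFamily_line hU hH
  set W := {x : ℝ × EuclideanSpace ℝ (Fin n) | x.2 ∈ U ∧ 0 < (G x.2 + x.1 • H x.2).det}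
  set Φ : ℝ × EuclideanSpace ℝ (Fin n) → ℝ := fun x => density t (fun z => G z + x.1 • H z) x.2
  have hΦ : ContDiffOn ℝ ∞ Φ W := hF.contDiffOn_density t
  set Φ' : ℝ × EuclideanSpace ℝ (Fin n) → ℝ := fun x => fderiv ℝ Φ x (1, 0)
  have hΦ' : ContinuousOn Φ' W := (contDiffOn_fderiv_apply hF.isOpen hΦ _).continuousOn
  have h0W : ∀ y ∈ C, ((0 : ℝ), y) ∈ W := fun y hy =>
    ⟨hCU hy, by simpa using hpos y (hCU hy)⟩
  have hcont : ∀ {f : ℝ × EuclideanSpace ℝ (Fin n) → ℝ} {s : ℝ}, ContinuousOn f W →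
      (∀ y ∈ C, (s, y) ∈ W) → ContinuousOn (fun y => f (s, y)) C := fun hf hs =>
    hf.comp (by fun_prop) hs
  have hfirst : ∀ y ∈ C, firstVar t G H y = Φ' (0, y) := fun y hy =>
    (hasDerivAt_density hU hG hH t (hCU hy) (h0W y hy).2).deriv
  have hint : ∀ {f : EuclideanSpace ℝ (Fin n) → ℝ}, ContinuousOn f C → IntegrableOn f S :=
    fun hf => (hf.integrableOn_compact hC).mono_set hSC
  obtain ⟨B, hB⟩ := hC.exists_bound_of_continuousOn (hcont hΦ' h0W)
  -- A bound `B` at parameter zero persists nearby only with some room, hence `B + 1`.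
  have hev : ∀ᶠ s : ℝ in 𝓝 0, ∀ y ∈ C, (s, y) ∈ W ∧ ‖Φ' (s, y)‖ < B + 1 := by
    refine hC.eventually_forall_of_forall_eventually
      (P := fun s y => (s, y) ∈ W ∧ ‖Φ' (s, y)‖ < B + 1) fun y hy => ?_
    have hn := hF.isOpen.mem_nhds (h0W y hy)
    have h1 : ∀ᶠ z in 𝓝 ((0 : ℝ), y), ‖Φ' z‖ < B + 1 :=
      (hΦ'.continuousAt hn).norm.eventually_lt continuousAt_const
        ((hB y hy).trans_lt (lt_add_one B))
    filter_upwards [hn, h1] with z hz1 hz2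
    exact ⟨hz1, hz2⟩
  have hfs : IntegrableOn (firstVar t G H) S :=
    (hint (hcont hΦ' h0W)).congr_fun (fun y hy => (hfirst y (hSC hy)).symm) hS
  refine ⟨hfs, ?_⟩
  have hd := (hasDerivAt_integral_of_dominated_loc_of_deriv_le (μ := volume.restrict S)
    (F := fun s y => Φ (s, y)) (F' := fun s y => Φ' (s, y)) (bound := fun _ => B + 1) hev
    (by
      filter_upwards [hev] with s hs
      exact ((hcont hΦ.continuousOn fun y hy => (hs y hy).1).mono hSC).aestronglyMeasurable hS)
    (hint (hcont hΦ.continuousOn h0W))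
    (((hcont hΦ' h0W).mono hSC).aestronglyMeasurable hS)
    (by
      refine (ae_restrict_iff' hS).2 (Filter.Eventually.of_forall fun y hy s hs => ?_)
      exact (hs y (hSC hy)).2.le)
    (by
      have : IsFiniteMeasure (volume.restrict S) :=
        ⟨by rw [Measure.restrict_apply_univ]; exact (measure_mono hSC).trans_lt hC.measure_lt_top⟩
      exact integrable_const _)
    (by
      refine (ae_restrict_iff' hS).2 (Filter.Eventually.of_forall fun y hy s hs => ?_)
      exact hasDerivAt_density hU hG hH t (hCU (hSC hy)) (hs y (hSC hy)).1.2)).2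
  rw [setIntegral_congr_fun hS fun y hy => hfirst y (hSC hy)]
  exact hd

end LocalVariation

/-! ### The functionals as integrals of one Lagrangian -/

section Energy

variable {n : ℕ} {M : Type*} [TopologicalSpace M] [ChartedSpace (EuclideanSpace ℝ (Fin n)) M]
  [MeasurableSpace M]

/-- The integrand of the functional `𝓕_t`. -/
def lagr (t : ℝ) (g : TwoTensor n M) (p : M) : ℝ := ricNormSq g p + t * scalarCurvature g p ^ 2

/-- The functional `𝓕_t` as a single integral. -/
def energy (t : ℝ) (g : TwoTensor n M) (A : Set M) : ℝ := ∫ p in A, lagr t g p ∂(volumeMeasure g)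

/-- Integrability of the two terms of `𝓕_t`. -/
def IsIntegrableOn (g : TwoTensor n M) (A : Set M) : Prop :=
  IntegrableOn (ricNormSq g) A (volumeMeasure g) ∧
    IntegrableOn (fun p => scalarCurvature g p ^ 2) A (volumeMeasure g)

theorem IsIntegrableOn.lagr {g : TwoTensor n M} {A : Set M} (h : IsIntegrableOn g A) (t : ℝ) :
    IntegrableOn (lagr t g) A (volumeMeasure g) := h.1.add (h.2.const_mul t)

theorem IsIntegrableOn.functionalF_eq {g : TwoTensor n M} {A : Set M} (h : IsIntegrableOn g A)
    (t : ℝ) : functionalF t g A = energy t g A := by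
  rw [functionalF, energy, ← integral_const_mul]
  exact (integral_add h.1 (h.2.const_mul t)).symm

theorem IsIntegrableOn.energy_union {g : TwoTensor n M} {A B : Set M} (hA : IsIntegrableOn g A)
    (hB : IsIntegrableOn g B) (hAB : Disjoint A B) (hBm : MeasurableSet B) (t : ℝ) :
    energy t g (A ∪ B) = energy t g A + energy t g B :=
  setIntegral_union hAB hBm (hA.lagr t) (hB.lagr t)

variable [IsManifold (𝓡 n) ∞ M]

theorem IsMetric.continuousOn_curvature {g : TwoTensor n M} (hg : IsMetric g) (c : M) :
    ContinuousOn (ricNormSq g) (extChartAt (𝓡 n) c).source ∧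
      ContinuousOn (scalarCurvature g) (extChartAt (𝓡 n) c).source := by
  obtain ⟨h1, h2⟩ := contDiffOn_curvature (isOpen_extChartAt_target c) (hg.localTensor c)
    fun y hy => hg.det_pos c hy
  have hm : Set.MapsTo (extChartAt (𝓡 n) c) (extChartAt (𝓡 n) c).source
    (extChartAt (𝓡 n) c).target := fun p hp => (extChartAt (𝓡 n) c).map_source hp
  exact ⟨(h1.continuousOn.comp (continuousOn_extChartAt c) hm).congr fun p hp =>
      (hg.curvature_eq c hp).1,
    (h2.continuousOn.comp (continuousOn_extChartAt c) hm).congr fun p hp =>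
      (hg.curvature_eq c hp).2⟩

variable [BorelSpace M] [SecondCountableTopology M]

theorem IsMetric.energy_eq {g : TwoTensor n M} (hg : IsMetric g) (t : ℝ) {c : M} {A : Set M}
    (hA : MeasurableSet A) (hc : A ⊆ (extChartAt (𝓡 n) c).source) :
    energy t g A = ∫ y in chartImage c A, density t (g.coeff c) y := by
  obtain ⟨h1, h2⟩ := hg.continuousOn_curvature c
  have h0 : ContinuousOn (lagr t g) (extChartAt (𝓡 n) c).source :=
    h1.add ((h2.pow 2).const_mul t)
  rw [energy, setIntegral_volumeMeasure (hg.localTensor c).continuousOn_det hA hc h0]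
  refine setIntegral_congr_fun (measurableSet_chartImage c hA) fun y hy => ?_
  obtain ⟨h3, h4⟩ := hg.curvature_eq c ((extChartAt (𝓡 n) c).map_target hy.1)
  rw [(extChartAt (𝓡 n) c).right_inv hy.1] at h3 h4
  simp only [lagr, h3, h4, density, lagrangian]

theorem IsMetric.isIntegrableOn {g : TwoTensor n M} (hg : IsMetric g) {c : M} {A C : Set M}
    (hA : MeasurableSet A) (hAC : A ⊆ C) (hC : IsCompact C)
    (hCc : C ⊆ (extChartAt (𝓡 n) c).source) : IsIntegrableOn g A := by
  obtain ⟨h1, h2⟩ := hg.continuousOn_curvature c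
  have hdet := (hg.localTensor c).continuousOn_det
  have key : ∀ {f : M → ℝ}, ContinuousOn f (extChartAt (𝓡 n) c).source →
      IntegrableOn f A (volumeMeasure g) := fun {f} hf => by
    refine integrableOn_volumeMeasure hdet hA (hAC.trans hCc) hf ?_
    have hcomp : ContinuousOn (fun y => √(g.coeff c y).det * f ((extChartAt (𝓡 n) c).symm y))
        (chartImage c C) :=
      (hdet.mono Set.inter_subset_left).sqrt.mul (hf.comp
        ((continuousOn_extChartAt_symm c).mono Set.inter_subset_left)
          fun y hy => (extChartAt (𝓡 n) c).map_target hy.1)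
    exact (hcomp.integrableOn_compact (isCompact_chartImage hC hCc)).mono_set
      fun y hy => ⟨hy.1, hAC hy.2⟩
  exact ⟨key h1, key (h2.pow 2)⟩

end Energy

/-! ### Differentiability, additivity and locality of the energy -/

section FirstVariation

variable {n : ℕ} {M : Type*} [TopologicalSpace M] [ChartedSpace (EuclideanSpace ℝ (Fin n)) M]
  [MeasurableSpace M] [IsManifold (𝓡 n) ∞ M] [BorelSpace M] [SecondCountableTopology M]

/-- The energy along a variation. -/
def energyLine (t : ℝ) (g h : TwoTensor n M) (A : Set M) (s : ℝ) : ℝ :=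
  energy t (fun p => g p + s • h p) A

theorem hasDerivAt_energyLine {g h : TwoTensor n M} (hg : IsMetric g) {K : Set M}
    (hK : IsCompact K) (hh : IsVariation K h) (t : ℝ) {c : M} {A C : Set M}
    (hA : MeasurableSet A) (hAC : A ⊆ C) (hC : IsCompact C)
    (hCc : C ⊆ (extChartAt (𝓡 n) c).source) :
    IntegrableOn (firstVar t (g.coeff c) (h.coeff c)) (chartImage c A) ∧
    HasDerivAt (energyLine t g h A)
      (∫ y in chartImage c A, firstVar t (g.coeff c) (h.coeff c) y) 0 := by
  obtain ⟨h1, h2⟩ := hasDerivAt_integral_density (isOpen_extChartAt_target c) (hg.localTensor c)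
    (fun y hy => hg.det_pos c hy) (hh.localTensor c) t (isCompact_chartImage hC hCc)
    Set.inter_subset_left (fun y hy => ⟨hy.1, hAC hy.2⟩) (measurableSet_chartImage c hA)
  refine ⟨h1, h2.congr_of_eventuallyEq ?_⟩
  filter_upwards [hg.eventually_line hK hh] with s hs
  rw [energyLine, hs.energy_eq t hA (hAC.trans hCc), coeff_line]

/-- The energy of the set `A` is defined and depends differentiably on the metric, with a local
linear derivative. -/
structure IsRegular (t : ℝ) (g : TwoTensor n M) (K A : Set M) : Prop where
  integrable : ∀ g' : TwoTensor n M, IsMetric g' → IsIntegrableOn g' A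
  differentiable : ∀ h, IsVariation K h → DifferentiableAt ℝ (energyLine t g h A) 0
  additive : ∀ h h', IsVariation K h → IsVariation K h' →
    deriv (energyLine t g (fun p => h p + h' p) A) 0 =
      deriv (energyLine t g h A) 0 + deriv (energyLine t g h' A) 0
  local_zero : ∀ h, IsVariation K h → (∀ p ∈ A, ∀ᶠ q in 𝓝 p, ∀ v w, h q v w = 0) →
    deriv (energyLine t g h A) 0 = 0

theorem isRegular_of_chart {g : TwoTensor n M} (hg : IsMetric g) {K : Set M}
    (hK : IsCompact K) (t : ℝ) {c : M} {A C : Set M}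
    (hA : MeasurableSet A) (hAC : A ⊆ C) (hC : IsCompact C)
    (hCc : C ⊆ (extChartAt (𝓡 n) c).source) : IsRegular t g K A where
  integrable g' hg' := hg'.isIntegrableOn hA hAC hC hCc
  differentiable h hh := (hasDerivAt_energyLine hg hK hh t hA hAC hC hCc).2.differentiableAt
  additive h h' hh hh' := by
    obtain ⟨i1, d1⟩ := hasDerivAt_energyLine hg hK hh t hA hAC hC hCc
    obtain ⟨i2, d2⟩ := hasDerivAt_energyLine hg hK hh' t hA hAC hC hCc
    obtain ⟨-, d3⟩ := hasDerivAt_energyLine hg hK (hh.add hh') t hA hAC hC hCc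
    rw [d1.deriv, d2.deriv, d3.deriv, ← integral_add i1 i2, coeff_add]
    refine setIntegral_congr_fun (measurableSet_chartImage c hA) fun y hy => ?_
    exact firstVar_add (isOpen_extChartAt_target c) (hg.localTensor c) (hh.localTensor c)
      (hh'.localTensor c) t hy.1 (hg.det_pos c hy.1)
  local_zero h hh h0 := by
    obtain ⟨-, d⟩ := hasDerivAt_energyLine hg hK hh t hA hAC hC hCc
    rw [d.deriv]
    refine setIntegral_eq_zero_of_forall_eq_zero fun y hy => ?_
    refine firstVar_eq_zero (isOpen_extChartAt_target c) (hg.localTensor c)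
      (fun y hy => hg.det_pos c hy) (hh.localTensor c) t hy.1 ?_
    have hc : ContinuousAt (extChartAt (𝓡 n) c).symm y :=
      (continuousOn_extChartAt_symm c).continuousAt ((isOpen_extChartAt_target c).mem_nhds hy.1)
    filter_upwards [hc.eventually (h0 _ hy.2)] with z hz
    exact Matrix.ext fun i j => hz _ _

theorem IsRegular.union {t : ℝ} {g : TwoTensor n M} {K A B : Set M} (hg : IsMetric g)
    (hK : IsCompact K) (hA : IsRegular t g K A)
    (hB : IsRegular t g K B) (hAB : Disjoint A B) (hBm : MeasurableSet B) :
    IsRegular t g K (A ∪ B) := by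
  have hsum : ∀ h, IsVariation K h → energyLine t g h (A ∪ B) =ᶠ[𝓝 0]
      fun s => energyLine t g h A s + energyLine t g h B s := fun h hh => by
    filter_upwards [hg.eventually_line hK hh] with s hs
    exact (hA.integrable _ hs).energy_union (hB.integrable _ hs) hAB hBm t
  have hd : ∀ h, IsVariation K h → HasDerivAt (energyLine t g h (A ∪ B))
      (deriv (energyLine t g h A) 0 + deriv (energyLine t g h B) 0) 0 := fun h hh =>
    ((hA.differentiable h hh).hasDerivAt.add
      (hB.differentiable h hh).hasDerivAt).congr_of_eventuallyEq (hsum h hh)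
  refine ⟨fun g' hg' => ⟨(hA.integrable g' hg').1.union (hB.integrable g' hg').1,
    (hA.integrable g' hg').2.union (hB.integrable g' hg').2⟩,
    fun h hh => (hd h hh).differentiableAt, fun h h' hh hh' => ?_, fun h hh h0 => ?_⟩
  · rw [(hd _ hh).deriv, (hd _ hh').deriv, (hd _ (hh.add hh')).deriv, hA.additive h h' hh hh',
      hB.additive h h' hh hh']
    ring
  · rw [(hd _ hh).deriv, hA.local_zero h hh fun p hp => h0 p (Or.inl hp),
      hB.local_zero h hh fun p hp => h0 p (Or.inr hp), add_zero]

/-- Finitely many compact sets inside chart domains cover `K`; their pieces are split off one at a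
time, and regularity passes to disjoint unions. -/
theorem isRegular_of_subset [T2Space M] {g : TwoTensor n M} (hg : IsMetric g) {K : Set M}
    (hK : IsCompact K) (t : ℝ) {A : Set M} (hA : MeasurableSet A) (hAK : A ⊆ K) :
    IsRegular t g K A := by
  classical
  have : LocallyCompactSpace M := ChartedSpace.locallyCompactSpace (EuclideanSpace ℝ (Fin n)) M
  have hC : ∀ p : M, ∃ C, IsCompact C ∧ C ∈ 𝓝 p ∧ C ⊆ (extChartAt (𝓡 n) p).source := fun p => by
    obtain ⟨C, h1, h2, h3⟩ := local_compact_nhds (extChartAt_source_mem_nhds (I := 𝓡 n) p)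
    exact ⟨C, h3, h1, h2⟩
  choose C hCc hCn hCs using hC
  obtain ⟨F, -, hF⟩ := hK.elim_nhds_subcover C fun p _ => hCn p
  have key : ∀ F : Finset M, ∀ A : Set M, MeasurableSet A → A ⊆ ⋃ p ∈ F, C p →
      IsRegular t g K A := by
    intro F
    induction F using Finset.induction_on with
    | empty =>
      intro A hA hAF
      have hA0 : A = ∅ := by simpa using hAF
      subst hA0
      have he : ∀ h, energyLine t g h ∅ = fun _ => 0 := fun h => by
        ext s; simp [energyLine, energy]
      exact ⟨fun _ _ => ⟨integrableOn_empty, integrableOn_empty⟩, fun h _ => by rw [he]; simp,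
        fun h h' _ _ => by simp [he], fun h _ _ => by simp [he]⟩
    | insert p F hp ih =>
      intro A hA hAF
      have hCm : MeasurableSet (C p) := (hCc p).isClosed.measurableSet
      rw [← Set.inter_union_sdiff A (C p)]
      refine (isRegular_of_chart hg hK t (hA.inter hCm) Set.inter_subset_right (hCc p)
        (hCs p)).union hg hK (ih _ (hA.diff hCm) fun q hq => ?_) Set.disjoint_sdiff_inter.symm
        (hA.diff hCm)
      have := hAF hq.1
      rw [Finset.set_biUnion_insert] at this
      exact this.resolve_left hq.2
  exact key F A hA (hAK.trans hF)

end FirstVariation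

/-! ### Symmetry of the gradient -/

namespace MetricAlg

variable {n : ℕ} {A : Type*} [CommRing A] [Algebra ℝ A] (X : MetricAlg n A)

theorem hess_comm (f : A) (i j : Fin n) : X.hess f i j = X.hess f j i := by
  simp only [hess, cov1, act, X.D_comm i j]
  congr 1
  exact Finset.sum_congr rfl fun m _ => by rw [X.torsion]

theorem lap2_comm {T : Fin n → Fin n → A} (hT : ∀ i j, T i j = T j i) (i j : Fin n) :
    X.lap2 T i j = X.lap2 T j i := by
  have h2 : ∀ k i j, X.cov2 k T i j = X.cov2 k T j i := fun k i j => by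
    have : T = fun i j => T j i := by ext i j; exact hT i j
    conv_lhs => rw [this]
    simp only [cov2]; ring
  have h3 : ∀ F : Fin n → Fin n → Fin n → A, (∀ k i j, F k i j = F k j i) → ∀ l k i j,
      X.cov3 l F k i j = X.cov3 l F k j i := fun F hF l k i j => by
    have : F = fun k i j => F k j i := by ext k i j; exact hF k i j
    conv_lhs => rw [this]
    simp only [cov3]; ring
  rw [lap2, lap2]
  congr 1
  ext k l
  exact h3 _ h2 l k i j

theorem rmC_comm {T : Fin n → Fin n → A} (hT : ∀ i j, T i j = T j i) (i j : Fin n) :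
    X.rmC T i j = X.rmC T j i := by
  rw [rmC, rmC, X.tr2_comm]
  congr 1; ext l q
  congr 1; ext k p
  rw [X.riem_pair i k j l, hT]

/-- Variations are symmetric, so they detect only the symmetric part of the gradient. -/
theorem grad_comm (τ : A) (i j : Fin n) : X.grad τ i j = X.grad τ j i := by
  rw [grad, grad, X.hess_comm _ i j, X.lap2_comm X.ric_comm i j, X.rmC_comm X.ric_comm i j,
    X.ric_comm i j, X.G_comm i j]

end MetricAlg

/-! ### Integration by parts and test matrices in coordinates -/

section LocalIntegration

variable {n : ℕ} {U : Set (EuclideanSpace ℝ (Fin n))}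
  {G H : EuclideanSpace ℝ (Fin n) → Matrix (Fin n) (Fin n) ℝ}

theorem gradient_comm (hU : IsOpen U) (hG : LocalTensor U G) (t : ℝ)
    {y : EuclideanSpace ℝ (Fin n)} (hy : y ∈ U) (hpos : 0 < (G y).det) (i j : Fin n) :
    gradient t G i j y = gradient t G j i y := by
  have hF := hG.metricFamily hU ℝ
  have hm : ((0 : ℝ), y) ∈ {x : ℝ × EuclideanSpace ℝ (Fin n) | x.2 ∈ U ∧ 0 < (G x.2).det} :=
    ⟨hy, hpos⟩
  have h1 := hF.rep_grad t i j _ hm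
  rw [MetricAlg.grad_comm] at h1
  exact h1.symm.trans (hF.rep_grad t j i _ hm)

theorem contDiffOn_pairing_gradient (hU : IsOpen U) (hG : LocalTensor U G)
    (hpos : ∀ y ∈ U, 0 < (G y).det) (t : ℝ) (B : Matrix (Fin n) (Fin n) ℝ) :
    ContDiffOn ℝ ∞ (fun y => pairing G (fun i j => gradient t G i j y) B y) U := by
  have hF := hG.metricFamily hU ℝ
  have hm : Set.MapsTo (fun y => ((0 : ℝ), y)) U
    {x : ℝ × EuclideanSpace ℝ (Fin n) | x.2 ∈ U ∧ 0 < (G x.2).det} := fun y hy => ⟨hy, hpos y hy⟩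
  have hc : ContDiffOn ℝ ∞ (fun y : EuclideanSpace ℝ (Fin n) => ((0 : ℝ), y)) U :=
    (contDiff_const.prodMk contDiff_id).contDiffOn
  have key : ∀ {f : EuclideanSpace ℝ (Fin n) → ℝ}
      {a : smoothAlg {x : ℝ × EuclideanSpace ℝ (Fin n) | x.2 ∈ U ∧ 0 < (G x.2).det}},
      Represents (fun x : ℝ × EuclideanSpace ℝ (Fin n) => f x.2) a → ContDiffOn ℝ ∞ f U :=
    fun ha => ha.contDiffOn.comp hc hm
  have h1 : ∀ i j, ContDiffOn ℝ ∞ (fun y => (G y)⁻¹ i j) U := fun i j => key (hF.rep_Gi i j)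
  have h2 : ∀ i j, ContDiffOn ℝ ∞ (fun y => gradient t G i j y) U :=
    fun i j => key (hF.rep_grad t i j)
  unfold pairing
  exact ContDiffOn.sum fun i _ => ContDiffOn.sum fun k _ => (h1 i k).mul
    (ContDiffOn.sum fun j _ => ContDiffOn.sum fun l _ => (h1 j l).mul
      ((h2 i j).mul contDiffOn_const))

theorem pairing_smul_right (G : EuclideanSpace ℝ (Fin n) → Matrix (Fin n) (Fin n) ℝ)
    (S : Fin n → Fin n → ℝ) (c : ℝ) (B : Matrix (Fin n) (Fin n) ℝ)
    (y : EuclideanSpace ℝ (Fin n)) : pairing G S (c • B) y = c * pairing G S B y := by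
  simp only [pairing, Finset.mul_sum, Matrix.smul_apply, smul_eq_mul]
  exact Finset.sum_congr rfl fun _ _ => Finset.sum_congr rfl fun _ _ => Finset.sum_congr rfl
    fun _ _ => Finset.sum_congr rfl fun _ _ => by ring

/-- The symmetric product of two coordinates. -/
def symMatrix (a b : Fin n) : Matrix (Fin n) (Fin n) ℝ :=
  Matrix.single a b 1 + Matrix.single b a 1

/-- With `P` denoting `S` with raised indices, the test matrices give $P_{ab}+P_{ba}=2P_{ab}$;
lowering the indices again recovers `S`. -/
theorem eq_zero_of_pairing {y : EuclideanSpace ℝ (Fin n)} (hdet : 0 < (G y).det)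
    (hsymm : (G y)ᵀ = G y) {S : Fin n → Fin n → ℝ} (hS : ∀ i j, S i j = S j i)
    (h : ∀ a b, pairing G S (symMatrix a b) y = 0) (i j : Fin n) : S i j = 0 := by
  have hu : IsUnit (G y).det := hdet.ne'.isUnit
  have hi : ((G y)⁻¹)ᵀ = (G y)⁻¹ := by rw [Matrix.transpose_nonsing_inv, hsymm]
  set P := (G y)⁻¹ * Matrix.of S * (G y)⁻¹ with hP
  have hPs : Pᵀ = P := by
    have : (Matrix.of S)ᵀ = Matrix.of S := Matrix.ext fun i j => hS j i
    rw [hP, Matrix.transpose_mul, Matrix.transpose_mul, hi, this, mul_assoc]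
  have hPp : ∀ B : Matrix (Fin n) (Fin n) ℝ, pairing G S B y = ∑ k, ∑ l, P k l * B k l := by
    intro B
    unfold pairing
    rw [Finset.sum_comm]
    refine Finset.sum_congr rfl fun k _ => ?_
    simp only [hP, Matrix.mul_apply, Matrix.of_apply, Finset.mul_sum, Finset.sum_mul]
    rw [Finset.sum_congr rfl fun i _ => Finset.sum_comm, Finset.sum_comm]
    refine Finset.sum_congr rfl fun l _ => ?_
    rw [Finset.sum_comm]
    refine Finset.sum_congr rfl fun j _ => Finset.sum_congr rfl fun i _ => ?_
    have : (G y)⁻¹ i k = (G y)⁻¹ k i := congrFun (congrFun hi k) i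
    rw [this]
    ring
  have hP0 : P = 0 := by
    ext a b
    have h1 := h a b
    rw [hPp] at h1
    simp only [symMatrix, Matrix.add_apply, Matrix.single_apply, mul_add,
      Finset.sum_add_distrib, mul_ite, mul_one, mul_zero, ite_and] at h1
    simp only [Finset.sum_ite_eq, Finset.sum_ite_irrel, Finset.sum_const_zero, Finset.mem_univ,
      if_true] at h1
    have h2 : P b a = P a b := congrFun (congrFun hPs a) b
    rw [h2] at h1
    change P a b = 0
    linarith
  have : Matrix.of S = G y * P * G y := by
    rw [hP]
    calc Matrix.of S = (G y * (G y)⁻¹) * Matrix.of S * ((G y)⁻¹ * G y) := by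
          rw [Matrix.mul_nonsing_inv _ hu, Matrix.nonsing_inv_mul _ hu, one_mul, mul_one]
      _ = _ := by noncomm_ring
  have h3 := congrFun (congrFun this i) j
  rw [hP0] at h3
  simpa using h3

/-- Integration by parts against the constant function one. -/
theorem integral_pd_eq_zero {f : EuclideanSpace ℝ (Fin n) → ℝ} (hf : ContDiff ℝ ∞ f)
    (hc : HasCompactSupport f) (i : Fin n) : ∫ y, pd i f y = 0 := by
  have h1 := integral_mul_fderiv_eq_neg_fderiv_mul_of_integrable (μ := volume)
    (f := fun _ : EuclideanSpace ℝ (Fin n) => (1 : ℝ)) (g := f) (v := EuclideanSpace.single i 1)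
    (by simp)
    (by
      simp only [one_mul]
      exact ((hf.continuous_fderiv (by simp)).clm_apply
        continuous_const).integrable_of_hasCompactSupport (hc.fderiv_apply ℝ _))
    (by simpa using hf.continuous.integrable_of_hasCompactSupport hc)
    (fun _ _ => differentiableAt_const _) (fun x _ => hf.differentiable (by simp) x)
  simpa [pd] using h1

/-- The field `V` vanishes off `S` together with `H`, hence is smooth with compact support on the
whole space, and its divergence integrates to zero. -/
theorem integral_firstVar (hU : IsOpen U) (hG : LocalTensor U G) (hpos : ∀ y ∈ U, 0 < (G y).det)
    (hH : LocalTensor U H) (t : ℝ) {S : Set (EuclideanSpace ℝ (Fin n))} (hS : IsCompact S)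
    (hSU : S ⊆ U) (h0 : ∀ y ∈ U, y ∉ S → H y = 0) :
    2 * ∫ y in S, firstVar t G H y =
      ∫ y in S, √(G y).det * pairing G (fun i j => gradient t G i j y) (H y) y := by
  obtain ⟨V, hVs, hV0, hV⟩ := exists_divergence hU hG hpos hH t
  have hout : ∀ i, ∀ y, y ∉ S → V i y = 0 := fun i y hy => hV0 i y fun hyU => by
    filter_upwards [hU.mem_nhds hyU, hS.isClosed.isOpen_compl.mem_nhds hy] with z hz hz'
    exact h0 z hz hz'
  have hVc : ∀ i, HasCompactSupport (V i) := fun i =>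
    HasCompactSupport.intro hS fun y hy => hout i y hy
  have hVd : ∀ i, ContDiff ℝ ∞ (V i) := fun i => contDiff_iff_contDiffAt.2 fun y => by
    by_cases hy : y ∈ S
    · exact (hVs i).contDiffAt (hU.mem_nhds (hSU hy))
    · have : V i =ᶠ[𝓝 y] fun _ => 0 := by
        filter_upwards [hS.isClosed.isOpen_compl.mem_nhds hy] with z hz
        exact hout i z hz
      exact contDiffAt_const.congr_of_eventuallyEq this
  have hpdc : ∀ i, Continuous (pd i (V i)) := fun i =>
    ((hVd i).continuous_fderiv (by simp)).clm_apply continuous_const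
  have hpd0 : ∀ i, ∫ y in S, pd i (V i) y = 0 := fun i => by
    rw [setIntegral_eq_integral_of_forall_compl_eq_zero, integral_pd_eq_zero (hVd i) (hVc i)]
    intro y hy
    have : V i =ᶠ[𝓝 y] fun _ => (0 : ℝ) := by
      filter_upwards [hS.isClosed.isOpen_compl.mem_nhds hy] with z hz
      exact hout i z hz
    rw [pd, this.fderiv_eq]
    simp
  have hSm := hS.isClosed.measurableSet
  have hi1 : IntegrableOn (firstVar t G H) S :=
    (hasDerivAt_integral_density hU hG hpos hH t hS hSU subset_rfl hSm).1
  have hi2 : ∀ i, IntegrableOn (pd i (V i)) S := fun i =>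
    ((hpdc i).integrable_of_hasCompactSupport ((hVc i).fderiv_apply ℝ _)).integrableOn
  rw [← integral_const_mul]
  have e1 : ∫ y in S, √(G y).det * pairing G (fun i j => gradient t G i j y) (H y) y =
      ∫ y in S, (2 * firstVar t G H y - ∑ i, pd i (V i) y) :=
    setIntegral_congr_fun hSm fun y hy => by
      simp only [hV y (hSU hy)]; ring
  rw [e1, integral_sub (hi1.const_mul 2) (integrable_finsetSum _ fun i _ => hi2 i),
    integral_finsetSum _ fun i _ => hi2 i]
  simp [hpd0]

end LocalIntegration

/-! ### Test variations supported in one chart -/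

section BumpVariation

variable {n : ℕ} {M : Type*} [TopologicalSpace M] [ChartedSpace (EuclideanSpace ℝ (Fin n)) M]

/-- The bilinear form with matrix `symMatrix a b`. -/
def symForm (a b : Fin n) :
    EuclideanSpace ℝ (Fin n) →L[ℝ] EuclideanSpace ℝ (Fin n) →L[ℝ] ℝ :=
  (coordinate a).smulRight (coordinate b) + (coordinate b).smulRight (coordinate a)

theorem symForm_single (a b i j : Fin n) :
    symForm a b (EuclideanSpace.single i 1) (EuclideanSpace.single j 1) = symMatrix a b i j := by
  have hc : ∀ a i : Fin n, coordinate a (EuclideanSpace.single i 1) = if a = i then 1 else 0 :=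
    fun a i => by simp [coordinate]
  simp only [symForm, symMatrix, ContinuousLinearMap.add_apply,
    ContinuousLinearMap.smulRight_apply, ContinuousLinearMap.smul_apply, smul_eq_mul,
    Matrix.add_apply, Matrix.single_apply, hc, ite_and, ite_mul, one_mul, zero_mul]

theorem symMatrix_transpose (a b : Fin n) : (symMatrix a b)ᵀ = symMatrix a b := by
  rw [symMatrix, Matrix.transpose_add, Matrix.transpose_single, Matrix.transpose_single, add_comm]

variable [IsManifold (𝓡 n) ∞ M]

/-- The two-tensor with constant components in the chart around `c`. -/
def chartTensor (c : M) (B : EuclideanSpace ℝ (Fin n) →L[ℝ] EuclideanSpace ℝ (Fin n) →L[ℝ] ℝ) :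
    TwoTensor n M := fun p =>
  (trivializationAt (EuclideanSpace ℝ (Fin n) →L[ℝ] EuclideanSpace ℝ (Fin n) →L[ℝ] ℝ)
    (fun p : M => TangentSpace (𝓡 n) p →L[ℝ] TangentSpace (𝓡 n) p →L[ℝ] ℝ) c).symm p B

set_option synthInstance.maxHeartbeats 400000 in
set_option maxHeartbeats 1000000 in
theorem trivialization_chartTensor (c : M)
    (B : EuclideanSpace ℝ (Fin n) →L[ℝ] EuclideanSpace ℝ (Fin n) →L[ℝ] ℝ) {p : M}
    (hp : p ∈ (extChartAt (𝓡 n) c).source) :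
    (trivializationAt (EuclideanSpace ℝ (Fin n) →L[ℝ] EuclideanSpace ℝ (Fin n) →L[ℝ] ℝ)
      (fun p : M => TangentSpace (𝓡 n) p →L[ℝ] TangentSpace (𝓡 n) p →L[ℝ] ℝ) c
        ⟨p, chartTensor c B p⟩).2 = B := by
  have hs : p ∈ (chartAt (EuclideanSpace ℝ (Fin n)) c).source := by
    rwa [← extChartAt_source (𝓡 n)]
  have := Bundle.Trivialization.apply_mk_symm (trivializationAt
    (EuclideanSpace ℝ (Fin n) →L[ℝ] EuclideanSpace ℝ (Fin n) →L[ℝ] ℝ)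
    (fun p : M => TangentSpace (𝓡 n) p →L[ℝ] TangentSpace (𝓡 n) p →L[ℝ] ℝ) c)
    (b := p) (by simpa using hs) B
  exact congrArg Prod.snd this

theorem coeff_chartTensor (c : M) (a b : Fin n) {y : EuclideanSpace ℝ (Fin n)}
    (hy : y ∈ (extChartAt (𝓡 n) c).target) :
    (chartTensor c (symForm a b)).coeff c y = symMatrix a b := by
  ext i j
  rw [coeff_apply _ c hy, trivialization_chartTensor c _ ((extChartAt (𝓡 n) c).map_target hy),
    symForm_single]

set_option synthInstance.maxHeartbeats 400000 in
set_option maxHeartbeats 1000000 in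
theorem contMDiffOn_chartTensor (c : M)
    (B : EuclideanSpace ℝ (Fin n) →L[ℝ] EuclideanSpace ℝ (Fin n) →L[ℝ] ℝ) :
    ContMDiffOn (𝓡 n)
      ((𝓡 n).prod 𝓘(ℝ, EuclideanSpace ℝ (Fin n) →L[ℝ] EuclideanSpace ℝ (Fin n) →L[ℝ] ℝ)) ∞
      (fun p : M => Bundle.TotalSpace.mk'
        (EuclideanSpace ℝ (Fin n) →L[ℝ] EuclideanSpace ℝ (Fin n) →L[ℝ] ℝ)
        (E := fun p : M => TangentSpace (𝓡 n) p →L[ℝ] TangentSpace (𝓡 n) p →L[ℝ] ℝ) p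
        (chartTensor c B p)) (extChartAt (𝓡 n) c).source := by
  have : IsManifold (𝓡 n) 1 M := IsManifold.of_le (n := ∞) (by simp)
  refine (Bundle.Trivialization.contMDiffOn_section_iff (IB := 𝓡 n) (n := ∞) (s := chartTensor c B)
    (trivializationAt
      (EuclideanSpace ℝ (Fin n) →L[ℝ] EuclideanSpace ℝ (Fin n) →L[ℝ] ℝ)
      (fun p : M => TangentSpace (𝓡 n) p →L[ℝ] TangentSpace (𝓡 n) p →L[ℝ] ℝ) c)
    (isOpen_extChartAt_source c) (fun p hp => by
      have hs : p ∈ (chartAt (EuclideanSpace ℝ (Fin n)) c).source := by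
        rwa [← extChartAt_source (𝓡 n)]
      simpa using hs)).2 ?_
  exact (contMDiffOn_const (c := B)).congr fun p hp => trivialization_chartTensor c B hp

/-- A function with compact support in the coordinates, as a function on the manifold. -/
def pullChart (c : M) (φ : EuclideanSpace ℝ (Fin n) → ℝ) : M → ℝ :=
  (extChartAt (𝓡 n) c).source.indicator (φ ∘ extChartAt (𝓡 n) c)

theorem pullChart_symm (c : M) (φ : EuclideanSpace ℝ (Fin n) → ℝ) {y : EuclideanSpace ℝ (Fin n)}
    (hy : y ∈ (extChartAt (𝓡 n) c).target) : pullChart c φ ((extChartAt (𝓡 n) c).symm y) = φ y := by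
  rw [pullChart, Set.indicator_of_mem ((extChartAt (𝓡 n) c).map_target hy), Function.comp_apply,
    (extChartAt (𝓡 n) c).right_inv hy]

theorem support_pullChart (c : M) (φ : EuclideanSpace ℝ (Fin n) → ℝ) :
    Function.support (pullChart c φ) ⊆ (extChartAt (𝓡 n) c).symm '' tsupport φ := by
  intro p hp
  have hps : p ∈ (extChartAt (𝓡 n) c).source := Set.mem_of_indicator_ne_zero hp
  refine ⟨extChartAt (𝓡 n) c p, subset_tsupport _ ?_, (extChartAt (𝓡 n) c).left_inv hps⟩
  rw [Function.mem_support, pullChart, Set.indicator_of_mem hps] at hp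
  exact hp

/-- A bump function times a tensor with constant components in the chart. Its compact support is
closed in the Hausdorff space and lies in the chart domain, so the extension by zero is smooth. -/
theorem exists_bump_variation [T2Space M] (c : M) (a b : Fin n)
    {φ : EuclideanSpace ℝ (Fin n) → ℝ} (hφ : ContDiff ℝ ∞ φ) (hc : HasCompactSupport φ)
    (hs : tsupport φ ⊆ (extChartAt (𝓡 n) c).target) :
    ∃ h : TwoTensor n M, IsVariation ((extChartAt (𝓡 n) c).symm '' tsupport φ) h ∧
      ∀ y ∈ (extChartAt (𝓡 n) c).target, h.coeff c y = φ y • symMatrix a b := by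
  have hK : IsCompact ((extChartAt (𝓡 n) c).symm '' tsupport φ) :=
    hc.isCompact.image_of_continuousOn ((continuousOn_extChartAt_symm c).mono hs)
  have hKs : (extChartAt (𝓡 n) c).symm '' tsupport φ ⊆ (extChartAt (𝓡 n) c).source := by
    rintro _ ⟨y, hy, rfl⟩
    exact (extChartAt (𝓡 n) c).map_target (hs hy)
  refine ⟨fun p => pullChart c φ p • chartTensor c (symForm a b) p, ⟨?_, ?_, ?_⟩, ?_⟩
  · refine ContMDiffOn.smul_section_of_tsupport (u := (extChartAt (𝓡 n) c).source)
      (ψ := pullChart c φ) (s := chartTensor c (symForm a b)) ?_ (isOpen_extChartAt_source c)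
      ((closure_minimal (support_pullChart c φ) hK.isClosed).trans hKs)
      (contMDiffOn_chartTensor c _)
    refine (hφ.contMDiff.comp_contMDiffOn
      ((contMDiffOn_extChartAt (I := 𝓡 n) (n := ∞) (x := c)).mono ?_)).congr fun p hp => ?_
    · rw [extChartAt_source]
    · exact Set.indicator_of_mem hp _
  · intro p v w
    rw [bilin_smul_apply, bilin_smul_apply]
    by_cases hp : p ∈ (extChartAt (𝓡 n) c).source
    · congr 1
      obtain ⟨y, hy, rfl⟩ : ∃ y ∈ (extChartAt (𝓡 n) c).target, (extChartAt (𝓡 n) c).symm y = p :=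
        ⟨_, (extChartAt (𝓡 n) c).map_source hp, (extChartAt (𝓡 n) c).left_inv hp⟩
      obtain ⟨x, rfl⟩ := exists_coordinates c hy v
      obtain ⟨x', rfl⟩ := exists_coordinates c hy w
      refine (apply_sum_coordVec (chartTensor c (symForm a b)) c x x' y).trans
        (Eq.trans ?_ (apply_sum_coordVec (chartTensor c (symForm a b)) c x' x y).symm)
      rw [coeff_chartTensor c a b hy, Finset.sum_comm]
      refine Finset.sum_congr rfl fun i _ => Finset.sum_congr rfl fun j _ => ?_
      have : symMatrix a b j i = symMatrix a b i j :=
        congrFun (congrFun (symMatrix_transpose a b) i) j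
      rw [this]; ring
    · rw [pullChart, Set.indicator_of_notMem hp, zero_mul, zero_mul]
  · intro p hp v w
    rw [bilin_smul_apply, Function.notMem_support.1 fun h => hp (support_pullChart c φ h), zero_mul]
  · intro y hy
    have h1 : TwoTensor.coeff (fun p => pullChart c φ p • chartTensor c (symForm a b) p) c y =
        pullChart c φ ((extChartAt (𝓡 n) c).symm y) • (chartTensor c (symForm a b)).coeff c y := by
      ext i j; rfl
    rw [h1, pullChart_symm c φ hy, coeff_chartTensor c a b hy]

end BumpVariation

/-! ### Critical metrics and the vanishing of the gradient -/

section Stationary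

variable {n : ℕ} {M : Type*} [TopologicalSpace M] [ChartedSpace (EuclideanSpace ℝ (Fin n)) M]
  [MeasurableSpace M] [IsManifold (𝓡 n) ∞ M]

/-- All derivatives of the energy along compactly supported variations vanish. -/
def IsStationary (t : ℝ) (g : TwoTensor n M) : Prop :=
  ∀ K : Set M, IsCompact K → ∀ h, IsVariation K h → deriv (energyLine t g h K) 0 = 0

omit [MeasurableSpace M] in
theorem IsVariation.mono {K K' : Set M} {h : TwoTensor n M} (hh : IsVariation K h) (hK : K ⊆ K') :
    IsVariation K' h := ⟨hh.smooth, hh.symm, fun p hp => hh.zero p fun hp' => hp (hK hp')⟩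

variable [BorelSpace M] [SecondCountableTopology M] [T2Space M]

/-- The energy is always differentiable along a variation, so only the value of the derivative
matters. The functionals need to agree only on metrics, since $g+sh$ is one for small $s$. The
factor `a` covers both functionals. -/
theorem isCritical_iff_isStationary {F : TwoTensor n M → Set M → ℝ} {a t : ℝ} (ha : a ≠ 0)
    (hF : ∀ g' : TwoTensor n M, IsMetric g' → ∀ K, IsCompact K → F g' K = a * energy t g' K)
    {g : TwoTensor n M} (hg : IsMetric g) : IsCritical F g ↔ IsStationary t g := by
  have key : ∀ K, IsCompact K → ∀ h, IsVariation K h →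
      HasDerivAt (fun s : ℝ => F (fun p => g p + s • h p) K)
        (a * deriv (energyLine t g h K) 0) 0 := fun K hK h hh => by
    have h1 := ((isRegular_of_subset hg hK t hK.isClosed.measurableSet
      subset_rfl).differentiable h hh).hasDerivAt.const_mul a
    refine h1.congr_of_eventuallyEq ?_
    filter_upwards [hg.eventually_line hK hh] with s hs
    exact hF _ hs K hK
  constructor
  · intro hcrit K hK h hh
    have h1 := hcrit h hh.smooth hh.symm K hK fun p hp => bilin_ext fun v w => hh.zero p hp v w
    exact (mul_eq_zero.1 ((key K hK h hh).unique h1)).resolve_left ha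
  · intro hst h hs hsymm K hK h0
    have hh : IsVariation K h := ⟨hs, hsymm, fun p hp v w => by rw [h0 p hp]; rfl⟩
    have := key K hK h hh
    rwa [hst K hK h hh, mul_zero] at this

/-- Near every point of `K \ S` the variation vanishes, so by locality only `S` contributes, and `S`
lies in one chart. The half comes from `gradient` being twice the gradient. -/
theorem hasDerivAt_energyLine_of_chart {g h : TwoTensor n M} (hg : IsMetric g) {K S : Set M}
    (hK : IsCompact K) (hS : IsCompact S) (hSK : S ⊆ K) (hh : IsVariation S h) (t : ℝ) {c : M}
    (hSc : S ⊆ (extChartAt (𝓡 n) c).source) :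
    HasDerivAt (energyLine t g h K)
      (1 / 2 * ∫ y in chartImage c S, √(g.coeff c y).det *
        pairing (g.coeff c) (fun i j => gradient t (g.coeff c) i j y) (h.coeff c y) y) 0 := by
  have hSm := hS.isClosed.measurableSet
  have hKm := hK.isClosed.measurableSet
  have hhK := hh.mono hSK
  have r1 := isRegular_of_subset hg hK t hSm hSK
  have r2 := isRegular_of_subset hg hK t (hKm.diff hSm) Set.sdiff_subset
  have d1 := (hasDerivAt_energyLine hg hK hhK t hSm subset_rfl hS hSc).2
  have d2 := (r2.differentiable h hhK).hasDerivAt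
  rw [r2.local_zero h hhK fun p hp => by
    filter_upwards [hS.isClosed.isOpen_compl.mem_nhds hp.2] with q hq
    exact hh.zero q hq] at d2
  have hI := integral_firstVar (isOpen_extChartAt_target c) (hg.localTensor c)
    (fun y hy => hg.det_pos c hy) (hh.localTensor c) t (isCompact_chartImage hS hSc)
    Set.inter_subset_left fun y hy hy' =>
      Matrix.ext fun i j => hh.zero _ (fun hS' => hy' ⟨hy, hS'⟩) _ _
  rw [← hI, ← mul_assoc, one_div, inv_mul_cancel₀ two_ne_zero, one_mul]
  have d := d1.add d2
  rw [add_zero] at d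
  refine d.congr_of_eventuallyEq ?_
  filter_upwards [hg.eventually_line hK hhK] with s hs
  have := (r1.integrable _ hs).energy_union (r2.integrable _ hs) disjoint_sdiff_self_right
    (hKm.diff hSm) t
  rw [Set.union_sdiff_cancel hSK] at this
  exact this

theorem IsStationary.gradient_eq_zero {g : TwoTensor n M} (hg : IsMetric g) {t : ℝ}
    (hst : IsStationary t g) (c : M) {y : EuclideanSpace ℝ (Fin n)}
    (hy : y ∈ (extChartAt (𝓡 n) c).target) (i j : Fin n) : gradient t (g.coeff c) i j y = 0 := by
  have hU := isOpen_extChartAt_target (I := 𝓡 n) c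
  have hpos : ∀ y ∈ (extChartAt (𝓡 n) c).target, 0 < (g.coeff c y).det := fun y hy => hg.det_pos c hy
  have hG := hg.localTensor c
  refine eq_zero_of_pairing (hpos y hy) (hG.symm y hy)
    (fun i j => gradient_comm hU hG t hy (hpos y hy) i j) (fun a b => ?_) i j
  set f : EuclideanSpace ℝ (Fin n) → ℝ := fun y => √(g.coeff c y).det *
    pairing (g.coeff c) (fun i j => gradient t (g.coeff c) i j y) (symMatrix a b) y
  have hf : ContinuousOn f (extChartAt (𝓡 n) c).target :=
    hG.continuousOn_det.sqrt.mul (contDiffOn_pairing_gradient hU hG hpos t _).continuousOn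
  -- The fundamental lemma of the calculus of variations, tested with bump variations; continuity of
  -- `f` then removes the exceptional null set.
  have hae : ∀ᵐ x, x ∈ (extChartAt (𝓡 n) c).target → f x = 0 := by
    refine hU.ae_eq_zero_of_integral_contDiff_smul_eq_zero
      (hf.locallyIntegrableOn hU.measurableSet) fun φ hφ hφc hφs => ?_
    obtain ⟨h, hh, hcoeff⟩ := exists_bump_variation c a b hφ hφc hφs
    set S := (extChartAt (𝓡 n) c).symm '' tsupport φ
    have hS : IsCompact S :=
      hφc.isCompact.image_of_continuousOn ((continuousOn_extChartAt_symm c).mono hφs)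
    have hSc : S ⊆ (extChartAt (𝓡 n) c).source := by
      rintro _ ⟨y, hy, rfl⟩
      exact (extChartAt (𝓡 n) c).map_target (hφs hy)
    have h1 := (hasDerivAt_energyLine_of_chart hg hS hS subset_rfl hh t hSc).deriv
    rw [hst S hS h hh] at h1
    have h2 : ∫ y in chartImage c S, φ y • f y = 0 := by
      refine Eq.trans (setIntegral_congr_fun
        (isCompact_chartImage hS hSc).isClosed.measurableSet fun y hy => ?_)
        ((mul_eq_zero.1 h1.symm).resolve_left (by norm_num))
      simp only [hcoeff y hy.1, pairing_smul_right, f, smul_eq_mul]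
      ring
    rw [← h2]
    refine (setIntegral_eq_integral_of_forall_compl_eq_zero fun y hy => ?_).symm
    have : φ y = 0 := image_eq_zero_of_notMem_tsupport fun hyφ =>
      hy ⟨hφs hyφ, ⟨y, hyφ, rfl⟩⟩
    rw [this, zero_smul]
  have h0 : f y = 0 := Measure.eqOn_open_of_ae_eq (μ := volume) (g := fun _ => (0 : ℝ))
    ((ae_restrict_iff' hU.measurableSet).2 hae) hU hf continuousOn_const hy
  exact (mul_eq_zero.1 h0).resolve_left (Real.sqrt_pos.2 (hpos y hy)).ne'

/-- A partition of unity subordinate to the chart domains splits `h` into pieces with zero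
derivative, and the derivative is additive. Mere linearity is not enough: each piece must fit in one
chart. -/
theorem isStationary_of_gradient {g : TwoTensor n M} (hg : IsMetric g) {t : ℝ}
    (hgrad : ∀ c : M, ∀ y ∈ (extChartAt (𝓡 n) c).target, ∀ i j, gradient t (g.coeff c) i j y = 0) :
    IsStationary t g := by
  classical
  intro K hK h hh
  have : LocallyCompactSpace M := ChartedSpace.locallyCompactSpace (EuclideanSpace ℝ (Fin n)) M
  obtain ⟨ρ, hρ⟩ := SmoothPartitionOfUnity.exists_isSubordinate_chartAt_source (𝓡 n) M
  have hreg := isRegular_of_subset hg hK t hK.isClosed.measurableSet subset_rfl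
  have hpart : ∀ F : Finset M, IsVariation K (fun p => (∑ c ∈ F, ρ c p) • h p) ∧
      deriv (energyLine t g (fun p => (∑ c ∈ F, ρ c p) • h p) K) 0 = 0 := by
    intro F
    induction F using Finset.induction_on with
    | empty =>
      have h0 : ∀ (p : M) v w, ((∑ c ∈ (∅ : Finset M), ρ c p) • h p) v w = 0 := fun p v w => by
        rw [bilin_smul_apply, Finset.sum_empty, zero_mul]
      have hv : IsVariation K (fun p => (∑ c ∈ (∅ : Finset M), ρ c p) • h p) := by
        have := (hh.mul (f := fun p => ∑ c ∈ (∅ : Finset M), ρ c p)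
          (by simpa using contMDiff_const)).mono (Set.inter_subset_right (t := K))
        exact this
      exact ⟨hv, hreg.local_zero _ hv fun p _ => Filter.Eventually.of_forall fun q => h0 q⟩
    | insert c F hc ih =>
      have he : (fun p => (∑ c ∈ insert c F, ρ c p) • h p) =
          fun p => ρ c p • h p + (∑ c ∈ F, ρ c p) • h p := by
        funext p
        refine bilin_ext fun v w => ?_
        rw [bilin_add_apply, bilin_smul_apply, bilin_smul_apply, bilin_smul_apply,
          Finset.sum_insert hc, add_mul]
      have hv := hh.mul (ρ c).contMDiff
      have hS : IsCompact (tsupport (ρ c) ∩ K) := hK.inter_left (isClosed_tsupport _)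
      have hSc : tsupport (ρ c) ∩ K ⊆ (extChartAt (𝓡 n) c).source := by
        rw [extChartAt_source]
        exact Set.inter_subset_left.trans (hρ c)
      have hd := (hasDerivAt_energyLine_of_chart hg hK hS Set.inter_subset_right hv t hSc).deriv
      rw [setIntegral_eq_zero_of_forall_eq_zero fun y hy => by
        simp [pairing, hgrad c y hy.1], mul_zero] at hd
      have hv' := hv.mono (Set.inter_subset_right (t := K))
      rw [he]
      exact ⟨hv'.add ih.1, by rw [hreg.additive _ _ hv' ih.1, hd, ih.2, add_zero]⟩
  -- Local finiteness leaves finitely many functions on `K`, and their sum there is one.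
  have hfin := ρ.locallyFinite.finite_nonempty_inter_compact hK
  have he : (fun p => (∑ c ∈ hfin.toFinset, ρ c p) • h p) = h := by
    funext p
    refine bilin_ext fun v w => ?_
    rw [bilin_smul_apply]
    by_cases hp : p ∈ K
    · have h1 := ρ.sum_eq_one (Set.mem_univ p)
      rw [finsum_eq_sum_of_support_subset (s := hfin.toFinset) _ (fun c hc => by
        rw [Set.Finite.coe_toFinset]
        exact ⟨p, hc, hp⟩)] at h1
      rw [h1, one_mul]
    · rw [hh.zero p hp, mul_zero]
  have := (hpart hfin.toFinset).2
  rwa [he] at this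

theorem isStationary_iff {g : TwoTensor n M} (hg : IsMetric g) {t : ℝ} :
    IsStationary t g ↔ ∀ c : M, ∀ y ∈ (extChartAt (𝓡 n) c).target, ∀ i j,
      gradient t (g.coeff c) i j y = 0 :=
  ⟨fun h c _ hy i j => h.gradient_eq_zero hg c hy i j, isStationary_of_gradient hg⟩

theorem isCritical_functionalF_iff {g : TwoTensor n M} (hg : IsMetric g) (t : ℝ) :
    IsCritical (functionalF t) g ↔ ∀ c : M, ∀ y ∈ (extChartAt (𝓡 n) c).target, ∀ i j,
      gradient t (g.coeff c) i j y = 0 := by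
  rw [← isStationary_iff hg]
  refine isCritical_iff_isStationary one_ne_zero (fun g' hg' K hK => ?_) hg
  rw [one_mul]
  exact ((isRegular_of_subset hg' hK t hK.isClosed.measurableSet subset_rfl).integrable
    g' hg').functionalF_eq t

end Stationary

/-! ### The functional of $\sigma_2$ in dimension three -/

section SigmaTwo

variable {M : Type*} [TopologicalSpace M] [ChartedSpace (EuclideanSpace ℝ (Fin 3)) M]
  [MeasurableSpace M] [IsManifold (𝓡 3) ∞ M] [BorelSpace M] [SecondCountableTopology M] [T2Space M]

/-- On metrics this functional is $-\frac12$ times the energy with $t=-\frac38$, even at the level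
of integrands. -/
theorem isCritical_functionalSigmaTwo_iff {g : TwoTensor 3 M} (hg : IsMetric g) :
    IsCritical functionalSigmaTwo g ↔ ∀ c : M, ∀ y ∈ (extChartAt (𝓡 3) c).target, ∀ i j,
      gradient (-3 / 8) (g.coeff c) i j y = 0 := by
  rw [← isStationary_iff hg]
  refine isCritical_iff_isStationary (a := -(1 / 2)) (by norm_num) (fun g' hg' K hK => ?_) hg
  rw [energy, functionalSigmaTwo, ← integral_const_mul]
  congr 1
  funext p
  have := sigmaTwo_schouten_of_dim_three (isOpen_extChartAt_target p) (hg'.localTensor p)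
    (mem_extChartAt_target p) (hg'.posDef p (mem_extChartAt_target p))
  rw [sigmaTwoSchouten, this, lagr, ricNormSq, scalarCurvature]
  ring

end SigmaTwo

theorem isMetric_inner {n : ℕ} {M : Type*} [TopologicalSpace M]
    [ChartedSpace (EuclideanSpace ℝ (Fin n)) M] [IsManifold (𝓡 n) ∞ M]
    (g : Bundle.ContMDiffRiemannianMetric (𝓡 n) ∞ (EuclideanSpace ℝ (Fin n))
      (fun p : M => TangentSpace (𝓡 n) p)) : IsMetric g.inner :=
  ⟨g.contMDiff, g.symm, g.pos⟩

end QuadraticCurvature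

end

/-! ### The Euler–Lagrange equations on the manifold -/

open QuadraticCurvature in
theorem proposition2p2 {n : ℕ} (hn : 3 ≤ n) {M : Type*} [TopologicalSpace M] [T2Space M]
    [SecondCountableTopology M] [ChartedSpace (EuclideanSpace ℝ (Fin n)) M] [IsManifold (𝓡 n) ∞ M]
    [MeasurableSpace M] [BorelSpace M]
    (g : Bundle.ContMDiffRiemannianMetric (𝓡 n) ∞ (EuclideanSpace ℝ (Fin n))
      (fun p : M => TangentSpace (𝓡 n) p)) :
    (∀ t : ℝ, IsCritical (functionalF t) g.inner ↔
      ∀ c : M, ∀ y ∈ (extChartAt (𝓡 n) c).target,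
        let G := TwoTensor.coeff g.inner c
        let E := tracelessRic G
        let R := scal G
        (∀ i j : Fin n,
          tensorLap G E i j y =
            (1 + 2 * t) * hess G R i j y
              - (n + 2 + 4 * n * t) / (2 * n) * lap G R y * G y i j
              - 2 * riemContract G E i j y
              - (2 + 2 * n * t) / n * R y * E y i j
              + 1 / 2 * (normSq G (ric G) y - (4 - n * (n - 4) * t) / n ^ 2 * R y ^ 2) * G y i j) ∧
        (n + 4 * (n - 1) * t) * lap G R y = (n - 4) * (normSq G (ric G) y + t * R y ^ 2)) ∧
    (n = 3 → (IsCritical functionalSigmaTwo g.inner ↔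
      ∀ c : M, ∀ y ∈ (extChartAt (𝓡 n) c).target,
        let G := TwoTensor.coeff g.inner c
        let E := tracelessRic G
        let R := scal G
        (∀ i j : Fin n,
          tensorLap G E i j y =
            1 / 4 * hess G R i j y
              - 1 / 12 * lap G R y * G y i j
              + 4 * comp G E E i j y
              + 5 / 12 * R y * E y i j
              - 1 / 2 * (3 * normSq G E y - 1 / 72 * R y ^ 2) * G y i j) ∧
        -2 * sigmaTwo G (schouten G) y = normSq G (ric G) y - 3 / 8 * R y ^ 2 ∧
        normSq G (ric G) y - 3 / 8 * R y ^ 2 = normSq G E y - 1 / 24 * R y ^ 2 ∧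
        normSq G E y - 1 / 24 * R y ^ 2 = 0)) := by
  refine ⟨fun t => ?_, fun h3 => ?_⟩
  · rw [isCritical_functionalF_iff (isMetric_inner g)]
    exact forall_congr' fun c => forall_congr' fun y => forall_congr' fun hy =>
      (eulerLagrange_iff (by omega) (isOpen_extChartAt_target c) ((isMetric_inner g).localTensor c)
        hy ((isMetric_inner g).det_pos c hy) t).symm
  · subst h3
    rw [isCritical_functionalSigmaTwo_iff (isMetric_inner g)]
    exact forall_congr' fun c => forall_congr' fun y => forall_congr' fun hy =>
      (eulerLagrange_sigmaTwo_iff (isOpen_extChartAt_target c) ((isMetric_inner g).localTensor c)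
        hy ((isMetric_inner g).posDef c hy)).symm
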